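/- **Setting.** Let $(\mathcal S,\mathcal A,P,\rho,\{r_i\}_{i=0}^m,\gamma)$ be a discounted constrained Markov decision process with measurable state and action spaces, $m\ge 1$ constraints, $r_0\in[0,1]$, $r_i\in[-1,1]$ for $i\in[m]$, $\gamma\in(0,1)$. For a stationary policy $\pi$ put $V_i^\pi(\rho)=\mathbb E[\sum_{t\ge 0}\gamma^t r_i(s_t,a_t)]$, and let $d_\rho^\pi=(1-\gamma)\sum_t\gamma^t\,\mathrm{Law}(s_t,a_t)$. Let $\pi^*$ be an optimal stationary policy: it maximizes $V_0^\pi(\rho)$ among all stationary policies with $V_i^\pi(\rho)\ge 0$, $i\in[m]$. Let $\{\pi_\theta\}_{\theta\in\mathbb R^d}$ be policies with positive densities $\pi_\theta(a|s)$ with respect to a $\sigma$-finite measure on $\mathcal A$, with $\log\pi_\theta(a|s)$ differentiable in $\theta$; write $V_i^\theta=V_i^{\pi_\theta}(\rho)$ and $\Theta=\{\theta: V_i^\theta\ge 0\ \forall i\in[m]\}$. Let $A_i^\theta$ be the advantage function of $\pi_\theta$ for $r_i$, $F^\theta=\mathbb E_{d_\rho^{\pi_\theta}}[\nabla\log\pi_\theta\,\nabla\log\pi_\theta^{T}]$,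 and $\mu_i^*=(F^\theta)^\dagger\nabla V_i^\theta$ with the Moore–Penrose inverse. **Assumptions.** There are constants $M_g,M_h,\nu_s,\nu_{\rm emf},\ell,\mu_F>0$, $\varepsilon_{\rm bias}\ge 0$ and a starting point $\theta_0$ such that: (1) for all $\theta\in\Theta$ and all $(s,a)$, the second derivative of $\theta\mapsto\log\pi_\theta(a|s)$ exists, $\|\nabla\log\pi_\theta(a|s)\|\le M_g$ and $\|\nabla^2\log\pi_\theta(a|s)\|\le M_h$; (2) (Slater) $V_i^{\theta_0}\ge\nu_s$ for all $i\in[m]$; (3) (extended MFCQ) $\nu_{\rm emf}\le\nu_s$, and for every $\theta\in\Theta$ there is a unit vector $s_\theta$ with $\langle s_\theta,\nabla V_i^\theta\rangle>\ell$ for all $i\in[m]$ with $0<V_i^\theta\le\nu_{\rm emf}$; moreover $\ell\le L$ with $L=M_g/(1-\gamma)^2$ (automatic unless the condition on $\ell$ is vacuous); (4) (relaxed Fisher non-degeneracy) for every $\theta\in\Theta$ all nonzero eigenvalues of $F^\theta$ are $\ge\mu_F$; (5) (bounded transfer error) $\mathbb E_{(s,a)\sim d_\rho^{\pi^*}}[(A_i^\theta(s,a)-(1-\gamma)\langle\mu_i^*,\nabla\log\pi_\theta(a|s)\rangle)^2]\le\varepsilon_{\rm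 bias}$ for all $\theta\in\Theta$, $i\in\{0,\dots,m\}$. **Algorithm (LB-SGD)** with parameters $\eta>0$, $\delta\in(0,1]$, $n,H,T\in\mathbb N$. At iteration $t=0,\dots,T-1$ sample $n$ independent trajectories of length $H$ with $\pi_{\theta_t}$, form $\hat V_i=\frac1n\sum_{j=1}^n\sum_{k<H}\gamma^k r_i(s_k^j,a_k^j)$, $\hat\nabla V_i=\frac1n\sum_{j=1}^n\sum_{k<H}\sum_{k'\le k}\gamma^k r_i(s_k^j,a_k^j)\nabla\log\pi_{\theta_t}(a_{k'}^j|s_{k'}^j)$ and $\hat g=\hat\nabla V_0+\eta\sum_{i=1}^m\hat\nabla V_i/\hat V_i$. If $\|\hat g\|\le\eta/2$, stop and return $\theta_{\rm out}=\theta_t$ (later iterates are then set to $\theta_t$). Otherwise $\theta_{t+1}=\theta_t+\gamma_t\hat g$ with $$\gamma_t=\min\Big\{\frac1{\hat M_t},\ \min_{i\in[m]}\frac{\underline\alpha_i}{\sqrt{M\underline\alpha_i}+2|\overline\beta_i|}\cdot\frac1{\|\hat g\|}\Big\},\qquad \hat M_t=M+\sum_{i=1}^m\frac{10M\eta}{\underline\alpha_i}+8\eta\sum_{i=1}^m\frac{\overline\beta_i^2}{\underline\alpha_i^2},$$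 where $M=\frac{M_g^2+M_h}{(1-\gamma)^2}$, $\underline\alpha_i=\hat V_i-\frac{\sqrt2}{\sqrt n(1-\gamma)}\sqrt{\ln\frac2\delta}-\frac{\gamma^H}{1-\gamma}$ and $\overline\beta_i=|\langle\hat\nabla V_i,\hat g/\|\hat g\|\rangle|+\frac{2\sqrt2M_g}{\sqrt n(1-\gamma)^{3/2}}\sqrt{\ln\frac{e^{1/4}}\delta}+\frac{M_g\gamma^H}{1-\gamma}\sqrt{\frac1{1-\gamma}+H}$. If it never stops, $\theta_{\rm out}=\theta_T$. **Theorem.** There are positive constants $K_1,K_2,K_4,K_n$ depending only on $m,M_g,M_h$, a constant $K_H>0$ depending only on these and $\gamma$, and a constant $K_3>0$ depending only on these, $\gamma$ and $\ell$, such that under the assumptions above, whenever $0<\eta\le\nu_{\rm emf}$, $\delta\in(0,1]$, $T\in\mathbb N$, $$n\ge K_n\,\frac{\ln(2/\delta)}{\eta^{4}\ell^{4m}(1-\gamma)^{6+8m}},\qquad H\ge K_H\max\{1,\ln\tfrac1{\ell\eta}\},$$ the following holds. 1. $\mathbb P\big(\forall t\in\{0,\dots,T\}:\ \min_{i\in[m]}V_i^{\theta_t}\ge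 0\big)\ge 1-mT\delta$. 2. With probability at least $1-mT\delta$, $$V_0^{\pi^*}(\rho)-V_0^{\theta_{\rm out}}\le K_1\frac{\sqrt{\varepsilon_{\rm bias}}}{\ell^m(1-\gamma)^{2m+1}}+K_2\frac{\eta}{\mu_F}+K_3\,\eta\max\{1,\ln\tfrac1\eta\}+K_4\,e^{-C\mu_FT\eta^2}\big(V_0^{\pi^*}(\rho)-V_0^{\theta_0}\big),$$ where $c=\Big(\frac{\ell(1-\gamma)^2}{4M_g(1+\frac{4m}3)}\Big)^m$ and $C=\dfrac{c}{2L^2(1+\frac mc)\max\{4+\frac{5Mc}{L^2},\,1+\sqrt{\frac{Mc}{4L^2}}\}}$. -/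

import Mathlib

open MeasureTheory ProbabilityTheory

universe u v w

noncomputable section

/-! ### Constrained Markov decision processes -/

/-- A discounted constrained Markov decision process with state space `S`, action space `A`,
`m` constraints and discount factor `γ`: transition kernel `P`, initial distribution `ρ`,
reward `r 0` with values in `[0, 1]` and utilities `r i.succ`, `i : Fin m`, with values
in `[-1, 1]`. -/
structure CMDP (S : Type u) (A : Type v) [MeasurableSpace S] [MeasurableSpace A]
    (m : ℕ) (γ : ℝ) where
  P : Kernel (S × A) S
  markov_P : IsMarkovKernel P
  ρ : Measure S
  prob_ρ : IsProbabilityMeasure ρ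
  r : Fin (m + 1) → S × A → ℝ
  measurable_r : ∀ i, Measurable (r i)
  r_zero_nonneg : ∀ x, 0 ≤ r 0 x
  abs_r_le_one : ∀ i x, |r i x| ≤ 1
  γ_pos : 0 < γ
  γ_lt_one : γ < 1

attribute [instance] CMDP.markov_P CMDP.prob_ρ

namespace CMDP

variable {S : Type u} {A : Type v} [MeasurableSpace S] [MeasurableSpace A] {m : ℕ} {γ : ℝ}

/-- One step of the state-action chain under the stationary policy `π`:
from `(s, a)` draw `s' ∼ P(· | s, a)` and then `a' ∼ π(· | s')`. -/
def step (𝓜 : CMDP S A m γ) (π : Kernel S A) [IsMarkovKernel π] : Kernel (S × A) (S × A) :=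
  𝓜.P ⊗ₖ Kernel.prodMkLeft (S × A) π

instance (𝓜 : CMDP S A m γ) (π : Kernel S A) [IsMarkovKernel π] :
    IsMarkovKernel (𝓜.step π) := by
  unfold step; infer_instance

/-- The law of the trajectory `(s₀, a₀), (s₁, a₁), …` when `(s₀, a₀) ∼ μ₀` and the policy `π`
is followed afterwards (Ionescu-Tulcea). -/
def traj (𝓜 : CMDP S A m γ) (π : Kernel S A) [IsMarkovKernel π] (μ₀ : Measure (S × A)) :
    Measure (ℕ → S × A) :=
  Kernel.trajMeasure (X := fun _ : ℕ => S × A) μ₀ fun n =>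
    (𝓜.step π).comap (fun h : (i : Finset.Iic n) → S × A => h ⟨n, Finset.mem_Iic.2 le_rfl⟩)
      (measurable_pi_apply _)

/-- The discounted return of a trajectory with respect to `r i`. -/
def ret (𝓜 : CMDP S A m γ) (i : Fin (m + 1)) (τ : ℕ → S × A) : ℝ :=
  ∑' t : ℕ, γ ^ t * 𝓜.r i (τ t)

/-- The performance measure `V_i^π(ρ)`. -/
def value (𝓜 : CMDP S A m γ) (i : Fin (m + 1)) (π : Kernel S A) [IsMarkovKernel π] : ℝ :=
  ∫ τ, 𝓜.ret i τ ∂(𝓜.traj π (𝓜.ρ ⊗ₘ π))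

/-- The state value function `V_i^π(s)`. -/
def stateValue (𝓜 : CMDP S A m γ) (i : Fin (m + 1)) (π : Kernel S A) [IsMarkovKernel π]
    (s : S) : ℝ :=
  ∫ τ, 𝓜.ret i τ ∂(𝓜.traj π (Measure.dirac s ⊗ₘ π))

/-- The state-action value function `Q_i^π(s, a)`. -/
def actionValue (𝓜 : CMDP S A m γ) (i : Fin (m + 1)) (π : Kernel S A) [IsMarkovKernel π]
    (x : S × A) : ℝ :=
  ∫ τ, 𝓜.ret i τ ∂(𝓜.traj π (Measure.dirac x))

/-- The advantage function `A_i^π(s, a) = Q_i^π(s, a) - V_i^π(s)`. -/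
def advantage (𝓜 : CMDP S A m γ) (i : Fin (m + 1)) (π : Kernel S A) [IsMarkovKernel π]
    (x : S × A) : ℝ :=
  𝓜.actionValue i π x - 𝓜.stateValue i π x.1

/-- The discounted state-action visitation distribution
`d_ρ^π = (1 - γ) ∑ₜ γᵗ Law(s_t, a_t)`. -/
def visitation (𝓜 : CMDP S A m γ) (π : Kernel S A) [IsMarkovKernel π] : Measure (S × A) :=
  Measure.sum fun t : ℕ =>
    ENNReal.ofReal ((1 - γ) * γ ^ t) • (𝓜.traj π (𝓜.ρ ⊗ₘ π)).map fun τ => τ t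

/-- `π` is an optimal stationary policy: it maximizes `V_0` among all stationary policies
(not only the parameterized ones) with `V_i ≥ 0` for every constraint `i`. -/
def IsOptimalPolicy (𝓜 : CMDP S A m γ) (π : Kernel S A) [IsMarkovKernel π] : Prop :=
  (∀ i : Fin m, 0 ≤ 𝓜.value i.succ π) ∧
    ∀ (π' : Kernel S A) [IsMarkovKernel π'],
      (∀ i : Fin m, 0 ≤ 𝓜.value i.succ π') → 𝓜.value 0 π' ≤ 𝓜.value 0 π

end CMDP

/-! ### Parameterized policies -/

/-- A parameterized family of stationary policies `π_θ`, `θ ∈ ℝ^d`, given by positive densities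
`dens θ s a = π_θ(a | s)` with respect to a `σ`-finite base measure on the actions (counting
measure for finitely many actions), with `log π_θ(a | s)` differentiable in `θ`. -/
structure PolicyClass (S : Type u) (A : Type v) [MeasurableSpace S] [MeasurableSpace A]
    (d : ℕ) where
  base : Measure A
  sigmaFinite_base : SigmaFinite base
  dens : EuclideanSpace ℝ (Fin d) → S → A → ℝ
  measurable_dens : ∀ θ, Measurable (Function.uncurry (dens θ))
  dens_pos : ∀ θ s a, 0 < dens θ s a
  lintegral_dens : ∀ θ s, ∫⁻ a, ENNReal.ofReal (dens θ s a) ∂base = 1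
  differentiable_log_dens : ∀ s a, Differentiable ℝ fun θ => Real.log (dens θ s a)

attribute [instance] PolicyClass.sigmaFinite_base

namespace PolicyClass

variable {S : Type u} {A : Type v} [MeasurableSpace S] [MeasurableSpace A] {d : ℕ}

/-- The policy `π_θ` as a Markov kernel. -/
def policy (𝓟 : PolicyClass S A d) (θ : EuclideanSpace ℝ (Fin d)) : Kernel S A :=
  (Kernel.const S 𝓟.base).withDensity fun s a => ENNReal.ofReal (𝓟.dens θ s a)

instance (𝓟 : PolicyClass S A d) (θ : EuclideanSpace ℝ (Fin d)) :
    IsMarkovKernel (𝓟.policy θ) := by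
  have hm : Measurable (Function.uncurry fun s a => ENNReal.ofReal (𝓟.dens θ s a)) :=
    (𝓟.measurable_dens θ).ennreal_ofReal
  refine ⟨fun s => ⟨?_⟩⟩
  rw [policy, Kernel.withDensity_apply _ hm, withDensity_apply _ MeasurableSet.univ,
    Measure.restrict_univ, Kernel.const_apply]
  exact 𝓟.lintegral_dens θ s

/-- The score `∇_θ log π_θ(a | s)` at `x = (s, a)`. -/
def score (𝓟 : PolicyClass S A d) (θ : EuclideanSpace ℝ (Fin d)) (x : S × A) :
    EuclideanSpace ℝ (Fin d) :=
  gradient (fun θ' => Real.log (𝓟.dens θ' x.1 x.2)) θ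

end PolicyClass

/-- The Moore-Penrose inverse of a real symmetric matrix: every nonzero eigenvalue is inverted
and the kernel is sent to `0` (recall `0⁻¹ = 0`). -/
def symmPinv {d : ℕ} (F : Matrix (Fin d) (Fin d) ℝ) : Matrix (Fin d) (Fin d) ℝ :=
  cfc (fun x : ℝ => x⁻¹) F

namespace CMDP

variable {S : Type u} {A : Type v} [MeasurableSpace S] [MeasurableSpace A] {m : ℕ} {γ : ℝ} {d : ℕ}

/-- `V_i^θ(ρ)`. -/
def V (𝓜 : CMDP S A m γ) (𝓟 : PolicyClass S A d) (i : Fin (m + 1))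
    (θ : EuclideanSpace ℝ (Fin d)) : ℝ :=
  𝓜.value i (𝓟.policy θ)

/-- The feasible parameter set `Θ`. -/
def feasible (𝓜 : CMDP S A m γ) (𝓟 : PolicyClass S A d) : Set (EuclideanSpace ℝ (Fin d)) :=
  {θ | ∀ i : Fin m, 0 ≤ 𝓜.V 𝓟 i.succ θ}

/-- The Fisher information matrix `F^θ(ρ)`. -/
def fisher (𝓜 : CMDP S A m γ) (𝓟 : PolicyClass S A d) (θ : EuclideanSpace ℝ (Fin d)) :
    Matrix (Fin d) (Fin d) ℝ :=
  Matrix.of fun k l => ∫ x, 𝓟.score θ x k * 𝓟.score θ x l ∂(𝓜.visitation (𝓟.policy θ))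

/-- `μ_i^* = F^θ(ρ)^† ∇_θ V_i^θ(ρ)`. -/
def naturalGradient (𝓜 : CMDP S A m γ) (𝓟 : PolicyClass S A d) (i : Fin (m + 1))
    (θ : EuclideanSpace ℝ (Fin d)) : EuclideanSpace ℝ (Fin d) :=
  WithLp.toLp 2
    (Matrix.mulVec (symmPinv (𝓜.fisher 𝓟 θ)) (WithLp.ofLp (gradient (𝓜.V 𝓟 i) θ)))

/-- The transfer error `L(μ_i^*, θ, d_ρ^{π})`. -/
def transferError (𝓜 : CMDP S A m γ) (𝓟 : PolicyClass S A d) (i : Fin (m + 1))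
    (θ : EuclideanSpace ℝ (Fin d)) (π : Kernel S A) [IsMarkovKernel π] : ℝ :=
  ∫ x, (𝓜.advantage i (𝓟.policy θ) x
      - (1 - γ) * inner ℝ (𝓜.naturalGradient 𝓟 i θ) (𝓟.score θ x)) ^ 2 ∂(𝓜.visitation π)

/-! ### Assumptions -/

/-- On the feasible set the gradient and the Hessian of `θ ↦ log π_θ(a | s)` exist and are
bounded by `Mg` and `Mh`, for all `(s, a)`. -/
def BoundedScore (𝓜 : CMDP S A m γ) (𝓟 : PolicyClass S A d) (Mg Mh : ℝ) : Prop :=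
  ∀ θ ∈ 𝓜.feasible 𝓟, ∀ x : S × A,
    ‖𝓟.score θ x‖ ≤ Mg ∧
    DifferentiableAt ℝ (fun θ' => 𝓟.score θ' x) θ ∧
    ‖fderiv ℝ (fun θ' => 𝓟.score θ' x) θ‖ ≤ Mh

/-- Slater's condition at the starting point `θ₀`. -/
def Slater (𝓜 : CMDP S A m γ) (𝓟 : PolicyClass S A d) (θ₀ : EuclideanSpace ℝ (Fin d))
    (νs : ℝ) : Prop :=
  0 < νs ∧ ∀ i : Fin m, νs ≤ 𝓜.V 𝓟 i.succ θ₀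

/-- The extended Mangasarian-Fromovitz constraint qualification. -/
def ExtendedMFCQ (𝓜 : CMDP S A m γ) (𝓟 : PolicyClass S A d) (νemf ℓ : ℝ) : Prop :=
  ∀ θ ∈ 𝓜.feasible 𝓟, ∃ s : EuclideanSpace ℝ (Fin d), ‖s‖ = 1 ∧
    ∀ i : Fin m, 0 < 𝓜.V 𝓟 i.succ θ → 𝓜.V 𝓟 i.succ θ ≤ νemf →
      ℓ < inner ℝ s (gradient (𝓜.V 𝓟 i.succ) θ)

/-- Relaxed Fisher non-degeneracy: on the feasible set, all nonzero eigenvalues of the Fisher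
information matrix (which is positive semidefinite) are at least `μF`. -/
def RelaxedFisher (𝓜 : CMDP S A m γ) (𝓟 : PolicyClass S A d) (μF : ℝ) : Prop :=
  ∀ θ ∈ 𝓜.feasible 𝓟, ∀ c : ℝ, c ≠ 0 →
    Module.End.HasEigenvalue (Matrix.toLin' (𝓜.fisher 𝓟 θ)) c → μF ≤ c

/-- Bounded transfer error. -/
def BoundedTransferError (𝓜 : CMDP S A m γ) (𝓟 : PolicyClass S A d) (πopt : Kernel S A)
    [IsMarkovKernel πopt] (εbias : ℝ) : Prop :=
  ∀ θ ∈ 𝓜.feasible 𝓟, ∀ i : Fin (m + 1), 𝓜.transferError 𝓟 i θ πopt ≤ εbias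

end CMDP

/-! ### The LB-SGD algorithm -/

/-- The inputs of LB-SGD other than the number of iterations and the starting point: bounds on
the score and its derivative, barrier parameter, confidence level, batch size, horizon. -/
structure LBParams where
  Mg : ℝ
  Mh : ℝ
  η : ℝ
  δ : ℝ
  n : ℕ
  H : ℕ

namespace LBSGD

variable {S : Type u} {A : Type v} [MeasurableSpace S] [MeasurableSpace A] {m : ℕ} {γ : ℝ} {d : ℕ}

/-- A batch of `n` trajectories truncated at horizon `H`. -/
abbrev Batch (S : Type u) (A : Type v) (p : LBParams) : Type (max u v) :=
  Fin p.n → Fin p.H → S × A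

/-- The law of a batch of `n` independent truncated trajectories sampled with `π_θ`. -/
def batchLaw (𝓜 : CMDP S A m γ) (𝓟 : PolicyClass S A d) (p : LBParams)
    (θ : EuclideanSpace ℝ (Fin d)) : Measure (Batch S A p) :=
  Measure.pi fun _ : Fin p.n =>
    (𝓜.traj (𝓟.policy θ) (𝓜.ρ ⊗ₘ 𝓟.policy θ)).map fun τ (t : Fin p.H) => τ t

/-- The estimator of `V_i^θ(ρ)`. -/
def valueEst (𝓜 : CMDP S A m γ) (p : LBParams) (i : Fin (m + 1)) (b : Batch S A p) : ℝ :=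
  (1 / (p.n : ℝ)) * ∑ j, ∑ t : Fin p.H, γ ^ (t : ℕ) * 𝓜.r i (b j t)

/-- The GPOMDP estimator of `∇_θ V_i^θ(ρ)`. -/
def gradEst (𝓜 : CMDP S A m γ) (𝓟 : PolicyClass S A d) (p : LBParams)
    (θ : EuclideanSpace ℝ (Fin d)) (i : Fin (m + 1)) (b : Batch S A p) :
    EuclideanSpace ℝ (Fin d) :=
  (1 / (p.n : ℝ)) • ∑ j, ∑ t : Fin p.H, ∑ t' ∈ Finset.Iic t,
    (γ ^ (t : ℕ) * 𝓜.r i (b j t)) • 𝓟.score θ (b j t')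

/-- The estimator of the log barrier gradient `∇_θ B_η^θ(ρ)`. -/
def barrierGradEst (𝓜 : CMDP S A m γ) (𝓟 : PolicyClass S A d) (p : LBParams)
    (θ : EuclideanSpace ℝ (Fin d)) (b : Batch S A p) : EuclideanSpace ℝ (Fin d) :=
  gradEst 𝓜 𝓟 p θ 0 b
    + p.η • ∑ i : Fin m, (valueEst 𝓜 p i.succ b)⁻¹ • gradEst 𝓜 𝓟 p θ i.succ b

/-- The Lipschitz constant `L = M_g / (1 - γ)²`. -/
def lipConst (γ Mg : ℝ) : ℝ := Mg / (1 - γ) ^ 2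

/-- The smoothness constant `M = (M_g² + M_h) / (1 - γ)²`. -/
def smoothConst (γ Mg Mh : ℝ) : ℝ := (Mg ^ 2 + Mh) / (1 - γ) ^ 2

/-- The radius `σ⁰(n) √(ln (2 / δ)) + b⁰(H)` of the confidence interval for `V_i^θ(ρ)`. -/
def valueRadius (γ : ℝ) (p : LBParams) : ℝ :=
  √2 / (√(p.n : ℝ) * (1 - γ)) * √(Real.log (2 / p.δ)) + γ ^ p.H / (1 - γ)

/-- The radius `σ¹(n) √(ln (e^{1/4} / δ)) + b¹(H)` of the confidence ball for
`∇_θ V_i^θ(ρ)`. -/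
def gradRadius (γ : ℝ) (p : LBParams) : ℝ :=
  2 * √2 * p.Mg / (√(p.n : ℝ) * (1 - γ) ^ (3 / 2 : ℝ))
      * √(Real.log (Real.exp (1 / 4) / p.δ))
    + p.Mg * γ ^ p.H / (1 - γ) * √(1 / (1 - γ) + p.H)

/-- The lower confidence bound `α̲_i` of `V_i^θ(ρ)`. -/
def lowerValue (𝓜 : CMDP S A m γ) (p : LBParams) (i : Fin m) (b : Batch S A p) : ℝ :=
  valueEst 𝓜 p i.succ b - valueRadius γ p

/-- The upper confidence bound `β̄_i` of the directional derivative of `V_i^θ(ρ)`. -/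
def upperSlope (𝓜 : CMDP S A m γ) (𝓟 : PolicyClass S A d) (p : LBParams)
    (θ : EuclideanSpace ℝ (Fin d)) (i : Fin m) (b : Batch S A p) : ℝ :=
  |inner ℝ (gradEst 𝓜 𝓟 p θ i.succ b)
      (‖barrierGradEst 𝓜 𝓟 p θ b‖⁻¹ • barrierGradEst 𝓜 𝓟 p θ b)| + gradRadius γ p

/-- The local smoothness constant `M̂_t`. -/
def localSmooth (𝓜 : CMDP S A m γ) (𝓟 : PolicyClass S A d) (p : LBParams)
    (θ : EuclideanSpace ℝ (Fin d)) (b : Batch S A p) : ℝ :=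
  smoothConst γ p.Mg p.Mh
    + ∑ i : Fin m, 10 * smoothConst γ p.Mg p.Mh * p.η / lowerValue 𝓜 p i b
    + 8 * p.η * ∑ i : Fin m, upperSlope 𝓜 𝓟 p θ i b ^ 2 / lowerValue 𝓜 p i b ^ 2

/-- The stepsize `γ_t`. -/
def stepSize (𝓜 : CMDP S A m γ) (𝓟 : PolicyClass S A d) (p : LBParams)
    (θ : EuclideanSpace ℝ (Fin d)) (b : Batch S A p) : ℝ :=
  min (1 / localSmooth 𝓜 𝓟 p θ b)
    ((⨅ i : Fin m, lowerValue 𝓜 p i b /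
        (√(smoothConst γ p.Mg p.Mh * lowerValue 𝓜 p i b) + 2 * |upperSlope 𝓜 𝓟 p θ i b|))
      * (1 / ‖barrierGradEst 𝓜 𝓟 p θ b‖))

open Classical in
/-- One iteration, acting on the current iterate and a flag which records that the algorithm has
already terminated. After termination the iterate no longer changes. -/
def update (𝓜 : CMDP S A m γ) (𝓟 : PolicyClass S A d) (p : LBParams)
    (q : EuclideanSpace ℝ (Fin d) × Bool) (b : Batch S A p) :
    EuclideanSpace ℝ (Fin d) × Bool :=
  if q.2 = true then q
  else if ‖barrierGradEst 𝓜 𝓟 p q.1 b‖ ≤ p.η / 2 then (q.1, true)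
  else (q.1 + stepSize 𝓜 𝓟 p q.1 b • barrierGradEst 𝓜 𝓟 p q.1 b, false)

/-- Iterate and termination flag after `t` iterations, when the batch `b s` is observed in
iteration `s`. -/
def state (𝓜 : CMDP S A m γ) (𝓟 : PolicyClass S A d) (p : LBParams)
    (θ₀ : EuclideanSpace ℝ (Fin d)) (b : ℕ → Batch S A p) :
    ℕ → EuclideanSpace ℝ (Fin d) × Bool
  | 0 => (θ₀, false)
  | t + 1 => update 𝓜 𝓟 p (state 𝓜 𝓟 p θ₀ b t) (b t)

/-- The iterate `θ_t`. The output of the algorithm run for `T` iterations is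
`iterate … T`: the point where it stopped, if it did, and `θ_T` otherwise. -/
def iterate (𝓜 : CMDP S A m γ) (𝓟 : PolicyClass S A d) (p : LBParams)
    (θ₀ : EuclideanSpace ℝ (Fin d)) (b : ℕ → Batch S A p) (t : ℕ) :
    EuclideanSpace ℝ (Fin d) :=
  (state 𝓜 𝓟 p θ₀ b t).1

/-- The random batches `ξ 0, ξ 1, …` are those of a run of `T` iterations of the algorithm: for
`t < T`, conditionally on the batches of the previous iterations, `ξ t` consists of `n`
independent truncated trajectories sampled with the current policy `π_{θ_t}`, that is
`μ(E ∩ {ξ_t ∈ B}) = 𝔼[1_E · Law_{θ_t}(B)]` for every event `E` of the past. (After termination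
the batches have no effect on the iterates.) -/
def IsRun (𝓜 : CMDP S A m γ) (𝓟 : PolicyClass S A d) (p : LBParams)
    (θ₀ : EuclideanSpace ℝ (Fin d)) (T : ℕ) {Ω : Type w} [MeasurableSpace Ω]
    (μ : Measure Ω) (ξ : ℕ → Ω → Batch S A p) : Prop :=
  (∀ t, Measurable (ξ t)) ∧
    ∀ t < T, ∀ E : Set Ω,
      MeasurableSet[⨆ s : Fin t, MeasurableSpace.comap (ξ s) inferInstance] E →
      ∀ B : Set (Batch S A p), MeasurableSet B →
        μ (E ∩ ξ t ⁻¹' B) =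
          ∫⁻ ω in E, batchLaw 𝓜 𝓟 p (iterate 𝓜 𝓟 p θ₀ (fun s => ξ s ω) t) B ∂μ

/-- `c = (ℓ (1 - γ)² / (4 M_g (1 + 4 m / 3)))^m`. -/
def cConst (m : ℕ) (γ Mg ℓ : ℝ) : ℝ :=
  (ℓ * (1 - γ) ^ 2 / (4 * Mg * (1 + 4 * m / 3))) ^ m

/-- `C = c / (2 L² (1 + m / c) max {4 + 5 M c / L², 1 + √(M c / (4 L²))})`. -/
def rateConst (m : ℕ) (γ Mg Mh ℓ : ℝ) : ℝ :=
  cConst m γ Mg ℓ /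
    (2 * lipConst γ Mg ^ 2 * (1 + m / cConst m γ Mg ℓ) *
      max (4 + 5 * smoothConst γ Mg Mh * cConst m γ Mg ℓ / lipConst γ Mg ^ 2)
        (1 + √(smoothConst γ Mg Mh * cConst m γ Mg ℓ / (4 * lipConst γ Mg ^ 2))))

end LBSGD

end

open scoped ENNReal

/-! ### Trajectory law and its one-step Markov property. -/

namespace CMDP

variable {S : Type u} {A : Type v} [MeasurableSpace S] [MeasurableSpace A] {m : ℕ} {γ : ℝ}

/-! The algorithm is analysed deterministically on the event that every batch used at a well-behaved
iterate is accurate. Three mechanisms carry the proof: a repelling potential for safety, gradient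
domination for optimality, and dimension-free concentration for the probability of the event.

Safety. The log barrier itself is not used to keep the constraints away from zero. Instead,
`potential` sums `truncLog η (V i)`, where ψ(x) = log x + 1 - x is evaluated at min (V i / η) 1.
Inactive constraints contribute nothing, so the extended MFCQ applies to every constraint that
carries weight, and η times the gradient of the potential differs from the barrier gradient by at
most (m + 1) L. If some constraint lies below `repelRatio * η`, MFCQ makes the potential part
dominate; the estimated gradient is then an ascent direction for the potential, strongly enough to
beat the second-order error (`StepAccurate.potential_le`). Otherwise all constraints are above that
level, and as one step loses at most two thirds of each (`StepAccurate.step`), the potential stays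
above a fixed level anyway. Hence the set `wellInside` is invariant. All summands are nonpositive,
so each alone is bounded below by the sum, and this gives V i ≥ `safetyRatio * η` with a ratio that
is an m-th power.

Optimality. The performance difference lemma, the transfer error and Jensen's inequality bound each
value gap against the optimal policy by √ε / (1 - γ) plus the pairing of the natural gradient with
the mean score. Adding these with weights 1 and η / V i assembles the natural gradients into the
pseudo-inverse of the Fisher matrix applied to the barrier gradient; feasibility of the optimal
policy costs only η per constraint. So the gap is at most a bias plus Mg ‖∇B‖ / μF
(`value_sub_le_of_relaxedFisher`). A step raises the barrier by at least 2/5 of stepsize times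
squared gradient norm, and `StepAccurate.stepLength_ge` bounds the step length below when the
gradient is not too small. Together these contract the part of the gap above a floor of order η
(`StepAccurate.contract`). If the run stops, the small gradient yields the bound at once.

Regularity. The score is controlled on the feasible set only. Values are continuous everywhere, by a
Scheffé argument, hence the strictly feasible set is open; on it, change of measure along
trajectories gives the policy gradient and a second-order Taylor bound with constant M
(`BoundedScore.abs_V_taylor_le`).

Probability. Exponential moments of the smoothed norm √(a² + ‖x‖²) give a Hoeffding inequality
without dimension (`measure_pi_norm_sum_ge_le`), and `IsRun.measure_good_ge` takes the union over
iterations. The required n and H make the total error small compared with (`safetyRatio * η`)² (1 -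
γ)³. -/

instance isProbabilityMeasure_traj (𝓜 : CMDP S A m γ) (π : Kernel S A) [IsMarkovKernel π]
    (μ₀ : Measure (S × A)) [IsProbabilityMeasure μ₀] : IsProbabilityMeasure (𝓜.traj π μ₀) := by
  unfold traj; infer_instance

theorem map_traj_zero (𝓜 : CMDP S A m γ) (π : Kernel S A) [IsMarkovKernel π]
    (μ₀ : Measure (S × A)) : (𝓜.traj π μ₀).map (fun τ => τ 0) = μ₀ := by
  unfold traj Kernel.trajMeasure
  have h : (fun τ : ℕ → S × A => τ 0)
      = (fun x : (i : Finset.Iic 0) → S × A => x ⟨0, by simp⟩) ∘ Preorder.frestrictLe 0 := rfl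
  rw [h, ← Measure.map_map (by fun_prop) (by fun_prop), Measure.map_comp _ _ (by fun_prop),
    Kernel.traj_map_frestrictLe, Kernel.partialTraj_self, Measure.id_comp,
    Measure.map_map (by fun_prop) (by fun_prop)]
  convert Measure.map_id
  funext x
  rfl

/-- The joint law of a finite history and the next coordinate is the composition-product with the
step kernel. A function of finitely many coordinates can therefore be integrated by redrawing the
last of them. -/
theorem lintegral_traj_succ (𝓜 : CMDP S A m γ) (π : Kernel S A) [IsMarkovKernel π]
    (μ₀ : Measure (S × A)) [IsProbabilityMeasure μ₀] (n : ℕ) {F : (ℕ → S × A) → ℝ≥0∞}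
    (hF : Measurable F) (hdep : DependsOn F (Set.Iic (n + 1))) :
    ∫⁻ τ, F τ ∂(𝓜.traj π μ₀)
      = ∫⁻ τ, ∫⁻ y, F (Function.update τ (n + 1) y) ∂(𝓜.step π (τ n)) ∂(𝓜.traj π μ₀) := by
  obtain ⟨x₀⟩ : Nonempty (S × A) := nonempty_of_isProbabilityMeasure μ₀
  -- `F` takes infinite sequences, so a finite history must be completed. All coordinates after `n`
  -- are filled with the new value, which is harmless because `F` only sees those up to `n + 1`.
  let g : ((i : Finset.Iic n) → S × A) × (S × A) → (ℕ → S × A) := fun p i =>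
    if h : i ≤ n then p.1 ⟨i, Finset.mem_Iic.2 h⟩ else p.2
  have hg : Measurable g := by
    refine measurable_pi_lambda _ fun i => ?_
    by_cases h : i ≤ n
    · simp only [g, h, dif_pos]; fun_prop
    · simp only [g, h, dif_neg, not_false_eq_true]; fun_prop
  have h1 : ∀ τ y, F (Function.update τ (n + 1) y) = F (g (Preorder.frestrictLe n τ, y)) := by
    intro τ y
    refine hdep fun i hi => ?_
    rcases Nat.lt_or_ge n i with h | h
    · have : i = n + 1 := le_antisymm hi h
      subst this
      simp [g]
    · simp [g, h, Function.update_of_ne (show i ≠ n + 1 by omega)]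
  have h2 : ∀ τ, F τ = F (g (Preorder.frestrictLe n τ, τ (n + 1))) := fun τ => by
    rw [← h1, Function.update_eq_self]
  simp_rw [h1]
  rw [lintegral_congr h2]
  have key := Kernel.map_frestrictLe_trajMeasure_compProd_eq_map_trajMeasure
    (X := fun _ : ℕ => S × A) (μ₀ := μ₀) (a := n)
    (κ := fun n => (𝓜.step π).comap
      (fun h : (i : Finset.Iic n) → S × A => h ⟨n, Finset.mem_Iic.2 le_rfl⟩)
      (measurable_pi_apply _))
  have h3 := lintegral_map (μ := 𝓜.traj π μ₀) (hF.comp hg)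
    (g := fun τ => (Preorder.frestrictLe n τ, τ (n + 1))) (by fun_prop)
  simp only [Function.comp] at h3
  rw [← h3]
  unfold traj
  rw [← key, Measure.lintegral_compProd (by exact hF.comp hg), lintegral_map _ (by fun_prop)]
  · rfl
  · exact Measurable.lintegral_kernel_prod_right' (hF.comp hg)

/-- Expectations of bounded functions of the first `n + 2` coordinates, computed by
integrating out the last coordinate first. -/
theorem integral_traj_succ (𝓜 : CMDP S A m γ) (π : Kernel S A) [IsMarkovKernel π]
    (μ₀ : Measure (S × A)) [IsProbabilityMeasure μ₀] (n : ℕ) {F : (ℕ → S × A) → ℝ}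
    (hF : Measurable F) (hdep : DependsOn F (Set.Iic (n + 1))) (hint : Integrable F (𝓜.traj π μ₀)) :
    ∫ τ, F τ ∂(𝓜.traj π μ₀)
      = ∫ τ, ∫ y, F (Function.update τ (n + 1) y) ∂(𝓜.step π (τ n)) ∂(𝓜.traj π μ₀) := by
  set P := 𝓜.traj π μ₀
  let κ : Kernel (ℕ → S × A) (S × A) := (𝓜.step π).comap (fun τ => τ n) (measurable_pi_apply n)
  have hm : Measurable fun p : (ℕ → S × A) × (S × A) => Function.update p.1 (n + 1) p.2 := by
    refine measurable_pi_lambda _ fun i => ?_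
    by_cases h : i = n + 1
    · subst h; simp only [Function.update_self]; fun_prop
    · simp only [Function.update_of_ne h]; fun_prop
  -- Equality of the two push-forward laws reduces the real-valued claim to indicators, and it
  -- transfers integrability as well.
  have hmap : (P ⊗ₘ κ).map (fun p => F (Function.update p.1 (n + 1) p.2)) = P.map F := by
    ext s hs
    have hFu : Measurable fun p : (ℕ → S × A) × (S × A) =>
      F (Function.update p.1 (n + 1) p.2) := hF.comp hm
    rw [Measure.map_apply hFu hs, Measure.map_apply hF hs]
    rw [← lintegral_indicator_one (hF hs), ← lintegral_indicator_one (hFu hs),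
      Measure.lintegral_compProd (measurable_one.indicator (hFu hs)),
      𝓜.lintegral_traj_succ π μ₀ n (F := (F ⁻¹' s).indicator 1) (measurable_one.indicator (hF hs))]
    · rfl
    · intro x y hxy
      change s.indicator (1 : ℝ → ℝ≥0∞) (F x) = s.indicator 1 (F y)
      rw [hdep hxy]
  have hFm : AEMeasurable (fun p => F (Function.update p.1 (n + 1) p.2)) (P ⊗ₘ κ) :=
    (hF.comp hm).aemeasurable
  have hint' : Integrable (fun p => F (Function.update p.1 (n + 1) p.2)) (P ⊗ₘ κ) := by
    have h1 : Integrable id ((P ⊗ₘ κ).map (fun p => F (Function.update p.1 (n + 1) p.2))) := by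
      rw [hmap]
      exact (integrable_map_measure (by fun_prop) hF.aemeasurable).2 hint
    exact (integrable_map_measure (by fun_prop) hFm).1 h1
  calc ∫ τ, F τ ∂P = ∫ x, x ∂(P.map F) := 
        (integral_map hF.aemeasurable aestronglyMeasurable_id).symm
    _ = ∫ p, F (Function.update p.1 (n + 1) p.2) ∂(P ⊗ₘ κ) := by
        rw [← hmap, integral_map hFm (f := fun x : ℝ => x) aestronglyMeasurable_id]
    _ = _ := by rw [Measure.integral_compProd hint']; rfl

/-- The `t`-step transition kernel of the state-action chain. -/
noncomputable def iterStep (𝓜 : CMDP S A m γ) (π : Kernel S A) [IsMarkovKernel π] :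
    ℕ → Kernel (S × A) (S × A)
  | 0 => Kernel.id
  | t + 1 => 𝓜.step π ∘ₖ iterStep 𝓜 π t

instance isMarkovKernel_iterStep (𝓜 : CMDP S A m γ) (π : Kernel S A) [IsMarkovKernel π] (t : ℕ) :
    IsMarkovKernel (𝓜.iterStep π t) := by
  induction t with
  | zero => unfold iterStep; infer_instance
  | succ t ih => unfold iterStep; infer_instance

theorem iterStep_comp_step (𝓜 : CMDP S A m γ) (π : Kernel S A) [IsMarkovKernel π] (t : ℕ) :
    𝓜.iterStep π t ∘ₖ 𝓜.step π = 𝓜.iterStep π (t + 1) := by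
  induction t with
  | zero => simp [iterStep]
  | succ t ih => rw [iterStep, Kernel.comp_assoc, ih]; rfl

theorem map_traj_succ (𝓜 : CMDP S A m γ) (π : Kernel S A) [IsMarkovKernel π]
    (μ₀ : Measure (S × A)) [IsProbabilityMeasure μ₀] (t : ℕ) :
    (𝓜.traj π μ₀).map (fun τ => τ (t + 1))
      = 𝓜.step π ∘ₘ (𝓜.traj π μ₀).map (fun τ => τ t) := by
  ext s hs
  rw [Measure.map_apply (by fun_prop) hs, Measure.bind_apply hs (Kernel.aemeasurable _),
    lintegral_map (Kernel.measurable_coe _ hs) (by fun_prop),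
    ← lintegral_indicator_one (measurable_pi_apply (t + 1) hs)]
  rw [𝓜.lintegral_traj_succ π μ₀ t
    (measurable_one.indicator (measurable_pi_apply (t + 1) hs)) _]
  · refine lintegral_congr fun τ => ?_
    rw [← lintegral_indicator_one hs]
    refine lintegral_congr fun y => ?_
    change s.indicator (1 : S × A → ℝ≥0∞) (Function.update τ (t + 1) y (t + 1)) = s.indicator 1 y
    rw [Function.update_self]
  · intro x y hxy
    change s.indicator (1 : S × A → ℝ≥0∞) (x (t + 1)) = s.indicator 1 (y (t + 1))
    rw [hxy (t + 1) (by simp)]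

theorem map_traj_eq (𝓜 : CMDP S A m γ) (π : Kernel S A) [IsMarkovKernel π]
    (μ₀ : Measure (S × A)) [IsProbabilityMeasure μ₀] (t : ℕ) :
    (𝓜.traj π μ₀).map (fun τ => τ t) = 𝓜.iterStep π t ∘ₘ μ₀ := by
  induction t with
  | zero => rw [map_traj_zero, iterStep, Measure.id_comp]
  | succ t ih => rw [map_traj_succ, ih, iterStep, Measure.comp_assoc]

end CMDP

/-! ### Value functions, Bellman equation and performance difference. -/

namespace CMDP

variable {S : Type u} {A : Type v} [MeasurableSpace S] [MeasurableSpace A] {m : ℕ} {γ : ℝ}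

theorem one_sub_pos (𝓜 : CMDP S A m γ) : 0 < 1 - γ := sub_pos.2 𝓜.γ_lt_one

theorem hasSum_discount (𝓜 : CMDP S A m γ) : HasSum (fun t : ℕ => γ ^ t) (1 / (1 - γ)) := by
  rw [one_div]; exact hasSum_geometric_of_lt_one 𝓜.γ_pos.le 𝓜.γ_lt_one

theorem integrable_of_abs_le {α : Type*} [MeasurableSpace α] {μ : Measure α} [IsFiniteMeasure μ]
    {f : α → ℝ} (hf : Measurable f) {C : ℝ} (h : ∀ x, |f x| ≤ C) : Integrable f μ :=
  Integrable.of_bound hf.aestronglyMeasurable C (ae_of_all _ h)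

theorem abs_integral_le_of_abs_le {α : Type*} [MeasurableSpace α] {μ : Measure α}
    [IsProbabilityMeasure μ] {f : α → ℝ} {C : ℝ} (h : ∀ x, |f x| ≤ C) : |∫ x, f x ∂μ| ≤ C := by
  have := norm_integral_le_of_norm_le_const (μ := μ) (f := f) (C := C) (ae_of_all _ h)
  simpa using this

theorem summable_discount_mul (𝓜 : CMDP S A m γ) {f : ℕ → ℝ} {C : ℝ} (h : ∀ t, |f t| ≤ C) :
    Summable fun t => γ ^ t * f t := by
  refine Summable.of_norm_bounded (g := fun t => γ ^ t * C) (𝓜.hasSum_discount.summable.mul_right C)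
    fun t => ?_
  rw [norm_mul, norm_pow, Real.norm_of_nonneg 𝓜.γ_pos.le]
  exact mul_le_mul_of_nonneg_left (h t) (pow_nonneg 𝓜.γ_pos.le _)

theorem abs_tsum_discount_mul_le (𝓜 : CMDP S A m γ) {f : ℕ → ℝ} {C : ℝ} (h : ∀ t, |f t| ≤ C) :
    |∑' t, γ ^ t * f t| ≤ C / (1 - γ) := by
  have h1 : HasSum (fun t : ℕ => γ ^ t * C) (C / (1 - γ)) := by
    have := 𝓜.hasSum_discount.mul_right C
    rwa [one_div_mul_eq_div] at this
  refine tsum_of_norm_bounded (E := ℝ) h1 fun t => ?_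
  rw [norm_mul, norm_pow, Real.norm_of_nonneg 𝓜.γ_pos.le]
  exact mul_le_mul_of_nonneg_left (h t) (pow_nonneg 𝓜.γ_pos.le _)

theorem hasSum_integral_ret (𝓜 : CMDP S A m γ) (i : Fin (m + 1)) (P : Measure (ℕ → S × A))
    [IsProbabilityMeasure P] :
    HasSum (fun t => γ ^ t * ∫ τ, 𝓜.r i (τ t) ∂P) (∫ τ, 𝓜.ret i τ ∂P) := by
  have hm : ∀ t, Measurable fun τ : ℕ → S × A => 𝓜.r i (τ t) := fun t =>
    (𝓜.measurable_r i).comp (measurable_pi_apply t)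
  have hi : ∀ t, Integrable (fun τ : ℕ → S × A => 𝓜.r i (τ t)) P := fun t =>
    integrable_of_abs_le (hm t) fun τ => 𝓜.abs_r_le_one i _
  have h := hasSum_integral_of_summable_integral_norm (μ := P)
    (F := fun t τ => γ ^ t * 𝓜.r i (τ t)) (fun t => (hi t).const_mul _) ?_
  · simp only [integral_const_mul] at h
    exact h
  · have : ∀ t, ∫ τ, ‖γ ^ t * 𝓜.r i (τ t)‖ ∂P = γ ^ t * ∫ τ, |𝓜.r i (τ t)| ∂P := fun t => by
      rw [← integral_const_mul]
      refine integral_congr_ae (ae_of_all _ fun τ => ?_)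
      simp [abs_of_pos 𝓜.γ_pos]
    simp_rw [this]
    refine 𝓜.summable_discount_mul (C := 1) fun t => abs_integral_le_of_abs_le fun τ => ?_
    simpa using 𝓜.abs_r_le_one i _

theorem integral_traj_coord (𝓜 : CMDP S A m γ) (π : Kernel S A) [IsMarkovKernel π]
    (μ₀ : Measure (S × A)) [IsProbabilityMeasure μ₀] (t : ℕ) {f : S × A → ℝ} (hf : Measurable f) :
    ∫ τ, f (τ t) ∂(𝓜.traj π μ₀) = ∫ x, f x ∂(𝓜.iterStep π t ∘ₘ μ₀) := by
  rw [← map_traj_eq, integral_map (measurable_pi_apply t).aemeasurable hf.aestronglyMeasurable]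

theorem actionValue_eq_tsum (𝓜 : CMDP S A m γ) (i : Fin (m + 1)) (π : Kernel S A)
    [IsMarkovKernel π] (x : S × A) :
    𝓜.actionValue i π x = ∑' t, γ ^ t * ∫ y, 𝓜.r i y ∂(𝓜.iterStep π t x) := by
  rw [actionValue, ← (𝓜.hasSum_integral_ret i _).tsum_eq]
  refine tsum_congr fun t => ?_
  rw [𝓜.integral_traj_coord π _ _ (𝓜.measurable_r i), Measure.dirac_bind (Kernel.measurable _)]

theorem measurable_actionValue (𝓜 : CMDP S A m γ) (i : Fin (m + 1)) (π : Kernel S A)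
    [IsMarkovKernel π] : Measurable (𝓜.actionValue i π) := by
  have h : 𝓜.actionValue i π = fun x => ∑' t, γ ^ t * ∫ y, 𝓜.r i y ∂(𝓜.iterStep π t x) :=
    funext (𝓜.actionValue_eq_tsum i π)
  rw [h]
  have hm : ∀ t, Measurable fun x => ∫ y, 𝓜.r i y ∂(𝓜.iterStep π t x) := fun t =>
    ((𝓜.measurable_r i).stronglyMeasurable.integral_kernel).measurable
  exact Measurable.tsum fun t => (hm t).const_mul _

theorem abs_actionValue_le (𝓜 : CMDP S A m γ) (i : Fin (m + 1)) (π : Kernel S A)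
    [IsMarkovKernel π] (x : S × A) : |𝓜.actionValue i π x| ≤ 1 / (1 - γ) := by
  rw [actionValue_eq_tsum]
  exact 𝓜.abs_tsum_discount_mul_le fun t => abs_integral_le_of_abs_le fun y => 𝓜.abs_r_le_one i y

theorem integral_bind_of_abs_le {α β : Type*} [MeasurableSpace α] [MeasurableSpace β]
    {μ : Measure α} [IsProbabilityMeasure μ] {κ : Kernel α β} [IsMarkovKernel κ] {f : β → ℝ}
    (hf : Measurable f) {C : ℝ} (h : ∀ x, |f x| ≤ C) :
    ∫ y, f y ∂(κ ∘ₘ μ) = ∫ x, ∫ y, f y ∂(κ x) ∂μ := by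
  rw [← Measure.snd_compProd, Measure.snd, integral_map (by fun_prop) hf.aestronglyMeasurable,
    Measure.integral_compProd (f := fun x : α × β => f x.2)
      (integrable_of_abs_le (hf.comp measurable_snd) fun x => h x.2)]

/-- The return of a trajectory started from `μ₀` is the average of the action values. -/
theorem integral_actionValue (𝓜 : CMDP S A m γ) (i : Fin (m + 1)) (π : Kernel S A)
    [IsMarkovKernel π] (μ₀ : Measure (S × A)) [IsProbabilityMeasure μ₀] :
    ∫ x, 𝓜.actionValue i π x ∂μ₀ = ∫ τ, 𝓜.ret i τ ∂(𝓜.traj π μ₀) := by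
  rw [← (𝓜.hasSum_integral_ret i _).tsum_eq]
  simp_rw [𝓜.integral_traj_coord π _ _ (𝓜.measurable_r i), actionValue_eq_tsum]
  have hb : ∀ t x, |∫ y, 𝓜.r i y ∂(𝓜.iterStep π t x)| ≤ 1 := fun t x =>
    abs_integral_le_of_abs_le fun y => 𝓜.abs_r_le_one i y
  have hm : ∀ t, Measurable fun x => ∫ y, 𝓜.r i y ∂(𝓜.iterStep π t x) := fun t =>
    ((𝓜.measurable_r i).stronglyMeasurable.integral_kernel).measurable
  rw [← (hasSum_integral_of_summable_integral_norm (μ := μ₀)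
    (F := fun t x => γ ^ t * ∫ y, 𝓜.r i y ∂(𝓜.iterStep π t x))
    (fun t => (integrable_of_abs_le (hm t) (hb t)).const_mul _) ?_).tsum_eq]
  · refine tsum_congr fun t => ?_
    rw [integral_const_mul, integral_bind_of_abs_le (𝓜.measurable_r i) (𝓜.abs_r_le_one i)]
  · have : ∀ t, ∫ x, ‖γ ^ t * ∫ y, 𝓜.r i y ∂(𝓜.iterStep π t x)‖ ∂μ₀
        = γ ^ t * ∫ x, |∫ y, 𝓜.r i y ∂(𝓜.iterStep π t x)| ∂μ₀ := fun t => by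
      rw [← integral_const_mul]
      refine integral_congr_ae (ae_of_all _ fun τ => ?_)
      simp [abs_of_pos 𝓜.γ_pos]
    simp_rw [this]
    exact 𝓜.summable_discount_mul (C := 1) fun t => abs_integral_le_of_abs_le fun τ => by
      simpa using hb t τ

/-- Splitting off the first reward leaves a shifted series, and one step followed by `t` iterations
is `t + 1` iterations, so that series is the action value averaged over a transition. -/
theorem actionValue_bellman (𝓜 : CMDP S A m γ) (i : Fin (m + 1)) (π : Kernel S A)
    [IsMarkovKernel π] (x : S × A) :
    𝓜.actionValue i π x = 𝓜.r i x + γ * ∫ y, 𝓜.actionValue i π y ∂(𝓜.step π x) := by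
  rw [integral_actionValue, ← (𝓜.hasSum_integral_ret i _).tsum_eq, actionValue_eq_tsum,
    Summable.tsum_eq_zero_add, ← tsum_mul_left]
  · congr 1
    · simp [iterStep, Kernel.id_apply, integral_dirac' _ _ (𝓜.measurable_r i).stronglyMeasurable]
    · refine tsum_congr fun t => ?_
      rw [𝓜.integral_traj_coord π _ _ (𝓜.measurable_r i), ← iterStep_comp_step, Kernel.comp_apply]
      ring
  · exact 𝓜.summable_discount_mul (C := 1) fun t =>
      abs_integral_le_of_abs_le fun y => 𝓜.abs_r_le_one i y

theorem stateValue_eq (𝓜 : CMDP S A m γ) (i : Fin (m + 1)) (π : Kernel S A)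
    [IsMarkovKernel π] (s : S) :
    𝓜.stateValue i π s = ∫ a, 𝓜.actionValue i π (s, a) ∂(π s) := by
  rw [stateValue, ← integral_actionValue,
    Measure.integral_compProd (integrable_of_abs_le (𝓜.measurable_actionValue i π)
      (𝓜.abs_actionValue_le i π)), integral_dirac']
  exact (𝓜.measurable_actionValue i π).stronglyMeasurable.integral_kernel_prod_right'

theorem measurable_stateValue (𝓜 : CMDP S A m γ) (i : Fin (m + 1)) (π : Kernel S A)
    [IsMarkovKernel π] : Measurable (𝓜.stateValue i π) := by
  rw [funext (𝓜.stateValue_eq i π)]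
  exact (𝓜.measurable_actionValue i π).stronglyMeasurable.integral_kernel_prod_right'.measurable

theorem abs_stateValue_le (𝓜 : CMDP S A m γ) (i : Fin (m + 1)) (π : Kernel S A)
    [IsMarkovKernel π] (s : S) : |𝓜.stateValue i π s| ≤ 1 / (1 - γ) := by
  rw [stateValue_eq]
  exact abs_integral_le_of_abs_le fun a => 𝓜.abs_actionValue_le i π _

theorem value_eq_integral_stateValue (𝓜 : CMDP S A m γ) (i : Fin (m + 1)) (π : Kernel S A)
    [IsMarkovKernel π] : 𝓜.value i π = ∫ s, 𝓜.stateValue i π s ∂𝓜.ρ := by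
  rw [value, ← integral_actionValue,
    Measure.integral_compProd (integrable_of_abs_le (𝓜.measurable_actionValue i π)
      (𝓜.abs_actionValue_le i π))]
  simp_rw [stateValue_eq]

theorem abs_value_le (𝓜 : CMDP S A m γ) (i : Fin (m + 1)) (π : Kernel S A)
    [IsMarkovKernel π] : |𝓜.value i π| ≤ 1 / (1 - γ) := by
  rw [value_eq_integral_stateValue]
  exact abs_integral_le_of_abs_le fun s => 𝓜.abs_stateValue_le i π s

theorem integral_step_fst (𝓜 : CMDP S A m γ) (π : Kernel S A) [IsMarkovKernel π] (x : S × A)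
    {f : S → ℝ} (hf : Measurable f) {C : ℝ} (h : ∀ s, |f s| ≤ C) :
    ∫ y, f y.1 ∂(𝓜.step π x) = ∫ s, f s ∂(𝓜.P x) := by
  rw [step, integral_compProd (f := fun y : S × A => f y.1)
    (integrable_of_abs_le (hf.comp measurable_fst) fun y => h y.1)]
  simp

theorem integral_step_actionValue (𝓜 : CMDP S A m γ) (i : Fin (m + 1)) (π : Kernel S A)
    [IsMarkovKernel π] (x : S × A) :
    ∫ y, 𝓜.actionValue i π y ∂(𝓜.step π x) = ∫ s, 𝓜.stateValue i π s ∂(𝓜.P x) := by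
  rw [step, integral_compProd (integrable_of_abs_le (𝓜.measurable_actionValue i π)
    (𝓜.abs_actionValue_le i π))]
  simp [stateValue_eq]

theorem measurable_advantage (𝓜 : CMDP S A m γ) (i : Fin (m + 1)) (π : Kernel S A)
    [IsMarkovKernel π] : Measurable (𝓜.advantage i π) :=
  (𝓜.measurable_actionValue i π).sub ((𝓜.measurable_stateValue i π).comp measurable_fst)

theorem abs_advantage_le (𝓜 : CMDP S A m γ) (i : Fin (m + 1)) (π : Kernel S A)
    [IsMarkovKernel π] (x : S × A) : |𝓜.advantage i π x| ≤ 2 / (1 - γ) := by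
  have h1 := 𝓜.abs_actionValue_le i π x
  have h2 := 𝓜.abs_stateValue_le i π x.1
  calc _ ≤ _ := abs_sub _ _
    _ ≤ 1 / (1 - γ) + 1 / (1 - γ) := add_le_add h1 h2
    _ = _ := by ring

theorem hasSum_integral_visitation (𝓜 : CMDP S A m γ) (π : Kernel S A) [IsMarkovKernel π]
    {f : S × A → ℝ} (hf : Measurable f) {C : ℝ} (h : ∀ x, |f x| ≤ C) :
    HasSum (fun t : ℕ => (1 - γ) * γ ^ t * ∫ x, f x ∂(𝓜.iterStep π t ∘ₘ (𝓜.ρ ⊗ₘ π)))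
      (∫ x, f x ∂(𝓜.visitation π)) ∧ IsProbabilityMeasure (𝓜.visitation π) := by
  have hp : IsProbabilityMeasure (𝓜.visitation π) := by
    refine ⟨?_⟩
    have : ∀ t, IsProbabilityMeasure ((𝓜.traj π (𝓜.ρ ⊗ₘ π)).map fun τ => τ t) := fun t =>
      Measure.isProbabilityMeasure_map (measurable_pi_apply t).aemeasurable
    rw [visitation, Measure.sum_apply _ MeasurableSet.univ]
    simp only [Measure.smul_apply, measure_univ, smul_eq_mul, mul_one]
    have h1 : HasSum (fun t : ℕ => (1 - γ) * γ ^ t) 1 := by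
      have := 𝓜.hasSum_discount.mul_left (1 - γ)
      rwa [mul_one_div_cancel 𝓜.one_sub_pos.ne'] at this
    rw [← ENNReal.ofReal_tsum_of_nonneg
      (fun t => mul_nonneg 𝓜.one_sub_pos.le (pow_nonneg 𝓜.γ_pos.le _)) h1.summable, h1.tsum_eq,
      ENNReal.ofReal_one]
  refine ⟨?_, hp⟩
  have := hasSum_integral_measure (integrable_of_abs_le (μ := 𝓜.visitation π) hf h)
  have h2 : ∀ t : ℕ, ∫ x, f x ∂(ENNReal.ofReal ((1 - γ) * γ ^ t) •
      (𝓜.traj π (𝓜.ρ ⊗ₘ π)).map fun τ => τ t)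
      = (1 - γ) * γ ^ t * ∫ x, f x ∂(𝓜.iterStep π t ∘ₘ (𝓜.ρ ⊗ₘ π)) := fun t => by
    rw [integral_smul_measure, ENNReal.toReal_ofReal
      (mul_nonneg 𝓜.one_sub_pos.le (pow_nonneg 𝓜.γ_pos.le _)), map_traj_eq, smul_eq_mul]
  simp only [h2] at this
  exact this

instance isProbabilityMeasure_visitation (𝓜 : CMDP S A m γ) (π : Kernel S A) [IsMarkovKernel π] :
    IsProbabilityMeasure (𝓜.visitation π) :=
  (𝓜.hasSum_integral_visitation π (f := fun _ => 0) measurable_const (C := 0) (by simp)).2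

/-- After the Bellman equation only the law of the next state matters, and this law does not involve
the policy drawing the next action. The step kernel of any `π'` may be used, which is what lets the
state values of `π` telescope along `π'`. -/
theorem integral_advantage (𝓜 : CMDP S A m γ) (i : Fin (m + 1)) (π π' : Kernel S A)
    [IsMarkovKernel π] [IsMarkovKernel π'] (ν : Measure (S × A)) [IsProbabilityMeasure ν] :
    ∫ x, 𝓜.advantage i π x ∂ν = ∫ x, 𝓜.r i x ∂ν
      + γ * ∫ x, 𝓜.stateValue i π x.1 ∂(𝓜.step π' ∘ₘ ν) - ∫ x, 𝓜.stateValue i π x.1 ∂ν := by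
  have hV : Measurable fun x : S × A => 𝓜.stateValue i π x.1 :=
    (𝓜.measurable_stateValue i π).comp measurable_fst
  have hVb : ∀ x : S × A, |𝓜.stateValue i π x.1| ≤ _ := fun x => 𝓜.abs_stateValue_le i π x.1
  have hin : ∀ y, |∫ x, 𝓜.stateValue i π x.1 ∂(𝓜.step π' y)| ≤ 1 / (1 - γ) := fun y =>
    abs_integral_le_of_abs_le hVb
  have him : Measurable fun y => ∫ x, 𝓜.stateValue i π x.1 ∂(𝓜.step π' y) :=
    (StronglyMeasurable.integral_kernel (κ := 𝓜.step π') hV.stronglyMeasurable).measurable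
  rw [integral_bind_of_abs_le hV hVb, ← integral_const_mul,
    ← integral_add (integrable_of_abs_le (𝓜.measurable_r i) (𝓜.abs_r_le_one i))
      ((integrable_of_abs_le him hin).const_mul _),
    ← integral_sub _ (integrable_of_abs_le hV hVb)]
  · refine integral_congr_ae (ae_of_all _ fun x => ?_)
    simp only [advantage]
    rw [actionValue_bellman, integral_step_actionValue,
      𝓜.integral_step_fst π' x (𝓜.measurable_stateValue i π) (𝓜.abs_stateValue_le i π)]
  · exact (integrable_of_abs_le (𝓜.measurable_r i) (𝓜.abs_r_le_one i)).add
      ((integrable_of_abs_le him hin).const_mul _)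

/-- The performance difference lemma. -/
theorem performance_difference (𝓜 : CMDP S A m γ) (i : Fin (m + 1)) (π π' : Kernel S A)
    [IsMarkovKernel π] [IsMarkovKernel π'] :
    (1 - γ) * (𝓜.value i π' - 𝓜.value i π) = ∫ x, 𝓜.advantage i π x ∂(𝓜.visitation π') := by
  rw [← (𝓜.hasSum_integral_visitation π' (𝓜.measurable_advantage i π)
    (𝓜.abs_advantage_le i π)).1.tsum_eq]
  set ν : ℕ → Measure (S × A) := fun t => 𝓜.iterStep π' t ∘ₘ (𝓜.ρ ⊗ₘ π') with hν
  set w : ℕ → ℝ := fun t => ∫ x, 𝓜.stateValue i π x.1 ∂(ν t) with hw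
  have hwb : ∀ t, |w t| ≤ 1 / (1 - γ) := fun t =>
    abs_integral_le_of_abs_le fun x => 𝓜.abs_stateValue_le i π x.1
  have hr : HasSum (fun t => γ ^ t * ∫ x, 𝓜.r i x ∂(ν t)) (𝓜.value i π') := by
    have := 𝓜.hasSum_integral_ret i (𝓜.traj π' (𝓜.ρ ⊗ₘ π'))
    simp_rw [𝓜.integral_traj_coord π' _ _ (𝓜.measurable_r i)] at this
    exact this
  have hs := 𝓜.summable_discount_mul hwb
  have hw0 : w 0 = 𝓜.value i π := by
    have hV : Measurable fun x : S × A => 𝓜.stateValue i π x.1 :=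
    (𝓜.measurable_stateValue i π).comp measurable_fst
    have hVb : ∀ x : S × A, |𝓜.stateValue i π x.1| ≤ _ := fun x => 𝓜.abs_stateValue_le i π x.1
    simp only [hw, hν, iterStep, Measure.id_comp]
    rw [Measure.integral_compProd (integrable_of_abs_le hV hVb), value_eq_integral_stateValue]
    simp
  have h2 : HasSum (fun t => γ ^ (t + 1) * w (t + 1)) ((∑' t, γ ^ t * w t) - w 0) := by
    have := (hasSum_nat_add_iff' 1).2 hs.hasSum
    simpa using this
  -- Subtracting the discounted state values from their shift telescopes; only `w 0`, the value of
  -- `π`, survives.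
  have h3 := ((hr.add h2).sub hs.hasSum).mul_left (1 - γ)
  have h4 : ∀ t, (1 - γ) * γ ^ t * ∫ x, 𝓜.advantage i π x ∂(ν t)
      = (1 - γ) * (γ ^ t * ∫ x, 𝓜.r i x ∂(ν t) + γ ^ (t + 1) * w (t + 1) - γ ^ t * w t) := by
    intro t
    rw [𝓜.integral_advantage i π π', Measure.comp_assoc]
    simp only [hw, hν, iterStep]
    ring
  rw [tsum_congr h4, h3.tsum_eq, ← hw0]
  ring

end CMDP

/-! ### Scores and likelihood ratios of policies. -/

open scoped Topology

namespace PolicyClass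

variable {S : Type u} {A : Type v} [MeasurableSpace S] [MeasurableSpace A] {d : ℕ}

theorem continuous_dens (𝓟 : PolicyClass S A d) (x : S × A) :
    Continuous fun θ => 𝓟.dens θ x.1 x.2 := by
  have : (fun θ => 𝓟.dens θ x.1 x.2) = fun θ => Real.exp (Real.log (𝓟.dens θ x.1 x.2)) :=
    funext fun θ => (Real.exp_log (𝓟.dens_pos θ x.1 x.2)).symm
  rw [this]
  exact Real.continuous_exp.comp (𝓟.differentiable_log_dens x.1 x.2).continuous

theorem measurable_dens_uncurry (𝓟 : PolicyClass S A d) :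
    Measurable fun p : EuclideanSpace ℝ (Fin d) × (S × A) => 𝓟.dens p.1 p.2.1 p.2.2 :=
  measurable_uncurry_of_continuous_of_measurable (u := fun θ (x : S × A) => 𝓟.dens θ x.1 x.2)
    𝓟.continuous_dens fun θ => 𝓟.measurable_dens θ

theorem hasGradientAt_log_dens (𝓟 : PolicyClass S A d) (θ : EuclideanSpace ℝ (Fin d))
    (x : S × A) :
    HasGradientAt (fun θ' => Real.log (𝓟.dens θ' x.1 x.2)) (𝓟.score θ x) θ :=
  (𝓟.differentiable_log_dens x.1 x.2 θ).hasGradientAt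

theorem hasDerivAt_add_smul {d : ℕ} (θ u : EuclideanSpace ℝ (Fin d)) (s : ℝ) :
    HasDerivAt (fun s : ℝ => θ + s • u) u s := by
  simpa using ((hasDerivAt_id s).smul_const u).const_add θ

theorem hasDerivAt_log_dens (𝓟 : PolicyClass S A d) (θ u : EuclideanSpace ℝ (Fin d))
    (x : S × A) (s : ℝ) :
    HasDerivAt (fun s : ℝ => Real.log (𝓟.dens (θ + s • u) x.1 x.2))
      (inner ℝ (𝓟.score (θ + s • u) x) u) s := by
  have h := (𝓟.hasGradientAt_log_dens (θ + s • u) x).hasFDerivAt.comp_hasDerivAt s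
    (hasDerivAt_add_smul θ u s)
  rw [InnerProductSpace.toDual_apply_apply] at h
  exact h

/-- The derivative is the pointwise limit of the difference quotients with increments 1 / (n + 1),
each of which is measurable. -/
theorem measurable_of_hasDerivAt {α : Type*} [MeasurableSpace α] {f : ℝ → α → ℝ} {f' : α → ℝ}
    {s : ℝ} (hf : ∀ s, Measurable (f s)) (h : ∀ x, HasDerivAt (fun s => f s x) (f' x) s) :
    Measurable f' := by
  refine measurable_of_tendsto_metrizable
    (f := fun (n : ℕ) x => ((n : ℝ) + 1) * (f (s + ((n : ℝ) + 1)⁻¹) x - f s x)) (fun n => ?_) ?_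
  · exact ((hf _).sub (hf _)).const_mul _
  · rw [tendsto_pi_nhds]
    intro x
    have h1 := (h x).tendsto_slope_zero
    have h2 : Filter.Tendsto (fun n : ℕ => ((n : ℝ) + 1)⁻¹) Filter.atTop (𝓝[≠] 0) := by
      refine tendsto_nhdsWithin_iff.2 ⟨?_, Filter.Eventually.of_forall fun n => ?_⟩
      · simpa [one_div] using tendsto_one_div_add_atTop_nhds_zero_nat (𝕜 := ℝ)
      · have : (0 : ℝ) < (n : ℝ) + 1 := by positivity
        simp only [Set.mem_compl_iff, Set.mem_singleton_iff]
        positivity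
    have h3 := h1.comp h2
    refine h3.congr fun n => ?_
    simp

/-- Densities are continuous in the parameter and measurable in the state-action pair, hence jointly
measurable. Each coordinate of the score is a directional derivative of their logarithm. -/
theorem measurable_score_uncurry (𝓟 : PolicyClass S A d) :
    Measurable fun p : EuclideanSpace ℝ (Fin d) × (S × A) => 𝓟.score p.1 p.2 := by
  have hc : ∀ k, Measurable fun p : EuclideanSpace ℝ (Fin d) × (S × A) => 𝓟.score p.1 p.2 k := by
    intro k
    refine measurable_of_hasDerivAt (s := 0) (f := fun s p =>
      Real.log (𝓟.dens (p.1 + s • EuclideanSpace.single k (1 : ℝ)) p.2.1 p.2.2)) (fun s => ?_)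
      fun p => ?_
    · have : Measurable fun p : EuclideanSpace ℝ (Fin d) × (S × A) =>
          (p.1 + s • EuclideanSpace.single k (1 : ℝ), p.2) := by fun_prop
      exact Real.measurable_log.comp (𝓟.measurable_dens_uncurry.comp this)
    · have := 𝓟.hasDerivAt_log_dens p.1 (EuclideanSpace.single k (1 : ℝ)) p.2 0
      simpa [EuclideanSpace.inner_single_right] using this
  have : (fun p : EuclideanSpace ℝ (Fin d) × (S × A) => 𝓟.score p.1 p.2)
      = fun p => WithLp.toLp 2 fun k => 𝓟.score p.1 p.2 k := rfl
  rw [this]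
  exact (WithLp.measurable_toLp 2 _).comp (measurable_pi_lambda _ hc)

theorem measurable_score (𝓟 : PolicyClass S A d) (θ : EuclideanSpace ℝ (Fin d)) :
    Measurable (𝓟.score θ) :=
  𝓟.measurable_score_uncurry.comp measurable_prodMk_left

/-- The likelihood ratio of `π_θ'` with respect to `π_θ`. -/
noncomputable def ratio (𝓟 : PolicyClass S A d) (θ θ' : EuclideanSpace ℝ (Fin d)) (x : S × A) : ℝ :=
  𝓟.dens θ' x.1 x.2 / 𝓟.dens θ x.1 x.2

theorem measurable_ratio (𝓟 : PolicyClass S A d) (θ θ' : EuclideanSpace ℝ (Fin d)) :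
    Measurable (𝓟.ratio θ θ') :=
  (𝓟.measurable_dens θ').div (𝓟.measurable_dens θ)

theorem ratio_pos (𝓟 : PolicyClass S A d) (θ θ' : EuclideanSpace ℝ (Fin d)) (x : S × A) :
    0 < 𝓟.ratio θ θ' x :=
  div_pos (𝓟.dens_pos _ _ _) (𝓟.dens_pos _ _ _)

theorem ratio_self (𝓟 : PolicyClass S A d) (θ : EuclideanSpace ℝ (Fin d)) (x : S × A) :
    𝓟.ratio θ θ x = 1 :=
  div_self (𝓟.dens_pos _ _ _).ne'

theorem lintegral_policy (𝓟 : PolicyClass S A d) (θ : EuclideanSpace ℝ (Fin d)) (s : S)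
    {f : A → ℝ≥0∞} (hf : Measurable f) :
    ∫⁻ a, f a ∂(𝓟.policy θ s) = ∫⁻ a, ENNReal.ofReal (𝓟.dens θ s a) * f a ∂𝓟.base := by
  have hm : Measurable (Function.uncurry fun s a => ENNReal.ofReal (𝓟.dens θ s a)) :=
    (𝓟.measurable_dens θ).ennreal_ofReal
  have hs : Measurable fun a => ENNReal.ofReal (𝓟.dens θ s a) := hm.comp measurable_prodMk_left
  rw [policy, Kernel.withDensity_apply _ hm, Kernel.const_apply,
    lintegral_withDensity_eq_lintegral_mul _ hs hf]
  rfl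

theorem lintegral_policy_eq_ratio (𝓟 : PolicyClass S A d) (θ θ' : EuclideanSpace ℝ (Fin d)) (s : S)
    {f : A → ℝ≥0∞} (hf : Measurable f) :
    ∫⁻ a, f a ∂(𝓟.policy θ' s)
      = ∫⁻ a, ENNReal.ofReal (𝓟.ratio θ θ' (s, a)) * f a ∂(𝓟.policy θ s) := by
  have hm : Measurable fun a => ENNReal.ofReal (𝓟.ratio θ θ' (s, a)) * f a :=
    ((𝓟.measurable_ratio θ θ').comp measurable_prodMk_left).ennreal_ofReal.mul hf
  rw [lintegral_policy _ _ _ hf, lintegral_policy _ _ _ hm]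
  refine lintegral_congr fun a => ?_
  rw [← mul_assoc, ← ENNReal.ofReal_mul (𝓟.dens_pos _ _ _).le, ratio,
    mul_div_cancel₀ _ (𝓟.dens_pos _ _ _).ne']

end PolicyClass

/-! ### Change of measure between trajectories of two parameters. -/

namespace CMDP

variable {S : Type u} {A : Type v} [MeasurableSpace S] [MeasurableSpace A] {m : ℕ} {γ : ℝ} {d : ℕ}

theorem lintegral_step_eq_ratio (𝓜 : CMDP S A m γ) (𝓟 : PolicyClass S A d)
    (θ θ' : EuclideanSpace ℝ (Fin d)) (x : S × A) {f : S × A → ℝ≥0∞} (hf : Measurable f) :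
    ∫⁻ y, f y ∂(𝓜.step (𝓟.policy θ') x)
      = ∫⁻ y, ENNReal.ofReal (𝓟.ratio θ θ' y) * f y ∂(𝓜.step (𝓟.policy θ) x) := by
  have hm : Measurable fun y => ENNReal.ofReal (𝓟.ratio θ θ' y) * f y :=
    (𝓟.measurable_ratio θ θ').ennreal_ofReal.mul hf
  rw [step, Kernel.lintegral_compProd _ _ _ hf, step, Kernel.lintegral_compProd _ _ _ hm]
  exact lintegral_congr fun s =>
    𝓟.lintegral_policy_eq_ratio θ θ' s (hf.comp measurable_prodMk_left)

/-- The law of the trajectory generated by `π_θ`. -/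
noncomputable abbrev law (𝓜 : CMDP S A m γ) (𝓟 : PolicyClass S A d) (θ : EuclideanSpace ℝ (Fin d)) :
    Measure (ℕ → S × A) :=
  𝓜.traj (𝓟.policy θ) (𝓜.ρ ⊗ₘ 𝓟.policy θ)

/-- The likelihood ratio of the first `t + 1` steps of a trajectory. -/
noncomputable def pathRatio (𝓟 : PolicyClass S A d) (θ θ' : EuclideanSpace ℝ (Fin d)) (t : ℕ)
    (τ : ℕ → S × A) : ℝ :=
  ∏ k ∈ Finset.range (t + 1), 𝓟.ratio θ θ' (τ k)

theorem measurable_pathRatio (𝓟 : PolicyClass S A d) (θ θ' : EuclideanSpace ℝ (Fin d)) (t : ℕ) :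
    Measurable (pathRatio 𝓟 θ θ' t) :=
  Finset.measurable_prod _ fun k _ => (𝓟.measurable_ratio θ θ').comp (measurable_pi_apply k)

theorem pathRatio_pos (𝓟 : PolicyClass S A d) (θ θ' : EuclideanSpace ℝ (Fin d)) (t : ℕ)
    (τ : ℕ → S × A) : 0 < pathRatio 𝓟 θ θ' t τ :=
  Finset.prod_pos fun _ _ => 𝓟.ratio_pos _ _ _

theorem pathRatio_self (𝓟 : PolicyClass S A d) (θ : EuclideanSpace ℝ (Fin d)) (t : ℕ)
    (τ : ℕ → S × A) : pathRatio 𝓟 θ θ t τ = 1 :=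
  Finset.prod_eq_one fun _ _ => 𝓟.ratio_self _ _

theorem pathRatio_update (𝓟 : PolicyClass S A d) (θ θ' : EuclideanSpace ℝ (Fin d)) (t : ℕ)
    (τ : ℕ → S × A) (y : S × A) :
    pathRatio 𝓟 θ θ' (t + 1) (Function.update τ (t + 1) y)
      = pathRatio 𝓟 θ θ' t τ * 𝓟.ratio θ θ' y := by
  rw [pathRatio, Finset.prod_range_succ, Function.update_self, pathRatio]
  congr 1
  refine Finset.prod_congr rfl fun k hk => ?_
  rw [Function.update_of_ne (by simp at hk; omega)]

theorem dependsOn_pathRatio (𝓟 : PolicyClass S A d) (θ θ' : EuclideanSpace ℝ (Fin d)) (t : ℕ) :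
    DependsOn (pathRatio 𝓟 θ θ' t) (Set.Iic t) := fun x y h => by
  refine Finset.prod_congr rfl fun k hk => ?_
  rw [h k (by simp at hk ⊢; omega)]

theorem measurable_update_coord (n : ℕ) :
    Measurable fun p : (ℕ → S × A) × (S × A) => Function.update p.1 n p.2 := by
  refine measurable_pi_lambda _ fun i => ?_
  by_cases h : i = n
  · subst h; simp only [Function.update_self]; fun_prop
  · simp only [Function.update_of_ne h]; fun_prop

/-- Change of measure between the trajectories of two parameters. -/
theorem lintegral_law_eq_pathRatio (𝓜 : CMDP S A m γ) (𝓟 : PolicyClass S A d)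
    (θ θ' : EuclideanSpace ℝ (Fin d)) (n : ℕ) {F : (ℕ → S × A) → ℝ≥0∞} (hF : Measurable F)
    (hdep : DependsOn F (Set.Iic n)) :
    ∫⁻ τ, F τ ∂(𝓜.law 𝓟 θ') = ∫⁻ τ, ENNReal.ofReal (pathRatio 𝓟 θ θ' n τ) * F τ ∂(𝓜.law 𝓟 θ) := by
  induction n generalizing F with
  | zero =>
    obtain ⟨x₀⟩ : Nonempty (S × A) := nonempty_of_isProbabilityMeasure (𝓜.ρ ⊗ₘ 𝓟.policy θ)
    have hc : Measurable fun (x : S × A) (_ : ℕ) => x := measurable_pi_lambda _ fun _ => measurable_id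
    have h1 : ∀ τ, F τ = (fun x => F fun _ => x) (τ 0) := fun τ =>
      hdep fun i hi => by simp only [Set.mem_Iic, nonpos_iff_eq_zero] at hi; rw [hi]
    have h2 : ∀ τ, ENNReal.ofReal (pathRatio 𝓟 θ θ' 0 τ) * F τ
        = (fun x => ENNReal.ofReal (𝓟.ratio θ θ' x) * F fun _ => x) (τ 0) := fun τ => by
      rw [h1]; simp [pathRatio]
    have hg1 : Measurable fun x : S × A => F fun _ => x := hF.comp hc
    have hg2 : Measurable fun x : S × A => ENNReal.ofReal (𝓟.ratio θ θ' x) * F fun _ => x :=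
      (𝓟.measurable_ratio θ θ').ennreal_ofReal.mul hg1
    rw [lintegral_congr h1, lintegral_congr h2, ← lintegral_map hg1 (measurable_pi_apply 0),
      ← lintegral_map hg2 (measurable_pi_apply 0), map_traj_zero, map_traj_zero,
      Measure.lintegral_compProd hg1, Measure.lintegral_compProd hg2]
    exact lintegral_congr fun s =>
      𝓟.lintegral_policy_eq_ratio θ θ' s (hg1.comp measurable_prodMk_left)
  | succ n ih =>
    have hFu : Measurable fun p : (ℕ → S × A) × (S × A) => F (Function.update p.1 (n + 1) p.2) :=
      hF.comp (measurable_update_coord _)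
    have hWF : Measurable fun τ => ENNReal.ofReal (pathRatio 𝓟 θ θ' (n + 1) τ) * F τ :=
      (measurable_pathRatio 𝓟 θ θ' (n + 1)).ennreal_ofReal.mul hF
    rw [𝓜.lintegral_traj_succ _ _ n hF (by exact_mod_cast hdep),
      𝓜.lintegral_traj_succ _ _ n hWF ?_, ih]
    · refine lintegral_congr fun τ => ?_
      have hFτ : Measurable fun y => F (Function.update τ (n + 1) y) :=
        hFu.comp measurable_prodMk_left
      have hm : Measurable fun y => ENNReal.ofReal (𝓟.ratio θ θ' y)
          * F (Function.update τ (n + 1) y) := (𝓟.measurable_ratio θ θ').ennreal_ofReal.mul hFτ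
      rw [𝓜.lintegral_step_eq_ratio 𝓟 θ θ' _ hFτ, ← lintegral_const_mul _ hm]
      refine lintegral_congr fun y => ?_
      rw [pathRatio_update, ENNReal.ofReal_mul (pathRatio_pos _ _ _ _ _).le, mul_assoc]
    · exact Measurable.lintegral_kernel_prod_right'
        (κ := (𝓜.step (𝓟.policy θ')).comap (fun τ : ℕ → S × A => τ n) (measurable_pi_apply n)) hFu
    · intro x y h
      have : x n = y n := h n (by simp)
      simp only [this]
      refine lintegral_congr fun z => hdep fun i hi => ?_
      by_cases hin : i = n + 1
      · subst hin; simp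
      · rw [Function.update_of_ne hin, Function.update_of_ne hin]
        exact h i (by simp at hi ⊢; omega)
    · intro x y h
      have h' : ∀ i ∈ Set.Iic (n + 1), x i = y i := fun i hi => h i (by simpa using hi)
      simp only [hdep h', dependsOn_pathRatio 𝓟 θ θ' (n + 1) h']

/-- No integrability is required: the two measures push forward under `F` to the same measure on the
line. -/
theorem integral_law_eq_pathRatio (𝓜 : CMDP S A m γ) (𝓟 : PolicyClass S A d)
    (θ θ' : EuclideanSpace ℝ (Fin d)) (n : ℕ) {F : (ℕ → S × A) → ℝ} (hF : Measurable F)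
    (hdep : DependsOn F (Set.Iic n)) :
    ∫ τ, F τ ∂(𝓜.law 𝓟 θ') = ∫ τ, pathRatio 𝓟 θ θ' n τ * F τ ∂(𝓜.law 𝓟 θ) := by
  have hW := (measurable_pathRatio (S := S) (A := A) 𝓟 θ θ' n).ennreal_ofReal
  have hmap : (𝓜.law 𝓟 θ').map F
      = ((𝓜.law 𝓟 θ).withDensity fun τ => ENNReal.ofReal (pathRatio 𝓟 θ θ' n τ)).map F := by
    ext s hs
    rw [Measure.map_apply hF hs, Measure.map_apply hF hs, ← lintegral_indicator_one (hF hs),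
      ← lintegral_indicator_one (hF hs), lintegral_withDensity_eq_lintegral_mul _ hW
        (measurable_one.indicator (hF hs)),
      𝓜.lintegral_law_eq_pathRatio 𝓟 θ θ' n (measurable_one.indicator (hF hs))]
    · rfl
    · intro x y hxy
      change s.indicator (1 : ℝ → ℝ≥0∞) (F x) = s.indicator 1 (F y)
      rw [hdep hxy]
  calc ∫ τ, F τ ∂(𝓜.law 𝓟 θ') = ∫ x, x ∂((𝓜.law 𝓟 θ').map F) :=
        (integral_map hF.aemeasurable aestronglyMeasurable_id).symm
    _ = _ := by
      rw [hmap, integral_map hF.aemeasurable (f := fun x : ℝ => x) aestronglyMeasurable_id,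
        integral_withDensity_eq_integral_toReal_smul hW (ae_of_all _ fun _ => ENNReal.ofReal_lt_top)]
      refine integral_congr_ae (ae_of_all _ fun τ => ?_)
      simp [ENNReal.toReal_ofReal (pathRatio_pos _ _ _ _ _).le]

theorem integrable_pathRatio (𝓜 : CMDP S A m γ) (𝓟 : PolicyClass S A d)
    (θ θ' : EuclideanSpace ℝ (Fin d)) (n : ℕ) :
    Integrable (pathRatio 𝓟 θ θ' n) (𝓜.law 𝓟 θ) ∧ ∫ τ, pathRatio 𝓟 θ θ' n τ ∂(𝓜.law 𝓟 θ) = 1 := by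
  have h := 𝓜.integral_law_eq_pathRatio 𝓟 θ θ' n (F := fun _ => 1) measurable_const
    fun _ _ _ => rfl
  simp only [integral_const, probReal_univ, smul_eq_mul, mul_one] at h
  refine ⟨?_, h.symm⟩
  -- A non-integrable function has integral zero, whereas this one has integral one.
  by_contra hc
  rw [integral_undef hc] at h
  norm_num at h

end CMDP

/-! ### Score moments and second-order expansion of trajectory expectations. -/

namespace CMDP

variable {S : Type u} {A : Type v} [MeasurableSpace S] [MeasurableSpace A] {m : ℕ} {γ : ℝ} {d : ℕ}

/-- The score at `θ` is bounded by `Mg`, and differentiable with derivative bounded by `Mh`. -/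
def RegularScore (𝓟 : PolicyClass S A d) (Mg Mh : ℝ) (θ : EuclideanSpace ℝ (Fin d)) : Prop :=
  ∀ x : S × A, ‖𝓟.score θ x‖ ≤ Mg ∧ DifferentiableAt ℝ (fun θ' => 𝓟.score θ' x) θ ∧
    ‖fderiv ℝ (fun θ' => 𝓟.score θ' x) θ‖ ≤ Mh

/-- The score of the first `t + 1` steps of a trajectory. -/
noncomputable def pathScore (𝓟 : PolicyClass S A d) (θ : EuclideanSpace ℝ (Fin d)) (t : ℕ)
    (τ : ℕ → S × A) : EuclideanSpace ℝ (Fin d) :=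
  ∑ k ∈ Finset.range (t + 1), 𝓟.score θ (τ k)

theorem measurable_pathScore (𝓟 : PolicyClass S A d) (θ : EuclideanSpace ℝ (Fin d)) (t : ℕ) :
    Measurable (pathScore 𝓟 θ t) :=
  Finset.measurable_sum _ fun k _ => (𝓟.measurable_score θ).comp (measurable_pi_apply k)

theorem dependsOn_pathScore (𝓟 : PolicyClass S A d) (θ : EuclideanSpace ℝ (Fin d)) (t : ℕ) :
    DependsOn (pathScore 𝓟 θ t) (Set.Iic t) := fun x y h => by
  refine Finset.sum_congr rfl fun k hk => ?_
  rw [h k (by simp at hk ⊢; omega)]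

theorem norm_pathScore_le {𝓟 : PolicyClass S A d} {θ : EuclideanSpace ℝ (Fin d)} {Mg : ℝ}
    (h : ∀ x, ‖𝓟.score θ x‖ ≤ Mg) (t : ℕ) (τ : ℕ → S × A) :
    ‖pathScore 𝓟 θ t τ‖ ≤ (t + 1) * Mg := by
  refine (norm_sum_le_of_le _ fun k _ => h (τ k)).trans ?_
  simp

theorem abs_inner_le_of_norm_le {v u : EuclideanSpace ℝ (Fin d)} {C : ℝ} (hv : ‖v‖ ≤ C)
    (hu : ‖u‖ ≤ 1) : |inner ℝ v u| ≤ C :=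
  (abs_real_inner_le_norm v u).trans <|
    (mul_le_of_le_one_right (norm_nonneg v) hu).trans hv

theorem hasDerivAt_integral_of_abs_deriv_le {Ω : Type*} [MeasurableSpace Ω] {P : Measure Ω}
    [IsFiniteMeasure P] {f f' : ℝ → Ω → ℝ} {ε C : ℝ} (hε : 0 < ε) (hf : ∀ s, Measurable (f s))
    (hf0 : Integrable (f 0) P)
    (hd : ∀ s, |s| < ε → ∀ ω, HasDerivAt (fun s => f s ω) (f' s ω) s)
    (hb : ∀ s, |s| < ε → ∀ ω, |f' s ω| ≤ C) :
    HasDerivAt (fun s => ∫ ω, f s ω ∂P) (∫ ω, f' 0 ω ∂P) 0 := by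
  have hm : Measurable (f' 0) :=
    PolicyClass.measurable_of_hasDerivAt (s := 0) hf (hd 0 (by simpa using hε))
  have hball : ∀ {s : ℝ}, s ∈ Metric.ball (0 : ℝ) ε → |s| < ε := fun hs => by
    simpa [Real.norm_eq_abs] using hs
  exact (hasDerivAt_integral_of_dominated_loc_of_deriv_le (Metric.ball_mem_nhds (0 : ℝ) hε)
    (Filter.Eventually.of_forall fun s => (hf s).aestronglyMeasurable) hf0
    hm.aestronglyMeasurable (bound := fun _ => C)
    (ae_of_all _ fun ω s hs => hb s (hball hs) ω) (integrable_const C)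
    (ae_of_all _ fun ω s hs => hd s (hball hs) ω)).2

theorem pathRatio_eq_exp (𝓟 : PolicyClass S A d) (θ θ' : EuclideanSpace ℝ (Fin d)) (t : ℕ)
    (τ : ℕ → S × A) : pathRatio 𝓟 θ θ' t τ = Real.exp (∑ k ∈ Finset.range (t + 1),
      (Real.log (𝓟.dens θ' (τ k).1 (τ k).2) - Real.log (𝓟.dens θ (τ k).1 (τ k).2))) := by
  rw [Real.exp_sum, pathRatio]
  refine Finset.prod_congr rfl fun k _ => ?_
  rw [Real.exp_sub, Real.exp_log (𝓟.dens_pos _ _ _), Real.exp_log (𝓟.dens_pos _ _ _)]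
  rfl

theorem hasDerivAt_pathRatio (𝓟 : PolicyClass S A d) (θ u : EuclideanSpace ℝ (Fin d)) (t : ℕ)
    (τ : ℕ → S × A) (s : ℝ) : HasDerivAt (fun s : ℝ => pathRatio 𝓟 θ (θ + s • u) t τ)
      (pathRatio 𝓟 θ (θ + s • u) t τ * inner ℝ (pathScore 𝓟 (θ + s • u) t τ) u) s := by
  simp_rw [pathRatio_eq_exp]
  refine HasDerivAt.exp ?_
  rw [pathScore, sum_inner]
  exact HasDerivAt.fun_sum fun k _ => (𝓟.hasDerivAt_log_dens θ u (τ k) s).sub_const _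

/-- The log-ratio vanishes at `s = 0` and has slope at most (t + 1) Mg, so the mean value inequality
applies. The resulting constant is the dominating function for differentiation under the integral.
-/
theorem pathRatio_le {𝓟 : PolicyClass S A d} {θ u : EuclideanSpace ℝ (Fin d)} {Mg ε : ℝ}
    (hu : ‖u‖ ≤ 1) (hε : 0 < ε) (hr : ∀ s : ℝ, |s| < ε → ∀ x, ‖𝓟.score (θ + s • u) x‖ ≤ Mg)
    (t : ℕ) (τ : ℕ → S × A) {s : ℝ} (hs : |s| < ε) :
    pathRatio 𝓟 θ (θ + s • u) t τ ≤ Real.exp ((t + 1) * Mg * ε) := by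
  rw [pathRatio_eq_exp, Real.exp_le_exp]
  set g : ℝ → ℝ := fun s => ∑ k ∈ Finset.range (t + 1),
      (Real.log (𝓟.dens (θ + s • u) (τ k).1 (τ k).2) - Real.log (𝓟.dens θ (τ k).1 (τ k).2)) with hg
  have hd : ∀ s, HasDerivAt g (inner ℝ (pathScore 𝓟 (θ + s • u) t τ) u) s := fun s => by
    rw [pathScore, sum_inner]
    exact HasDerivAt.fun_sum fun k _ => (𝓟.hasDerivAt_log_dens θ u (τ k) s).sub_const _
  have h0 : g 0 = 0 := by simp [hg]
  have hMg : 0 ≤ (t + 1) * Mg := (norm_nonneg _).trans (norm_pathScore_le (hr 0 (by simpa)) t τ)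
  have := Convex.norm_image_sub_le_of_norm_hasDerivWithin_le (𝕜 := ℝ) (f := g)
    (s := Metric.ball (0 : ℝ) ε) (x := 0) (y := s) (C := (t + 1) * Mg)
    (fun s _ => (hd s).hasDerivWithinAt)
    (fun s hs => abs_inner_le_of_norm_le
      (norm_pathScore_le (hr s (by simpa [Real.norm_eq_abs] using hs)) t τ) hu)
    (convex_ball _ _) (by simpa using hε) (by simpa [Real.norm_eq_abs] using hs)
  rw [h0, sub_zero, sub_zero, Real.norm_eq_abs, Real.norm_eq_abs] at this
  exact (le_abs_self _).trans (this.trans (mul_le_mul_of_nonneg_left hs.le hMg))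

theorem integral_step_ratio (𝓜 : CMDP S A m γ) (𝓟 : PolicyClass S A d)
    (θ θ' : EuclideanSpace ℝ (Fin d)) (x : S × A) :
    ∫ y, 𝓟.ratio θ θ' y ∂(𝓜.step (𝓟.policy θ) x) = 1 := by
  rw [integral_eq_lintegral_of_nonneg_ae (ae_of_all _ fun y => (𝓟.ratio_pos θ θ' y).le)
    (𝓟.measurable_ratio θ θ').aestronglyMeasurable]
  have := 𝓜.lintegral_step_eq_ratio 𝓟 θ θ' x (f := fun _ => 1) measurable_const
  simp only [lintegral_const, measure_univ, mul_one] at this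
  rw [← this, ENNReal.toReal_one]

/-- The score has mean zero along each transition. -/
theorem integral_step_score {𝓜 : CMDP S A m γ} {𝓟 : PolicyClass S A d}
    {θ u : EuclideanSpace ℝ (Fin d)} {Mg ε : ℝ} (hu : ‖u‖ ≤ 1) (hε : 0 < ε)
    (hr : ∀ s : ℝ, |s| < ε → ∀ x, ‖𝓟.score (θ + s • u) x‖ ≤ Mg) (x : S × A) :
    ∫ y, inner ℝ (𝓟.score θ y) u ∂(𝓜.step (𝓟.policy θ) x) = 0 := by
  -- A single transition is viewed as a path with one step, so that the path estimates can be
  -- reused.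
  have hW : ∀ (s : ℝ) (y : S × A), pathRatio 𝓟 θ (θ + s • u) 0 (fun _ => y) = 𝓟.ratio θ (θ + s • u) y :=
    fun s y => by simp [pathRatio]
  have hZ : ∀ (s : ℝ) (y : S × A), pathScore 𝓟 (θ + s • u) 0 (fun _ => y) = 𝓟.score (θ + s • u) y :=
    fun s y => by simp [pathScore]
  have h := hasDerivAt_integral_of_abs_deriv_le (P := 𝓜.step (𝓟.policy θ) x) (ε := ε)
    (f := fun s y => 𝓟.ratio θ (θ + s • u) y)
    (f' := fun s y => 𝓟.ratio θ (θ + s • u) y * inner ℝ (𝓟.score (θ + s • u) y) u)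
    (C := Real.exp ((0 + 1) * Mg * ε) * Mg) hε
    (fun s => 𝓟.measurable_ratio _ _) (by simp [PolicyClass.ratio_self])
    (fun s _ y => by simpa only [hW, hZ] using hasDerivAt_pathRatio 𝓟 θ u 0 (fun _ => y) s)
    (fun s hs y => by
      rw [abs_mul, abs_of_pos (𝓟.ratio_pos _ _ _)]
      have h1 := pathRatio_le hu hε hr 0 (fun _ => y) hs
      rw [hW, Nat.cast_zero] at h1
      exact mul_le_mul h1 (abs_inner_le_of_norm_le (hr s hs y) hu) (abs_nonneg _)
        (Real.exp_pos _).le)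
  -- The ratio has total mass one for every `s`; its derivative at zero, the mean score, must
  -- vanish.
  simp only [integral_step_ratio, zero_smul, add_zero, PolicyClass.ratio_self, one_mul] at h
  exact h.unique (hasDerivAt_const _ _)

/-- The scores of the different steps are uncorrelated. -/
theorem integral_pathScore_sq_le {𝓜 : CMDP S A m γ} {𝓟 : PolicyClass S A d}
    {θ u : EuclideanSpace ℝ (Fin d)} {Mg ε : ℝ} (hu : ‖u‖ ≤ 1) (hε : 0 < ε)
    (hr : ∀ s : ℝ, |s| < ε → ∀ x, ‖𝓟.score (θ + s • u) x‖ ≤ Mg) (t : ℕ) :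
    ∫ τ, inner ℝ (pathScore 𝓟 θ t τ) u ^ 2 ∂(𝓜.law 𝓟 θ) ≤ (t + 1) * Mg ^ 2 := by
  have hr0 : ∀ x, ‖𝓟.score θ x‖ ≤ Mg := by simpa using hr 0 (by simpa)
  have hz : ∀ x, |inner ℝ (𝓟.score θ x) u| ≤ Mg := fun x => abs_inner_le_of_norm_le (hr0 x) hu
  have hzm : Measurable fun x => inner ℝ (𝓟.score θ x) u :=
    (𝓟.measurable_score θ).inner_const
  have hzsq : ∀ x, inner ℝ (𝓟.score θ x) u ^ 2 ≤ Mg ^ 2 := fun x => by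
    rw [← sq_abs]; gcongr; exact hz x
  have hZ : ∀ t τ, |inner ℝ (pathScore 𝓟 θ t τ) u| ≤ (t + 1) * Mg := fun t τ =>
    abs_inner_le_of_norm_le (norm_pathScore_le hr0 t τ) hu
  have hZm : ∀ t, Measurable fun τ => inner ℝ (pathScore 𝓟 θ t τ) u := fun t =>
    (measurable_pathScore 𝓟 θ t).inner_const
  induction t with
  | zero =>
    refine (le_abs_self _).trans (abs_integral_le_of_abs_le fun τ => ?_)
    simpa [pathScore] using hzsq (τ 0)
  | succ t ih =>
    have hsplit : ∀ τ, inner ℝ (pathScore 𝓟 θ (t + 1) τ) u ^ 2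
        = inner ℝ (pathScore 𝓟 θ t τ) u ^ 2
          + 2 * (inner ℝ (pathScore 𝓟 θ t τ) u * inner ℝ (𝓟.score θ (τ (t + 1))) u)
          + inner ℝ (𝓟.score θ (τ (t + 1))) u ^ 2 := fun τ => by
      have : pathScore 𝓟 θ (t + 1) τ = pathScore 𝓟 θ t τ + 𝓟.score θ (τ (t + 1)) := by
        rw [pathScore, Finset.sum_range_succ]; rfl
      rw [this, inner_add_left]; ring
    have hzt : Measurable fun τ : ℕ → S × A => inner ℝ (𝓟.score θ (τ (t + 1))) u :=
      hzm.comp (measurable_pi_apply (t + 1))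
    have hMg : 0 ≤ Mg := by
      obtain ⟨x⟩ : Nonempty (S × A) := nonempty_of_isProbabilityMeasure (𝓜.ρ ⊗ₘ 𝓟.policy θ)
      exact (norm_nonneg _).trans (hr0 x)
    have hi1 : Integrable (fun τ => inner ℝ (pathScore 𝓟 θ t τ) u ^ 2) (𝓜.law 𝓟 θ) :=
      integrable_of_abs_le ((hZm t).pow_const 2) (C := ((t + 1) * Mg) ^ 2) fun τ => by
        rw [abs_pow]; gcongr; exact hZ t τ
    have hi2 : Integrable (fun τ => inner ℝ (pathScore 𝓟 θ t τ) u
        * inner ℝ (𝓟.score θ (τ (t + 1))) u) (𝓜.law 𝓟 θ) :=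
      integrable_of_abs_le ((hZm t).mul hzt) (C := ((t + 1) * Mg) * Mg) fun τ => by
        rw [abs_mul]; gcongr
        · exact hZ t τ
        · exact hz _
    have hi3 : Integrable (fun τ : ℕ → S × A => inner ℝ (𝓟.score θ (τ (t + 1))) u ^ 2)
        (𝓜.law 𝓟 θ) :=
      integrable_of_abs_le (hzt.pow_const 2) (C := Mg ^ 2) fun τ => by
        rw [abs_pow]; gcongr; exact hz _
    -- Integrating out the last coordinate first leaves the past score times the mean of the next
    -- score, which is zero.
    have hcross : ∫ τ, inner ℝ (pathScore 𝓟 θ t τ) u * inner ℝ (𝓟.score θ (τ (t + 1))) u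
        ∂(𝓜.law 𝓟 θ) = 0 := by
      have hm : Measurable fun τ => inner ℝ (pathScore 𝓟 θ t τ) u
        * inner ℝ (𝓟.score θ (τ (t + 1))) u := (hZm t).mul hzt
      rw [𝓜.integral_traj_succ _ _ t hm ?_ hi2]
      · refine integral_eq_zero_of_ae (ae_of_all _ fun τ => ?_)
        have h1 : ∀ y, inner ℝ (pathScore 𝓟 θ t (Function.update τ (t + 1) y)) u
            * inner ℝ (𝓟.score θ (Function.update τ (t + 1) y (t + 1))) u
            = inner ℝ (pathScore 𝓟 θ t τ) u * inner ℝ (𝓟.score θ y) u := fun y => by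
          rw [Function.update_self, dependsOn_pathScore 𝓟 θ t (x := Function.update τ (t + 1) y)
            (y := τ) fun i hi => Function.update_of_ne (by simp at hi; omega) _ _]
        simp only [h1, Pi.zero_apply]
        rw [integral_const_mul, integral_step_score hu hε hr, mul_zero]
      · intro x y h
        simp only
        rw [dependsOn_pathScore 𝓟 θ t (x := x) (y := y)
          fun i hi => h i (by simp at hi ⊢; omega), h (t + 1) (by simp)]
    have hi12 : Integrable (fun τ => inner ℝ (pathScore 𝓟 θ t τ) u ^ 2
        + 2 * (inner ℝ (pathScore 𝓟 θ t τ) u * inner ℝ (𝓟.score θ (τ (t + 1))) u)) (𝓜.law 𝓟 θ) :=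
      hi1.add (hi2.const_mul 2)
    simp_rw [hsplit]
    rw [integral_add hi12 hi3, integral_add hi1 (hi2.const_mul 2), integral_const_mul, hcross]
    have h3 : ∫ τ : ℕ → S × A, inner ℝ (𝓟.score θ (τ (t + 1))) u ^ 2 ∂(𝓜.law 𝓟 θ) ≤ Mg ^ 2 :=
      (le_abs_self _).trans (abs_integral_le_of_abs_le fun τ => by
        rw [abs_pow]; gcongr; exact hz _)
    push_cast
    linarith

variable {𝓜 : CMDP S A m γ} {𝓟 : PolicyClass S A d} {θ u : EuclideanSpace ℝ (Fin d)}
  {Mg Mh ε : ℝ} {R : (ℕ → S × A) → ℝ} {t : ℕ}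

/-- The log-derivative trick: the ratio has derivative ratio times score, and the ratio is one at `s
= 0`. -/
theorem hasDerivAt_integral_law (hu : ‖u‖ ≤ 1) (hε : 0 < ε)
    (hr : ∀ s : ℝ, |s| < ε → ∀ x, ‖𝓟.score (θ + s • u) x‖ ≤ Mg) (hR : Measurable R)
    (hRb : ∀ τ, |R τ| ≤ 1) (hRd : DependsOn R (Set.Iic t)) :
    HasDerivAt (fun s : ℝ => ∫ τ, R τ ∂(𝓜.law 𝓟 (θ + s • u)))
      (∫ τ, R τ * inner ℝ (pathScore 𝓟 θ t τ) u ∂(𝓜.law 𝓟 θ)) 0 := by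
  simp_rw [fun s : ℝ => 𝓜.integral_law_eq_pathRatio 𝓟 θ (θ + s • u) t hR hRd]
  have h := hasDerivAt_integral_of_abs_deriv_le (P := 𝓜.law 𝓟 θ) (ε := ε)
    (f := fun s τ => pathRatio 𝓟 θ (θ + s • u) t τ * R τ)
    (f' := fun s τ => pathRatio 𝓟 θ (θ + s • u) t τ * inner ℝ (pathScore 𝓟 (θ + s • u) t τ) u * R τ)
    (C := Real.exp ((t + 1) * Mg * ε) * ((t + 1) * Mg) * 1) hε
    (fun s => (measurable_pathRatio _ _ _ _).mul hR)
    (by simpa [pathRatio_self] using integrable_of_abs_le hR hRb)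
    (fun s _ τ => (hasDerivAt_pathRatio 𝓟 θ u t τ s).mul_const _)
    (fun s hs τ => by
      have h1 := pathRatio_le hu hε hr t τ hs
      have h2 := abs_inner_le_of_norm_le (norm_pathScore_le (hr s hs) t τ) hu
      have h3 := (abs_nonneg _).trans h2
      rw [abs_mul, abs_mul, abs_of_pos (pathRatio_pos _ _ _ _ _)]
      gcongr
      exact hRb τ)
  convert h using 1
  refine integral_congr_ae (ae_of_all _ fun τ => ?_)
  simp [pathRatio_self, mul_comm]

/-- The derivative at zero is the mean of R (Z² + Z'), with Z the path score along `u`. Since the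
scores are uncorrelated, the mean of Z² grows linearly in t instead of quadratically; this is what
leads to the power (1 - γ)⁻² in the smoothness constant. -/
theorem exists_hasDerivAt_integral_pathScore (hu : ‖u‖ ≤ 1) (hε : 0 < ε)
    (hr : ∀ s : ℝ, |s| < ε → RegularScore 𝓟 Mg Mh (θ + s • u)) (hR : Measurable R)
    (hRb : ∀ τ, |R τ| ≤ 1) (hRd : DependsOn R (Set.Iic t)) :
    ∃ D : ℝ, |D| ≤ (t + 1) * (Mg ^ 2 + Mh) ∧
      HasDerivAt (fun s : ℝ => ∫ τ, R τ * inner ℝ (pathScore 𝓟 (θ + s • u) t τ) u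
        ∂(𝓜.law 𝓟 (θ + s • u))) D 0 := by
  obtain ⟨x₀⟩ : Nonempty (S × A) := nonempty_of_isProbabilityMeasure (𝓜.ρ ⊗ₘ 𝓟.policy θ)
  have hr' : ∀ s : ℝ, |s| < ε → ∀ x, ‖𝓟.score (θ + s • u) x‖ ≤ Mg := fun s hs x => (hr s hs x).1
  set Z : ℝ → (ℕ → S × A) → ℝ := fun s τ => inner ℝ (pathScore 𝓟 (θ + s • u) t τ) u with hZ
  set Z' : ℝ → (ℕ → S × A) → ℝ := fun s τ => ∑ k ∈ Finset.range (t + 1),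
    inner ℝ (fderiv ℝ (fun θ' => 𝓟.score θ' (τ k)) (θ + s • u) u) u with hZ'
  have hZm : ∀ s, Measurable (Z s) := fun s => (measurable_pathScore 𝓟 _ t).inner_const
  have hZb : ∀ s, |s| < ε → ∀ τ, |Z s τ| ≤ (t + 1) * Mg := fun s hs τ =>
    abs_inner_le_of_norm_le (norm_pathScore_le (hr' s hs) t τ) hu
  have hZb' : ∀ s, |s| < ε → ∀ τ, |Z' s τ| ≤ (t + 1) * Mh := fun s hs τ => by
    refine (Finset.abs_sum_le_sum_abs _ _).trans ?_
    have : ∀ k ∈ Finset.range (t + 1),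
        |inner ℝ (fderiv ℝ (fun θ' => 𝓟.score θ' (τ k)) (θ + s • u) u) u| ≤ Mh := fun k _ => by
      refine abs_inner_le_of_norm_le ?_ hu
      refine (ContinuousLinearMap.le_opNorm _ _).trans ?_
      exact (mul_le_of_le_one_right (norm_nonneg _) hu).trans (hr s hs (τ k)).2.2
    simpa using Finset.sum_le_sum this
  have hZd : ∀ s, |s| < ε → ∀ τ, HasDerivAt (fun s => Z s τ) (Z' s τ) s := fun s hs τ => by
    simp only [hZ, hZ', pathScore, sum_inner]
    refine HasDerivAt.fun_sum fun k _ => ?_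
    have h1 := (hr s hs (τ k)).2.1.hasFDerivAt.comp_hasDerivAt s
      (PolicyClass.hasDerivAt_add_smul θ u s)
    simpa using h1.inner ℝ (hasDerivAt_const s u)
  have hMg : 0 ≤ (t + 1) * Mg := (abs_nonneg _).trans (hZb 0 (by simpa) fun _ => x₀)
  have hMh : 0 ≤ (t + 1) * Mh := (abs_nonneg _).trans (hZb' 0 (by simpa) fun _ => x₀)
  have hdep : ∀ s, DependsOn (fun τ => R τ * Z s τ) (Set.Iic t) := fun s x y h => by
    simp only [hZ]
    rw [hRd h, dependsOn_pathScore 𝓟 _ t h]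
  have h := hasDerivAt_integral_of_abs_deriv_le (P := 𝓜.law 𝓟 θ) (ε := ε)
    (f := fun s τ => pathRatio 𝓟 θ (θ + s • u) t τ * (R τ * Z s τ))
    (f' := fun s τ => pathRatio 𝓟 θ (θ + s • u) t τ * Z s τ * (R τ * Z s τ)
      + pathRatio 𝓟 θ (θ + s • u) t τ * (R τ * Z' s τ))
    (C := Real.exp ((t + 1) * Mg * ε) * ((t + 1) * Mg) * (1 * ((t + 1) * Mg))
      + Real.exp ((t + 1) * Mg * ε) * (1 * ((t + 1) * Mh))) hε
    (fun s => (measurable_pathRatio _ _ _ _).mul (hR.mul (hZm s)))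
    (by
      refine integrable_of_abs_le ((measurable_pathRatio _ _ _ _).mul (hR.mul (hZm 0)))
        (C := 1 * ((t + 1) * Mg)) fun τ => ?_
      simp only [zero_smul, add_zero, pathRatio_self, one_mul, abs_mul]
      have h1 := hZb 0 (by simpa) τ
      simp only [zero_smul, add_zero, hZ] at h1 ⊢
      exact (mul_le_of_le_one_left (abs_nonneg _) (hRb τ)).trans h1)
    (fun s hs τ => (hasDerivAt_pathRatio 𝓟 θ u t τ s).mul ((hZd s hs τ).const_mul _))
    (fun s hs τ => by
      have h1 := pathRatio_le hu hε hr' t τ hs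
      have h2 := hZb s hs τ
      have h3 := hZb' s hs τ
      refine (abs_add_le _ _).trans ?_
      rw [abs_mul, abs_mul, abs_mul, abs_mul, abs_mul, abs_of_pos (pathRatio_pos _ _ _ _ _)]
      gcongr
      · exact hRb τ
      · exact hRb τ)
  refine ⟨_, ?_, h.congr_of_eventuallyEq ?_⟩
  · have hi : Integrable (fun τ => Z 0 τ ^ 2) (𝓜.law 𝓟 θ) :=
      integrable_of_abs_le ((hZm 0).pow_const 2) (C := ((t + 1) * Mg) ^ 2) fun τ => by
        rw [abs_pow]; gcongr; exact hZb 0 (by simpa) τ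
    have hsq := integral_pathScore_sq_le (𝓜 := 𝓜) hu hε hr' t
    have hle : ∀ τ, ‖pathRatio 𝓟 θ (θ + (0 : ℝ) • u) t τ * Z 0 τ * (R τ * Z 0 τ)
      + pathRatio 𝓟 θ (θ + (0 : ℝ) • u) t τ * (R τ * Z' 0 τ)‖ ≤ Z 0 τ ^ 2 + (t + 1) * Mh := by
      intro τ
      have h1 := hRb τ
      have h3 := hZb' 0 (by simpa) τ
      simp only [zero_smul, add_zero, pathRatio_self, one_mul]
      refine (norm_add_le _ _).trans (add_le_add ?_ ?_)
      · rw [show Z 0 τ * (R τ * Z 0 τ) = R τ * Z 0 τ ^ 2 by ring, norm_mul, Real.norm_eq_abs,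
          Real.norm_of_nonneg (sq_nonneg _)]
        exact mul_le_of_le_one_left (sq_nonneg _) h1
      · rw [norm_mul, Real.norm_eq_abs, Real.norm_eq_abs]
        exact (mul_le_of_le_one_left (abs_nonneg _) h1).trans h3
    refine (norm_integral_le_of_norm_le (hi.add (integrable_const ((t + 1) * Mh)))
      (ae_of_all _ hle)).trans ?_
    simp only [Pi.add_apply]
    rw [integral_add hi (integrable_const _)]
    simp only [integral_const, probReal_univ, smul_eq_mul, one_mul]
    simp only [hZ, zero_smul, add_zero]
    linarith
  · refine Filter.Eventually.of_forall fun s => ?_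
    exact 𝓜.integral_law_eq_pathRatio 𝓟 θ (θ + s • u) t (hR.mul (hZm s)) (hdep s)

/-- Second-order Taylor bound along a segment for the expectation of a bounded function of the
first `t + 1` steps of the trajectory. -/
theorem abs_integral_law_taylor_le {h : ℝ} (hu : ‖u‖ ≤ 1) (hh : 0 ≤ h)
    (hr : ∀ s ∈ Set.Icc (0 : ℝ) h, ∀ᶠ θ' in 𝓝 (θ + s • u), RegularScore 𝓟 Mg Mh θ')
    (hR : Measurable R) (hRb : ∀ τ, |R τ| ≤ 1) (hRd : DependsOn R (Set.Iic t)) :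
    |∫ τ, R τ ∂(𝓜.law 𝓟 (θ + h • u)) - ∫ τ, R τ ∂(𝓜.law 𝓟 θ)
      - h * ∫ τ, R τ * inner ℝ (pathScore 𝓟 θ t τ) u ∂(𝓜.law 𝓟 θ)|
      ≤ (t + 1) * (Mg ^ 2 + Mh) * (h ^ 2 / 2) := by
  set J : ℝ → ℝ := fun s => ∫ τ, R τ ∂(𝓜.law 𝓟 (θ + s • u)) with hJ
  set D : ℝ → ℝ := fun s => ∫ τ, R τ * inner ℝ (pathScore 𝓟 (θ + s • u) t τ) u
        ∂(𝓜.law 𝓟 (θ + s • u)) with hD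
  set K : ℝ := (t + 1) * (Mg ^ 2 + Mh) with hK
  -- Regularity near each point of the closed segment allows two-sided derivatives, including at its
  -- ends.
  have hloc : ∀ s ∈ Set.Icc (0 : ℝ) h, ∃ ε > 0, ∀ s' : ℝ, |s'| < ε →
      RegularScore 𝓟 Mg Mh (θ + s • u + s' • u) := by
    intro s hs
    have hc : Filter.Tendsto (fun s' : ℝ => θ + s • u + s' • u) (𝓝 0) (𝓝 (θ + s • u)) := by
      have : Continuous fun s' : ℝ => θ + s • u + s' • u := by fun_prop
      simpa using this.tendsto 0
    obtain ⟨ε, hε, h1⟩ := Metric.eventually_nhds_iff.1 (hc.eventually (hr s hs))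
    exact ⟨ε, hε, fun s' hs' => h1 (by simpa [Real.dist_eq] using hs')⟩
  have hJd : ∀ s ∈ Set.Icc (0 : ℝ) h, HasDerivAt J (D s) s := by
    intro s hs
    obtain ⟨ε, hε, h1⟩ := hloc s hs
    have h2 := hasDerivAt_integral_law (𝓜 := 𝓜) (θ := θ + s • u) hu hε
      (fun s' hs' x => (h1 s' hs' x).1) hR hRb hRd
    have h3 := HasDerivAt.comp_sub_const s s (by simpa using h2)
    refine h3.congr_of_eventuallyEq (Filter.Eventually.of_forall fun s' => ?_)
    have : θ + s' • u = θ + s • u + (s' - s) • u := by rw [add_assoc, ← add_smul]; simp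
    simp only [hJ, this]
  have hDd : ∀ s ∈ Set.Icc (0 : ℝ) h, ∃ D', |D'| ≤ K ∧ HasDerivAt D D' s := by
    intro s hs
    obtain ⟨ε, hε, h1⟩ := hloc s hs
    obtain ⟨D', hb, h2⟩ := exists_hasDerivAt_integral_pathScore (𝓜 := 𝓜) (θ := θ + s • u) hu hε
      h1 hR hRb hRd
    have h3 := HasDerivAt.comp_sub_const s s (by simpa using h2)
    refine ⟨D', hb, ?_⟩
    refine h3.congr_of_eventuallyEq (Filter.Eventually.of_forall fun s' => ?_)
    have : θ + s' • u = θ + s • u + (s' - s) • u := by rw [add_assoc, ← add_smul]; simp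
    simp only [hD, this]
  choose! D' hD'b hD'd using hDd
  have hDlip : ∀ s ∈ Set.Icc (0 : ℝ) h, |D s - D 0| ≤ K * s := by
    intro s hs
    have := norm_image_sub_le_of_norm_deriv_le_segment' (f := D) (f' := D') (C := K) (a := 0)
      (b := h) (fun x hx => (hD'd x hx).hasDerivWithinAt)
      (fun x hx => hD'b x (Set.Ico_subset_Icc_self hx)) s hs
    simpa using this
  -- The remainder has derivative `D s - D 0`, bounded by `K * s`; comparison with `K * s ^ 2 / 2`
  -- integrates this without needing continuity of the second derivative.
  have hfin := image_norm_le_of_norm_deriv_right_le_deriv_boundary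
    (f := fun s => J s - J 0 - s * D 0) (f' := fun s => D s - D 0) (a := 0) (b := h)
    (B := fun s => K * (s ^ 2 / 2)) (B' := fun s => K * s)
    (fun s hs => by
      have hc : ContinuousWithinAt J (Set.Icc 0 h) s := (hJd s hs).continuousAt.continuousWithinAt
      fun_prop)
    (fun s hs => by
      have h1 := ((hJd s (Set.Ico_subset_Icc_self hs)).sub_const (J 0)).fun_sub
        ((hasDerivAt_id' s).mul_const (D 0))
      rw [one_mul] at h1
      exact h1.hasDerivWithinAt)
    (by simp)
    (fun s => by
      have := ((hasDerivAt_pow 2 s).div_const 2).const_mul K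
      simpa using this)
    (fun s hs => hDlip s (Set.Ico_subset_Icc_self hs)) (Set.right_mem_Icc.2 hh)
  simpa [hJ, hD] using hfin

end CMDP

/-! ### Continuity, gradient and smoothness of the values. -/

namespace CMDP

variable {S : Type u} {A : Type v} [MeasurableSpace S] [MeasurableSpace A] {m : ℕ} {γ : ℝ} {d : ℕ}

theorem measurable_reward_coord (𝓜 : CMDP S A m γ) (i : Fin (m + 1)) (t : ℕ) :
    Measurable fun τ : ℕ → S × A => 𝓜.r i (τ t) :=
  (𝓜.measurable_r i).comp (measurable_pi_apply t)

theorem dependsOn_reward_coord (𝓜 : CMDP S A m γ) (i : Fin (m + 1)) (t : ℕ) :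
    DependsOn (fun τ : ℕ → S × A => 𝓜.r i (τ t)) (Set.Iic t) := fun x y h => by
  simp only [h t (by simp)]

theorem hasSum_V (𝓜 : CMDP S A m γ) (𝓟 : PolicyClass S A d) (i : Fin (m + 1))
    (θ : EuclideanSpace ℝ (Fin d)) :
    HasSum (fun t => γ ^ t * ∫ τ, 𝓜.r i (τ t) ∂(𝓜.law 𝓟 θ)) (𝓜.V 𝓟 i θ) :=
  𝓜.hasSum_integral_ret i _

theorem continuous_pathRatio (𝓟 : PolicyClass S A d) (θ : EuclideanSpace ℝ (Fin d)) (t : ℕ)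
    (τ : ℕ → S × A) : Continuous fun θ' => pathRatio 𝓟 θ θ' t τ :=
  continuous_finsetProd _ fun k _ => (𝓟.continuous_dens (τ k)).div_const _

/-- Scheffé's argument. The ratio W tends pointwise to 1 and has mean 1, and |W - 1| = 2 (1 - W)⁺ +
(W - 1), where the positive part is bounded by 1. No score bound enters, which is essential: score
bounds are available on the feasible set only, and openness of its strict part is deduced from this
continuity. -/
theorem continuous_integral_law (𝓜 : CMDP S A m γ) (𝓟 : PolicyClass S A d) {R : (ℕ → S × A) → ℝ}
    {t : ℕ} (hR : Measurable R) (hRb : ∀ τ, |R τ| ≤ 1) (hRd : DependsOn R (Set.Iic t)) :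
    Continuous fun θ => ∫ τ, R τ ∂(𝓜.law 𝓟 θ) := by
  rw [continuous_iff_continuousAt]
  intro θ
  have hW := measurable_pathRatio (S := S) (A := A) 𝓟 θ
  have hlim : Filter.Tendsto (fun θ' => ∫ τ, max (1 - pathRatio 𝓟 θ θ' t τ) 0 ∂(𝓜.law 𝓟 θ))
      (𝓝 θ) (𝓝 0) := by
    have := tendsto_integral_filter_of_dominated_convergence (μ := 𝓜.law 𝓟 θ) (l := 𝓝 θ)
      (F := fun θ' τ => max (1 - pathRatio 𝓟 θ θ' t τ) 0) (f := fun _ => (0 : ℝ)) (fun _ => 1)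
      (Filter.Eventually.of_forall fun θ' =>
        ((measurable_const.sub (hW θ' t)).max measurable_const).aestronglyMeasurable)
      (Filter.Eventually.of_forall fun θ' => ae_of_all _ fun τ => by
        rw [Real.norm_of_nonneg (le_max_right _ _)]
        exact max_le (by linarith [pathRatio_pos 𝓟 θ θ' t τ]) zero_le_one)
      (integrable_const _)
      (ae_of_all _ fun τ => by
        have h : Continuous fun θ' => max (1 - pathRatio 𝓟 θ θ' t τ) 0 :=
          (continuous_const.sub (continuous_pathRatio 𝓟 θ t τ)).max continuous_const
        simpa [pathRatio_self] using h.tendsto θ)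
    simpa using this
  rw [ContinuousAt, tendsto_iff_norm_sub_tendsto_zero]
  have hlim2 := hlim.const_mul 2
  rw [mul_zero] at hlim2
  refine squeeze_zero (fun _ => norm_nonneg _) (fun θ' => ?_) hlim2
  obtain ⟨hWi, hW1⟩ := 𝓜.integrable_pathRatio 𝓟 θ θ' t
  have hmi : Integrable (fun τ => max (1 - pathRatio 𝓟 θ θ' t τ) 0) (𝓜.law 𝓟 θ) :=
    ((integrable_const 1).sub hWi).pos_part
  have hRi : Integrable R (𝓜.law 𝓟 θ) := integrable_of_abs_le hR hRb
  have hWRi : Integrable (fun τ => pathRatio 𝓟 θ θ' t τ * R τ) (𝓜.law 𝓟 θ) :=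
    hWi.mul_bdd (c := 1) hR.aestronglyMeasurable (ae_of_all _ hRb)
  rw [𝓜.integral_law_eq_pathRatio 𝓟 θ θ' t hR hRd, ← integral_sub hWRi hRi]
  have hb : ∀ τ, ‖pathRatio 𝓟 θ θ' t τ * R τ - R τ‖
      ≤ 2 * max (1 - pathRatio 𝓟 θ θ' t τ) 0 + (pathRatio 𝓟 θ θ' t τ - 1) := fun τ => by
    have h1 : pathRatio 𝓟 θ θ' t τ * R τ - R τ = (pathRatio 𝓟 θ θ' t τ - 1) * R τ := by ring
    rw [h1, norm_mul, Real.norm_eq_abs, Real.norm_eq_abs]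
    refine (mul_le_of_le_one_right (abs_nonneg _) (hRb τ)).trans ?_
    rcases le_total (pathRatio 𝓟 θ θ' t τ) 1 with h | h
    · rw [abs_of_nonpos (by linarith), max_eq_left (by linarith)]; linarith
    · rw [abs_of_nonneg (by linarith), max_eq_right (by linarith)]; linarith
  have hWi' : Integrable (fun τ => pathRatio 𝓟 θ θ' t τ - 1) (𝓜.law 𝓟 θ) :=
    hWi.sub (integrable_const 1)
  refine (norm_integral_le_of_norm_le ((hmi.const_mul 2).add hWi') (ae_of_all _ hb)).trans ?_
  simp only [Pi.add_apply]
  rw [integral_add (hmi.const_mul 2) hWi',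
    integral_sub hWi (integrable_const 1), hW1, integral_const_mul]
  simp

theorem continuous_V (𝓜 : CMDP S A m γ) (𝓟 : PolicyClass S A d) (i : Fin (m + 1)) :
    Continuous (𝓜.V 𝓟 i) := by
  rw [funext fun θ => (𝓜.hasSum_V 𝓟 i θ).tsum_eq.symm]
  refine continuous_tsum (u := fun t => γ ^ t) (fun t => ?_) 𝓜.hasSum_discount.summable
    fun t θ => ?_
  · exact (𝓜.continuous_integral_law 𝓟 (𝓜.measurable_reward_coord i t)
      (fun τ => 𝓜.abs_r_le_one i _) (𝓜.dependsOn_reward_coord i t)).const_mul _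
  · rw [norm_mul, norm_pow, Real.norm_of_nonneg 𝓜.γ_pos.le]
    exact mul_le_of_le_one_right (pow_nonneg 𝓜.γ_pos.le _)
      (abs_integral_le_of_abs_le fun τ => 𝓜.abs_r_le_one i _)

/-- The contribution of the reward at time `t` to the policy gradient. -/
noncomputable def stepGrad (𝓜 : CMDP S A m γ) (𝓟 : PolicyClass S A d) (i : Fin (m + 1)) (t : ℕ)
    (θ : EuclideanSpace ℝ (Fin d)) : EuclideanSpace ℝ (Fin d) :=
  ∫ τ, 𝓜.r i (τ t) • pathScore 𝓟 θ t τ ∂(𝓜.law 𝓟 θ)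

variable {𝓜 : CMDP S A m γ} {𝓟 : PolicyClass S A d} {θ u : EuclideanSpace ℝ (Fin d)}
  {Mg Mh : ℝ} {i : Fin (m + 1)}

theorem norm_reward_smul_pathScore_le (h : ∀ x, ‖𝓟.score θ x‖ ≤ Mg) (t t' : ℕ) (τ : ℕ → S × A) :
    ‖𝓜.r i (τ t') • pathScore 𝓟 θ t τ‖ ≤ (t + 1) * Mg := by
  rw [norm_smul]
  exact (mul_le_of_le_one_left (norm_nonneg _) (𝓜.abs_r_le_one i _)).trans
    (norm_pathScore_le h t τ)

theorem norm_stepGrad_le (h : ∀ x, ‖𝓟.score θ x‖ ≤ Mg) (t : ℕ) :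
    ‖𝓜.stepGrad 𝓟 i t θ‖ ≤ (t + 1) * Mg := by
  have := norm_integral_le_of_norm_le_const (μ := 𝓜.law 𝓟 θ)
    (ae_of_all _ (norm_reward_smul_pathScore_le (𝓜 := 𝓜) (i := i) h t t))
  rwa [probReal_univ, mul_one] at this

theorem inner_stepGrad (h : ∀ x, ‖𝓟.score θ x‖ ≤ Mg) (t : ℕ) (u : EuclideanSpace ℝ (Fin d)) :
    inner ℝ (𝓜.stepGrad 𝓟 i t θ) u
      = ∫ τ, 𝓜.r i (τ t) * inner ℝ (pathScore 𝓟 θ t τ) u ∂(𝓜.law 𝓟 θ) := by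
  have hm : Measurable fun τ : ℕ → S × A => 𝓜.r i (τ t) • pathScore 𝓟 θ t τ :=
    (𝓜.measurable_reward_coord i t).smul (measurable_pathScore 𝓟 θ t)
  have hi : Integrable (fun τ => 𝓜.r i (τ t) • pathScore 𝓟 θ t τ) (𝓜.law 𝓟 θ) :=
    Integrable.of_bound hm.aestronglyMeasurable _
      (ae_of_all _ (norm_reward_smul_pathScore_le h t t))
  rw [stepGrad, real_inner_comm, ← integral_inner hi]
  simp_rw [inner_smul_right, real_inner_comm]

theorem hasSum_discount_mul_succ (𝓜 : CMDP S A m γ) :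
    HasSum (fun t : ℕ => γ ^ t * ((t : ℝ) + 1)) (1 / (1 - γ) ^ 2) := by
  have h1 := hasSum_coe_mul_geometric_of_norm_lt_one (𝕜 := ℝ) (r := γ)
    (by rw [Real.norm_of_nonneg 𝓜.γ_pos.le]; exact 𝓜.γ_lt_one)
  have h2 := h1.add 𝓜.hasSum_discount
  have := 𝓜.one_sub_pos.ne'
  have e : 1 / (1 - γ) ^ 2 = γ / (1 - γ) ^ 2 + 1 / (1 - γ) := by field_simp; ring
  have hf : (fun t : ℕ => γ ^ t * ((t : ℝ) + 1)) = fun t : ℕ => (t : ℝ) * γ ^ t + γ ^ t := by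
    funext t; ring
  rw [e, hf]
  exact h2

/-- The policy gradient. -/
noncomputable def policyGrad (𝓜 : CMDP S A m γ) (𝓟 : PolicyClass S A d) (i : Fin (m + 1))
    (θ : EuclideanSpace ℝ (Fin d)) : EuclideanSpace ℝ (Fin d) :=
  ∑' t : ℕ, γ ^ t • 𝓜.stepGrad 𝓟 i t θ

theorem norm_discount_smul_stepGrad_le (h : ∀ x, ‖𝓟.score θ x‖ ≤ Mg) (t : ℕ) :
    ‖γ ^ t • 𝓜.stepGrad 𝓟 i t θ‖ ≤ γ ^ t * ((t : ℝ) + 1) * Mg := by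
  rw [norm_smul, norm_pow, Real.norm_of_nonneg 𝓜.γ_pos.le, mul_assoc]
  exact mul_le_mul_of_nonneg_left (norm_stepGrad_le h t) (pow_nonneg 𝓜.γ_pos.le _)

theorem hasSum_policyGrad (h : ∀ x, ‖𝓟.score θ x‖ ≤ Mg) :
    HasSum (fun t : ℕ => γ ^ t • 𝓜.stepGrad 𝓟 i t θ) (𝓜.policyGrad 𝓟 i θ) :=
  (Summable.of_norm_bounded (𝓜.hasSum_discount_mul_succ.summable.mul_right Mg)
    fun t => norm_discount_smul_stepGrad_le h t).hasSum

theorem norm_policyGrad_le (h : ∀ x, ‖𝓟.score θ x‖ ≤ Mg) :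
    ‖𝓜.policyGrad 𝓟 i θ‖ ≤ LBSGD.lipConst γ Mg := by
  have h1 := 𝓜.hasSum_discount_mul_succ.mul_right Mg
  rw [one_div_mul_eq_div] at h1
  exact tsum_of_norm_bounded h1 fun t => norm_discount_smul_stepGrad_le h t

/-- The Taylor errors at time t grow like t + 1, and the discounted sum of t + 1 is 1 / (1 - γ)². -/
theorem abs_V_taylor_le_of_regular {h : ℝ} (hu : ‖u‖ ≤ 1) (hh : 0 ≤ h)
    (hr : ∀ s ∈ Set.Icc (0 : ℝ) h, ∀ᶠ θ' in 𝓝 (θ + s • u), RegularScore 𝓟 Mg Mh θ') :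
    |𝓜.V 𝓟 i (θ + h • u) - 𝓜.V 𝓟 i θ - h * inner ℝ (𝓜.policyGrad 𝓟 i θ) u|
      ≤ LBSGD.smoothConst γ Mg Mh * (h ^ 2 / 2) := by
  have hr0 : ∀ x, ‖𝓟.score θ x‖ ≤ Mg := fun x => by
    have := (hr 0 (by simpa using hh)).self_of_nhds x
    simpa using this.1
  have hG : HasSum (fun t => γ ^ t * inner ℝ (𝓜.stepGrad 𝓟 i t θ) u)
      (inner ℝ (𝓜.policyGrad 𝓟 i θ) u) := by
    have := (hasSum_policyGrad (𝓜 := 𝓜) (i := i) hr0).mapL (innerSL ℝ u)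
    simp only [innerSL_apply_apply, inner_smul_right] at this
    simp_rw [real_inner_comm u]
    exact this
  have h1 := ((𝓜.hasSum_V 𝓟 i (θ + h • u)).sub (𝓜.hasSum_V 𝓟 i θ)).sub (hG.mul_left h)
  have h2 : HasSum (fun t : ℕ => γ ^ t * ((t : ℝ) + 1) * ((Mg ^ 2 + Mh) * (h ^ 2 / 2)))
      (LBSGD.smoothConst γ Mg Mh * (h ^ 2 / 2)) := by
    have := 𝓜.hasSum_discount_mul_succ.mul_right ((Mg ^ 2 + Mh) * (h ^ 2 / 2))
    have e : LBSGD.smoothConst γ Mg Mh * (h ^ 2 / 2)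
        = 1 / (1 - γ) ^ 2 * ((Mg ^ 2 + Mh) * (h ^ 2 / 2)) := by
      unfold LBSGD.smoothConst; ring
    rw [e]
    exact this
  rw [← h1.tsum_eq]
  refine tsum_of_norm_bounded (E := ℝ) h2 fun t => ?_
  have h3 := abs_integral_law_taylor_le (𝓜 := 𝓜) (t := t) hu hh hr (𝓜.measurable_reward_coord i t)
    (fun τ => 𝓜.abs_r_le_one i _) (𝓜.dependsOn_reward_coord i t)
  rw [inner_stepGrad hr0, Real.norm_eq_abs]
  have h4 := mul_le_mul_of_nonneg_left h3 (pow_nonneg 𝓜.γ_pos.le t)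
  rw [← abs_of_nonneg (pow_nonneg 𝓜.γ_pos.le t), ← abs_mul,
    abs_of_nonneg (pow_nonneg 𝓜.γ_pos.le t)] at h4
  refine le_trans (le_of_eq ?_) (h4.trans (le_of_eq ?_))
  · congr 1; ring
  · ring

/-- The Taylor bound along the ray from `θ` towards `θ + h` has an error of order ‖h‖² uniform in
the direction, which upgrades directional derivatives to a Fréchet derivative. -/
theorem hasGradientAt_V_of_regular (hr : ∀ᶠ θ' in 𝓝 θ, RegularScore 𝓟 Mg Mh θ') :
    HasGradientAt (𝓜.V 𝓟 i) (𝓜.policyGrad 𝓟 i θ) θ := by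
  rw [hasGradientAt_iff_hasFDerivAt, hasFDerivAt_iff_isLittleO_nhds_zero]
  obtain ⟨ε, hε, hball⟩ := Metric.eventually_nhds_iff_ball.1 hr
  have hO : (fun h => 𝓜.V 𝓟 i (θ + h) - 𝓜.V 𝓟 i θ
      - (InnerProductSpace.toDual ℝ _ (𝓜.policyGrad 𝓟 i θ)) h) =O[𝓝 0] fun h => ‖h‖ ^ 2 := by
    refine Asymptotics.IsBigO.of_bound (LBSGD.smoothConst γ Mg Mh / 2) ?_
    filter_upwards [Metric.ball_mem_nhds (0 : EuclideanSpace ℝ (Fin d)) hε] with h hh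
    rw [InnerProductSpace.toDual_apply_apply]
    have hh' : ‖h‖ < ε := by simpa using hh
    have hu : ‖‖h‖⁻¹ • h‖ ≤ 1 := by
      rw [norm_smul, norm_inv, norm_norm]; exact inv_mul_le_one
    have hsm : ‖h‖ • ‖h‖⁻¹ • h = h := by
      rcases eq_or_ne h 0 with rfl | h0
      · simp
      · rw [smul_smul, mul_inv_cancel₀ (norm_ne_zero_iff.2 h0), one_smul]
    have h1 := abs_V_taylor_le_of_regular (𝓜 := 𝓜) (𝓟 := 𝓟) (θ := θ) (i := i) (Mg := Mg)
      (Mh := Mh) hu (norm_nonneg h) fun s hs => by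
        refine Filter.eventually_iff_exists_mem.2 ⟨_, Metric.isOpen_ball.mem_nhds ?_, hball⟩
        rw [Metric.mem_ball, dist_self_add_left, norm_smul, Real.norm_of_nonneg hs.1]
        exact ((mul_le_of_le_one_right hs.1 hu).trans hs.2).trans_lt hh'
    rw [hsm, ← real_inner_smul_right, hsm] at h1
    rw [Real.norm_eq_abs, Real.norm_of_nonneg (sq_nonneg _)]
    linarith
  refine hO.trans_isLittleO ?_
  have := Asymptotics.isLittleO_norm_pow_id (E' := EuclideanSpace ℝ (Fin d)) one_lt_two
  exact this

/-- The set of strictly feasible parameters. -/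
def strictlyFeasible (𝓜 : CMDP S A m γ) (𝓟 : PolicyClass S A d) : Set (EuclideanSpace ℝ (Fin d)) :=
  {θ | ∀ i : Fin m, 0 < 𝓜.V 𝓟 i.succ θ}

theorem strictlyFeasible_subset : 𝓜.strictlyFeasible 𝓟 ⊆ 𝓜.feasible 𝓟 := fun _ h i => (h i).le

theorem isOpen_strictlyFeasible : IsOpen (𝓜.strictlyFeasible 𝓟) := by
  have : 𝓜.strictlyFeasible 𝓟 = ⋂ i : Fin m, {θ | 0 < 𝓜.V 𝓟 i.succ θ} := by
    ext θ; simp [strictlyFeasible]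
  rw [this]
  exact isOpen_iInter_of_finite fun i => isOpen_lt continuous_const (𝓜.continuous_V 𝓟 _)

/-- The assumption is pointwise on the feasible set; openness of its strict part turns it into a
bound on a neighbourhood. -/
theorem BoundedScore.eventually (hB : 𝓜.BoundedScore 𝓟 Mg Mh) (hθ : θ ∈ 𝓜.strictlyFeasible 𝓟) :
    ∀ᶠ θ' in 𝓝 θ, RegularScore 𝓟 Mg Mh θ' :=
  Filter.mem_of_superset (isOpen_strictlyFeasible.mem_nhds hθ)
    fun θ' h => hB θ' (strictlyFeasible_subset h)

theorem BoundedScore.gradient_V (hB : 𝓜.BoundedScore 𝓟 Mg Mh)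
    (hθ : θ ∈ 𝓜.strictlyFeasible 𝓟) (i : Fin (m + 1)) :
    gradient (𝓜.V 𝓟 i) θ = 𝓜.policyGrad 𝓟 i θ :=
  (hasGradientAt_V_of_regular (hB.eventually hθ)).gradient

theorem BoundedScore.norm_gradient_V_le (hB : 𝓜.BoundedScore 𝓟 Mg Mh)
    (hθ : θ ∈ 𝓜.strictlyFeasible 𝓟) (i : Fin (m + 1)) :
    ‖gradient (𝓜.V 𝓟 i) θ‖ ≤ LBSGD.lipConst γ Mg := by
  rw [hB.gradient_V hθ]
  exact norm_policyGrad_le fun x => (hB θ (strictlyFeasible_subset hθ) x).1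

theorem BoundedScore.abs_V_taylor_le (hB : 𝓜.BoundedScore 𝓟 Mg Mh) {h : ℝ} (hu : ‖u‖ ≤ 1)
    (hh : 0 ≤ h) (hs : ∀ s ∈ Set.Icc (0 : ℝ) h, θ + s • u ∈ 𝓜.strictlyFeasible 𝓟)
    (i : Fin (m + 1)) :
    |𝓜.V 𝓟 i (θ + h • u) - 𝓜.V 𝓟 i θ - h * inner ℝ (gradient (𝓜.V 𝓟 i) θ) u|
      ≤ LBSGD.smoothConst γ Mg Mh * (h ^ 2 / 2) := by
  rw [hB.gradient_V (by simpa using hs 0 (by simpa using hh))]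
  exact abs_V_taylor_le_of_regular hu hh fun s hs' => hB.eventually (hs s hs')

end CMDP

/-! ### Dimension-free concentration of sums of bounded vectors. -/

/-- The square root lies below its tangent at D². The smoothed norm replaces ‖x‖ because its
curvature is at most 1 / a, also at the origin. -/
theorem sqrt_sq_add_norm_add_sq_le {E : Type*} [NormedAddCommGroup E] [InnerProductSpace ℝ E]
    {a R : ℝ} (ha : 0 < a) (x v : E) (hv : ‖v‖ ≤ R) :
    √(a ^ 2 + ‖x + v‖ ^ 2) ≤ √(a ^ 2 + ‖x‖ ^ 2) + inner ℝ x v / √(a ^ 2 + ‖x‖ ^ 2)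
      + R ^ 2 / (2 * a) := by
  set D := √(a ^ 2 + ‖x‖ ^ 2) with hD
  have hD2 : D ^ 2 = a ^ 2 + ‖x‖ ^ 2 := Real.sq_sqrt (by positivity)
  have hDa : a ≤ D := Real.le_sqrt_of_sq_le (by nlinarith [sq_nonneg ‖x‖])
  have hD0 : 0 < D := ha.trans_le hDa
  have hR : ‖v‖ ^ 2 ≤ R ^ 2 := by gcongr
  have h1 : R ^ 2 / (2 * D) ≤ R ^ 2 / (2 * a) := by gcongr
  have h2 : √(a ^ 2 + ‖x + v‖ ^ 2) ≤ D + inner ℝ x v / D + ‖v‖ ^ 2 / (2 * D) := by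
    have he : a ^ 2 + ‖x + v‖ ^ 2 = D ^ 2 + (2 * inner ℝ x v + ‖v‖ ^ 2) := by
      rw [norm_add_sq_real, hD2]; ring
    have h3 : D + inner ℝ x v / D + ‖v‖ ^ 2 / (2 * D)
        = (2 * D ^ 2 + (2 * inner ℝ x v + ‖v‖ ^ 2)) / (2 * D) := by field_simp; ring
    rw [h3, Real.sqrt_le_left]
    · rw [he, div_pow, le_div_iff₀ (by positivity)]
      nlinarith [sq_nonneg (2 * inner ℝ x v + ‖v‖ ^ 2)]
    · have : 0 ≤ D ^ 2 + (2 * inner ℝ x v + ‖v‖ ^ 2) := by rw [← he]; positivity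
      apply div_nonneg _ (by positivity)
      nlinarith
  have h4 : ‖v‖ ^ 2 / (2 * D) ≤ R ^ 2 / (2 * D) := by gcongr
  linarith

section Concentration

variable {E : Type*} [NormedAddCommGroup E] [InnerProductSpace ℝ E]
  [CompleteSpace E] [MeasurableSpace E] [BorelSpace E] [SecondCountableTopology E]
  {Y : Type*} [MeasurableSpace Y]

/-- The linear term of the smoothed norm is a centered scalar bounded by R, because ‖x‖ ≤ D, so the
scalar Hoeffding lemma controls its exponential moment. The curvature contributes a deterministic
factor. -/
theorem integral_exp_sqrt_le {ν : Measure Y} [IsProbabilityMeasure ν] {f : Y → E}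
    (hf : Measurable f) {R a l : ℝ} (hfR : ∀ y, ‖f y‖ ≤ R) (h0 : ∫ y, f y ∂ν = 0) (ha : 0 < a)
    (hl : 0 ≤ l) (x : E) :
    ∫⁻ y, ENNReal.ofReal (Real.exp (l * √(a ^ 2 + ‖x + f y‖ ^ 2))) ∂ν
      ≤ ENNReal.ofReal (Real.exp (l ^ 2 * R ^ 2 / 2 + l * (R ^ 2 / (2 * a)))
        * Real.exp (l * √(a ^ 2 + ‖x‖ ^ 2))) := by
  obtain ⟨y₀⟩ : Nonempty Y := nonempty_of_isProbabilityMeasure ν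
  have hR : 0 ≤ R := (norm_nonneg _).trans (hfR y₀)
  set D := √(a ^ 2 + ‖x‖ ^ 2) with hD
  have hD2 : D ^ 2 = a ^ 2 + ‖x‖ ^ 2 := Real.sq_sqrt (by positivity)
  have hD0 : 0 < D := Real.sqrt_pos.2 (by positivity)
  have hxD : ‖x‖ ≤ D := Real.le_sqrt_of_sq_le (by nlinarith [sq_nonneg a])
  set X : Y → ℝ := fun y => inner ℝ x (f y) / D with hX
  have hXm : Measurable X := (hf.const_inner).div_const _
  have hXb : ∀ y, |X y| ≤ R := fun y => by
    rw [hX, abs_div, abs_of_pos hD0, div_le_iff₀ hD0, mul_comm]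
    exact (abs_real_inner_le_norm _ _).trans (mul_le_mul hxD (hfR y) (norm_nonneg _) hD0.le)
  have hi : Integrable f ν := Integrable.of_bound hf.aestronglyMeasurable R (ae_of_all _ hfR)
  have hX0 : ∫ y, X y ∂ν = 0 := by
    simp only [hX]
    rw [integral_div, integral_inner hi, h0, inner_zero_right, zero_div]
  have hsub := hasSubgaussianMGF_of_mem_Icc_of_integral_eq_zero (a := -R) (b := R)
    hXm.aemeasurable (ae_of_all ν fun y => abs_le.1 (hXb y)) hX0
  have hmgf := hsub.mgf_le l
  have hc : ((‖R - -R‖₊ / 2) ^ 2 : NNReal) = (R ^ 2 : ℝ) := by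
    push_cast
    rw [Real.norm_of_nonneg (by linarith)]; ring
  rw [hc, mgf] at hmgf
  have hei : Integrable (fun y => Real.exp (l * X y)) ν := hsub.integrable_exp_mul l
  calc ∫⁻ y, ENNReal.ofReal (Real.exp (l * √(a ^ 2 + ‖x + f y‖ ^ 2))) ∂ν
      ≤ ∫⁻ y, ENNReal.ofReal (Real.exp (l * D + l * (R ^ 2 / (2 * a))) * Real.exp (l * X y)) ∂ν := by
        refine lintegral_mono fun y => ENNReal.ofReal_le_ofReal ?_
        rw [← Real.exp_add, Real.exp_le_exp]
        have := mul_le_mul_of_nonneg_left (sqrt_sq_add_norm_add_sq_le ha x (f y) (hfR y)) hl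
        simp only [hX]
        linarith
    _ = ENNReal.ofReal (∫ y, Real.exp (l * D + l * (R ^ 2 / (2 * a))) * Real.exp (l * X y) ∂ν) :=
        (ofReal_integral_eq_lintegral_ofReal (hei.const_mul _)
          (ae_of_all _ fun y => by positivity)).symm
    _ ≤ _ := by
        refine ENNReal.ofReal_le_ofReal ?_
        rw [integral_const_mul]
        refine (mul_le_mul_of_nonneg_left hmgf (Real.exp_pos _).le).trans (le_of_eq ?_)
        rw [← Real.exp_add, ← Real.exp_add]
        congr 1; ring

/-- Each sample multiplies the moment by a factor that does not depend on the current partial sum;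
the induction therefore varies the starting point `x`. -/
theorem lintegral_pi_exp_sqrt_le {ν : Measure Y} [IsProbabilityMeasure ν] {f : Y → E}
    (hf : Measurable f) {R a l : ℝ} (hfR : ∀ y, ‖f y‖ ≤ R) (h0 : ∫ y, f y ∂ν = 0) (ha : 0 < a)
    (hl : 0 ≤ l) (n : ℕ) (x : E) :
    ∫⁻ b, ENNReal.ofReal (Real.exp (l * √(a ^ 2 + ‖x + ∑ j, f (b j)‖ ^ 2)))
        ∂(Measure.pi fun _ : Fin n => ν)
      ≤ ENNReal.ofReal (Real.exp (n * (l ^ 2 * R ^ 2 / 2 + l * (R ^ 2 / (2 * a))))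
        * Real.exp (l * √(a ^ 2 + ‖x‖ ^ 2))) := by
  induction n generalizing x with
  | zero => simp
  | succ n ih =>
    have hmp := (measurePreserving_piFinSuccAbove (fun _ : Fin (n + 1) => ν) 0)
    have hsum : ∀ b : Fin (n + 1) → Y, x + ∑ j, f (b j)
        = (fun p : Y × (Fin n → Y) => x + f p.1 + ∑ j, f (p.2 j))
          (MeasurableEquiv.piFinSuccAbove (fun _ : Fin (n + 1) => Y) 0 b) := fun b => by
      rw [Fin.sum_univ_succ, ← add_assoc]; rfl
    simp_rw [hsum]
    have hgm : Measurable fun p : Y × (Fin n → Y) => ENNReal.ofReal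
        (Real.exp (l * √(a ^ 2 + ‖x + f p.1 + ∑ j, f (p.2 j)‖ ^ 2))) := by fun_prop
    rw [hmp.lintegral_comp hgm, lintegral_prod _ hgm.aemeasurable]
    refine (lintegral_mono fun y => ih (x + f y)).trans ?_
    simp_rw [ENNReal.ofReal_mul (Real.exp_pos _).le]
    rw [lintegral_const_mul _ (by fun_prop)]
    refine (mul_le_mul_right (integral_exp_sqrt_le hf hfR h0 ha hl x) _).trans (le_of_eq ?_)
    rw [← ENNReal.ofReal_mul (Real.exp_pos _).le, ← mul_assoc, ← Real.exp_add,
      ← ENNReal.ofReal_mul (Real.exp_pos _).le]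
    congr 3
    push_cast; ring

/-- Dimension-free Hoeffding inequality for the norm of a sum of bounded centered independent
vectors. -/
theorem measure_pi_norm_sum_ge_le {ν : Measure Y} [IsProbabilityMeasure ν] {f : Y → E}
    (hf : Measurable f) {R : ℝ} (hR : 0 < R) (hfR : ∀ y, ‖f y‖ ≤ R) (h0 : ∫ y, f y ∂ν = 0)
    {n : ℕ} (hn : 0 < n) {s : ℝ} (hs : 0 ≤ s) :
    (Measure.pi fun _ : Fin n => ν) {b | R * √n * (3 / 2 + s) ≤ ‖∑ j, f (b j)‖}
      ≤ ENNReal.ofReal (Real.exp (-(s ^ 2 / 2))) := by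
  have hn' : (0 : ℝ) < √n := Real.sqrt_pos.2 (by exact_mod_cast hn)
  have hnn : √(n : ℝ) ^ 2 = n := Real.sq_sqrt (by positivity)
  set q := √(n : ℝ) with hq
  -- With `a` = R √n and `l` = s / a the exponent is s² / 2 + s / 2 + s - s (3 / 2 + s) = -s² / 2.
  -- The terms s / 2 and s are the price of the smoothing and account for the offset 3 / 2.
  set a := R * q with ha'
  have ha : 0 < a := mul_pos hR hn'
  set l := s / a with hl'
  have hl : 0 ≤ l := div_nonneg hs ha.le
  set r := R * q * (3 / 2 + s) with hr
  have h1 := lintegral_pi_exp_sqrt_le hf hfR h0 ha hl n 0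
  have hm : Measurable fun b : Fin n → Y => ENNReal.ofReal
      (Real.exp (l * √(a ^ 2 + ‖0 + ∑ j, f (b j)‖ ^ 2))) := by fun_prop
  have h2 := meas_ge_le_lintegral_div (μ := Measure.pi fun _ : Fin n => ν) hm.aemeasurable
    (ε := ENNReal.ofReal (Real.exp (l * r)))
    (by simp [Real.exp_pos]) ENNReal.ofReal_ne_top
  refine (measure_mono fun b hb => ?_).trans (h2.trans ?_)
  · simp only [Set.mem_ofPred_eq] at hb ⊢
    refine ENNReal.ofReal_le_ofReal (Real.exp_le_exp.2 (mul_le_mul_of_nonneg_left ?_ hl))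
    refine hb.trans (Real.le_sqrt_of_sq_le ?_)
    rw [zero_add]
    nlinarith [sq_nonneg a]
  · refine (ENNReal.div_le_div_right h1 _).trans ?_
    rw [← ENNReal.ofReal_div_of_pos (Real.exp_pos _), ← Real.exp_add, ← Real.exp_sub]
    refine ENNReal.ofReal_le_ofReal (Real.exp_le_exp.2 (le_of_eq ?_))
    rw [norm_zero, ← hnn]
    simp only [ne_eq, OfNat.ofNat_ne_zero, not_false_eq_true, zero_pow, add_zero]
    rw [Real.sqrt_sq ha.le, hl', hr, ha']
    field_simp
    ring

/-- Centering doubles the bound on the vectors, hence the factor 2 R. -/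
theorem measure_pi_norm_mean_sub_ge_le {ν : Measure Y} [IsProbabilityMeasure ν] {f : Y → E}
    (hf : Measurable f) {R : ℝ} (hR : 0 < R) (hfR : ∀ y, ‖f y‖ ≤ R)
    {n : ℕ} (hn : 0 < n) {s : ℝ} (hs : 0 ≤ s) :
    (Measure.pi fun _ : Fin n => ν)
        {b : Fin n → Y | 2 * R * (3 / 2 + s) / √n ≤ ‖(1 / (n : ℝ)) • ∑ j, f (b j) - ∫ y, f y ∂ν‖}
      ≤ ENNReal.ofReal (Real.exp (-(s ^ 2 / 2))) := by
  have hi : Integrable f ν := Integrable.of_bound hf.aestronglyMeasurable R (ae_of_all _ hfR)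
  have hb : ∀ y, ‖f y - ∫ y, f y ∂ν‖ ≤ 2 * R := fun y => by
    have h1 := norm_integral_le_of_norm_le_const (μ := ν) (ae_of_all _ hfR)
    rw [probReal_univ, mul_one] at h1
    linarith [norm_sub_le (f y) (∫ y, f y ∂ν), hfR y]
  have h := measure_pi_norm_sum_ge_le (ν := ν) (f := fun y => f y - ∫ y, f y ∂ν)
    (hf.sub_const _) (by linarith : 0 < 2 * R) hb
    (by rw [integral_sub hi (integrable_const _)]; simp) hn hs
  refine (measure_mono fun b hb => ?_).trans h
  have hn' : (0 : ℝ) < n := by exact_mod_cast hn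
  have hq : 0 < √(n : ℝ) := Real.sqrt_pos.2 hn'
  have hnn : √(n : ℝ) * √n = n := Real.mul_self_sqrt hn'.le
  simp only [Set.mem_ofPred_eq] at hb ⊢
  have he : ∑ j, (f (b j) - ∫ y, f y ∂ν)
      = (n : ℝ) • ((1 / (n : ℝ)) • ∑ j, f (b j) - ∫ y, f y ∂ν) := by
    rw [Finset.sum_sub_distrib, smul_sub, smul_smul, mul_one_div_cancel hn'.ne', one_smul]
    simp [Nat.cast_smul_eq_nsmul]
  rw [he, norm_smul, Real.norm_of_nonneg hn'.le]
  calc 2 * R * √n * (3 / 2 + s) = n * (2 * R * (3 / 2 + s) / √n) := by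
        rw [mul_div_assoc', mul_comm (n : ℝ), mul_div_assoc, Real.div_sqrt]; ring
    _ ≤ _ := mul_le_mul_of_nonneg_left hb hn'.le

end Concentration

/-! ### Measurability of batch laws, estimators and updates. -/

namespace LBSGD

variable {S : Type u} {A : Type v} [MeasurableSpace S] [MeasurableSpace A] {m : ℕ} {γ : ℝ} {d : ℕ}

/-- The law of one trajectory truncated at horizon `H`. -/
noncomputable def truncLaw (𝓜 : CMDP S A m γ) (𝓟 : PolicyClass S A d) (H : ℕ)
    (θ : EuclideanSpace ℝ (Fin d)) : Measure (Fin H → S × A) :=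
  (𝓜.law 𝓟 θ).map fun τ (t : Fin H) => τ t

theorem measurable_trunc (H : ℕ) : Measurable fun (τ : ℕ → S × A) (t : Fin H) => τ t :=
  measurable_pi_lambda _ fun t => measurable_pi_apply (t : ℕ)

instance isProbabilityMeasure_truncLaw (𝓜 : CMDP S A m γ) (𝓟 : PolicyClass S A d) (H : ℕ)
    (θ : EuclideanSpace ℝ (Fin d)) : IsProbabilityMeasure (truncLaw 𝓜 𝓟 H θ) :=
  Measure.isProbabilityMeasure_map (measurable_trunc H).aemeasurable

theorem batchLaw_eq_pi (𝓜 : CMDP S A m γ) (𝓟 : PolicyClass S A d) (p : LBParams)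
    (θ : EuclideanSpace ℝ (Fin d)) :
    batchLaw 𝓜 𝓟 p θ = Measure.pi fun _ : Fin p.n => truncLaw 𝓜 𝓟 p.H θ := rfl

instance isProbabilityMeasure_batchLaw (𝓜 : CMDP S A m γ) (𝓟 : PolicyClass S A d) (p : LBParams)
    (θ : EuclideanSpace ℝ (Fin d)) : IsProbabilityMeasure (batchLaw 𝓜 𝓟 p θ) := by
  rw [batchLaw_eq_pi]; infer_instance

/-- All finite-horizon laws have a density with respect to the law at the parameter 0, and this
density is jointly measurable in the parameter and the path. -/
theorem measurable_truncLaw (𝓜 : CMDP S A m γ) (𝓟 : PolicyClass S A d) (H : ℕ) :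
    Measurable (truncLaw 𝓜 𝓟 H) := by
  refine Measure.measurable_of_measurable_coe _ fun B hB => ?_
  have h : ∀ θ, truncLaw 𝓜 𝓟 H θ B = ∫⁻ τ, ENNReal.ofReal (CMDP.pathRatio 𝓟 0 θ H τ)
      * ((fun (τ : ℕ → S × A) (t : Fin H) => τ t) ⁻¹' B).indicator 1 τ ∂(𝓜.law 𝓟 0) := fun θ => by
    rw [truncLaw, Measure.map_apply (measurable_trunc H) hB,
      ← lintegral_indicator_one (measurable_trunc H hB)]
    refine 𝓜.lintegral_law_eq_pathRatio 𝓟 0 θ H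
      (measurable_one.indicator (measurable_trunc H hB)) fun x y hxy => ?_
    change B.indicator (1 : (Fin H → S × A) → ℝ≥0∞) _ = B.indicator 1 _
    congr 1
    funext t
    exact hxy t (by simp [t.2.le])
  simp_rw [h]
  have hW : Measurable fun p : EuclideanSpace ℝ (Fin d) × (ℕ → S × A) =>
      CMDP.pathRatio 𝓟 0 p.1 H p.2 := by
    refine Finset.measurable_prod _ fun k _ => ?_
    have hk : Measurable fun p : EuclideanSpace ℝ (Fin d) × (ℕ → S × A) => (p.1, p.2 k) := by
      fun_prop
    have hk' : Measurable fun p : EuclideanSpace ℝ (Fin d) × (ℕ → S × A) => p.2 k := by fun_prop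
    exact (𝓟.measurable_dens_uncurry.comp hk).div ((𝓟.measurable_dens 0).comp hk')
  refine Measurable.lintegral_prod_right' (f := fun p : EuclideanSpace ℝ (Fin d) × (ℕ → S × A) =>
    ENNReal.ofReal (CMDP.pathRatio 𝓟 0 p.1 H p.2)
      * ((fun (τ : ℕ → S × A) (t : Fin H) => τ t) ⁻¹' B).indicator 1 p.2) ?_
  exact hW.ennreal_ofReal.mul
    ((measurable_one.indicator (measurable_trunc H hB)).comp measurable_snd)

/-- It suffices to test on boxes, where the product law is a finite product of measurable functions.
-/
theorem measurable_batchLaw (𝓜 : CMDP S A m γ) (𝓟 : PolicyClass S A d) (p : LBParams) :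
    Measurable (batchLaw 𝓜 𝓟 p) := by
  refine Measurable.measure_of_isPiSystem_of_isProbabilityMeasure
    generateFrom_pi.symm isPiSystem_pi ?_
  rintro _ ⟨s, hs, rfl⟩
  simp_rw [batchLaw_eq_pi, Measure.pi_pi]
  exact Finset.measurable_prod _ fun j _ =>
    (Measure.measurable_coe (show MeasurableSet (s j) from hs j (Set.mem_univ j))).comp
      (measurable_truncLaw 𝓜 𝓟 p.H)

/-- The law of a batch, as a kernel from the parameters. -/
noncomputable def batchKernel (𝓜 : CMDP S A m γ) (𝓟 : PolicyClass S A d) (p : LBParams) :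
    Kernel (EuclideanSpace ℝ (Fin d)) (Batch S A p) :=
  ⟨batchLaw 𝓜 𝓟 p, measurable_batchLaw 𝓜 𝓟 p⟩

instance isMarkovKernel_batchKernel (𝓜 : CMDP S A m γ) (𝓟 : PolicyClass S A d) (p : LBParams) :
    IsMarkovKernel (batchKernel 𝓜 𝓟 p) :=
  ⟨fun θ => isProbabilityMeasure_batchLaw 𝓜 𝓟 p θ⟩

/-- The discounted reward collected along a truncated trajectory. -/
noncomputable def trajValue (𝓜 : CMDP S A m γ) (H : ℕ) (i : Fin (m + 1)) (y : Fin H → S × A) : ℝ :=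
  ∑ t : Fin H, γ ^ (t : ℕ) * 𝓜.r i (y t)

/-- The GPOMDP gradient estimate from one truncated trajectory. -/
noncomputable def trajGrad (𝓜 : CMDP S A m γ) (𝓟 : PolicyClass S A d) (H : ℕ)
    (θ : EuclideanSpace ℝ (Fin d)) (i : Fin (m + 1)) (y : Fin H → S × A) :
    EuclideanSpace ℝ (Fin d) :=
  ∑ t : Fin H, ∑ t' ∈ Finset.Iic t, (γ ^ (t : ℕ) * 𝓜.r i (y t)) • 𝓟.score θ (y t')

theorem valueEst_eq (𝓜 : CMDP S A m γ) (p : LBParams) (i : Fin (m + 1)) (b : Batch S A p) :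
    valueEst 𝓜 p i b = (1 / (p.n : ℝ)) * ∑ j, trajValue 𝓜 p.H i (b j) := rfl

theorem gradEst_eq (𝓜 : CMDP S A m γ) (𝓟 : PolicyClass S A d) (p : LBParams)
    (θ : EuclideanSpace ℝ (Fin d)) (i : Fin (m + 1)) (b : Batch S A p) :
    gradEst 𝓜 𝓟 p θ i b = (1 / (p.n : ℝ)) • ∑ j, trajGrad 𝓜 𝓟 p.H θ i (b j) := rfl

theorem measurable_trajValue (𝓜 : CMDP S A m γ) (H : ℕ) (i : Fin (m + 1)) :
    Measurable (trajValue (S := S) (A := A) 𝓜 H i) :=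
  Finset.measurable_sum _ fun t _ =>
    ((𝓜.measurable_r i).comp (measurable_pi_apply t)).const_mul _

theorem measurable_trajGrad (𝓜 : CMDP S A m γ) (𝓟 : PolicyClass S A d) (H : ℕ)
    (i : Fin (m + 1)) : Measurable fun q : EuclideanSpace ℝ (Fin d) × (Fin H → S × A) =>
      trajGrad 𝓜 𝓟 H q.1 i q.2 := by
  refine Finset.measurable_sum _ fun t _ => Finset.measurable_sum _ fun t' _ => ?_
  have h1 : Measurable fun q : EuclideanSpace ℝ (Fin d) × (Fin H → S × A) => (q.1, q.2 t') := by
    fun_prop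
  have h2 : Measurable fun q : EuclideanSpace ℝ (Fin d) × (Fin H → S × A) => q.2 t := by fun_prop
  exact (((𝓜.measurable_r i).comp h2).const_mul _).smul (𝓟.measurable_score_uncurry.comp h1)

theorem measurable_valueEst (𝓜 : CMDP S A m γ) (p : LBParams) (i : Fin (m + 1)) :
    Measurable (valueEst (S := S) (A := A) 𝓜 p i) :=
  (Finset.measurable_sum _ fun j _ =>
    (measurable_trajValue 𝓜 p.H i).comp (measurable_pi_apply j)).const_mul _

theorem measurable_gradEst (𝓜 : CMDP S A m γ) (𝓟 : PolicyClass S A d) (p : LBParams)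
    (i : Fin (m + 1)) :
    Measurable fun q : EuclideanSpace ℝ (Fin d) × Batch S A p => gradEst 𝓜 𝓟 p q.1 i q.2 := by
  have h : ∀ j, Measurable fun q : EuclideanSpace ℝ (Fin d) × Batch S A p =>
      trajGrad 𝓜 𝓟 p.H q.1 i (q.2 j) := fun j => by
    have hg : Measurable fun q : EuclideanSpace ℝ (Fin d) × Batch S A p => (q.1, q.2 j) :=
      measurable_fst.prodMk ((measurable_pi_apply j).comp measurable_snd)
    have hc := (measurable_trajGrad 𝓜 𝓟 p.H i).comp hg
    simp only [Function.comp_def] at hc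
    exact hc
  have hs : Measurable fun q : EuclideanSpace ℝ (Fin d) × Batch S A p =>
      ∑ j, trajGrad 𝓜 𝓟 p.H q.1 i (q.2 j) := Finset.measurable_sum _ fun j _ => h j
  have h2 : (fun q : EuclideanSpace ℝ (Fin d) × Batch S A p => gradEst 𝓜 𝓟 p q.1 i q.2)
      = (1 / (p.n : ℝ)) • fun q : EuclideanSpace ℝ (Fin d) × Batch S A p =>
        ∑ j, trajGrad 𝓜 𝓟 p.H q.1 i (q.2 j) := rfl
  rw [h2]
  exact hs.const_smul (1 / (p.n : ℝ))

theorem measurable_barrierGradEst (𝓜 : CMDP S A m γ) (𝓟 : PolicyClass S A d) (p : LBParams) :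
    Measurable fun q : EuclideanSpace ℝ (Fin d) × Batch S A p =>
      barrierGradEst 𝓜 𝓟 p q.1 q.2 := by
  have h : ∀ i : Fin m, Measurable fun q : EuclideanSpace ℝ (Fin d) × Batch S A p =>
      (valueEst 𝓜 p i.succ q.2)⁻¹ • gradEst 𝓜 𝓟 p q.1 i.succ q.2 := fun i =>
    ((measurable_valueEst 𝓜 p i.succ).comp measurable_snd).inv.smul
      (measurable_gradEst 𝓜 𝓟 p i.succ)
  have hs : Measurable fun q : EuclideanSpace ℝ (Fin d) × Batch S A p =>
      ∑ i : Fin m, (valueEst 𝓜 p i.succ q.2)⁻¹ • gradEst 𝓜 𝓟 p q.1 i.succ q.2 :=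
    Finset.measurable_sum _ fun i _ => h i
  exact (measurable_gradEst 𝓜 𝓟 p 0).add (hs.const_smul p.η)

theorem measurable_lowerValue (𝓜 : CMDP S A m γ) (p : LBParams) (i : Fin m) :
    Measurable (lowerValue (S := S) (A := A) 𝓜 p i) :=
  (measurable_valueEst 𝓜 p i.succ).sub_const _

theorem measurable_upperSlope (𝓜 : CMDP S A m γ) (𝓟 : PolicyClass S A d) (p : LBParams)
    (i : Fin m) :
    Measurable fun q : EuclideanSpace ℝ (Fin d) × Batch S A p =>
      upperSlope 𝓜 𝓟 p q.1 i q.2 := by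
  have h := measurable_barrierGradEst 𝓜 𝓟 p
  have h' : Measurable fun q : EuclideanSpace ℝ (Fin d) × Batch S A p =>
      inner ℝ (gradEst 𝓜 𝓟 p q.1 i.succ q.2)
        (‖barrierGradEst 𝓜 𝓟 p q.1 q.2‖⁻¹ • barrierGradEst 𝓜 𝓟 p q.1 q.2) :=
    (measurable_gradEst 𝓜 𝓟 p i.succ).inner (h.norm.inv.smul h)
  exact (continuous_abs.measurable.comp h').add_const _

theorem measurable_localSmooth (𝓜 : CMDP S A m γ) (𝓟 : PolicyClass S A d) (p : LBParams) :
    Measurable fun q : EuclideanSpace ℝ (Fin d) × Batch S A p =>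
      localSmooth 𝓜 𝓟 p q.1 q.2 := by
  have hl : ∀ i, Measurable fun q : EuclideanSpace ℝ (Fin d) × Batch S A p =>
      lowerValue 𝓜 p i q.2 := fun i => (measurable_lowerValue 𝓜 p i).comp measurable_snd
  refine Measurable.add (Measurable.const_add (Finset.measurable_sum _ fun i _ =>
    measurable_const.div (hl i)) _) (Measurable.const_mul (Finset.measurable_sum _ fun i _ => ?_) _)
  exact ((measurable_upperSlope 𝓜 𝓟 p i).pow_const 2).div ((hl i).pow_const 2)

theorem measurable_stepSize (𝓜 : CMDP S A m γ) (𝓟 : PolicyClass S A d) (p : LBParams) :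
    Measurable fun q : EuclideanSpace ℝ (Fin d) × Batch S A p => stepSize 𝓜 𝓟 p q.1 q.2 := by
  have hl : ∀ i, Measurable fun q : EuclideanSpace ℝ (Fin d) × Batch S A p =>
      lowerValue 𝓜 p i q.2 := fun i => (measurable_lowerValue 𝓜 p i).comp measurable_snd
  refine Measurable.min (measurable_const.div (measurable_localSmooth 𝓜 𝓟 p))
    (Measurable.mul (Measurable.iInf fun i => (hl i).div (Measurable.add ?_ ?_))
      (measurable_const.div (measurable_barrierGradEst 𝓜 𝓟 p).norm))
  · exact ((hl i).const_mul _).sqrt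
  · exact (continuous_abs.measurable.comp (measurable_upperSlope 𝓜 𝓟 p i)).const_mul _

theorem measurable_update (𝓜 : CMDP S A m γ) (𝓟 : PolicyClass S A d) (p : LBParams) :
    Measurable fun q : (EuclideanSpace ℝ (Fin d) × Bool) × Batch S A p =>
      update 𝓜 𝓟 p q.1 q.2 := by
  have hf : Measurable fun q : (EuclideanSpace ℝ (Fin d) × Bool) × Batch S A p =>
      (q.1.1, q.2) := by fun_prop
  have hg := (measurable_barrierGradEst 𝓜 𝓟 p).comp hf
  have hs := (measurable_stepSize 𝓜 𝓟 p).comp hf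
  have h1 : Measurable fun q : (EuclideanSpace ℝ (Fin d) × Bool) × Batch S A p => q.1.1 := by
    fun_prop
  have h2 : Measurable fun q : (EuclideanSpace ℝ (Fin d) × Bool) × Batch S A p => q.1.2 := by
    fun_prop
  refine Measurable.ite (h2 (measurableSet_singleton true)) measurable_fst
    (Measurable.ite (measurableSet_le hg.norm measurable_const) (h1.prodMk measurable_const)
      (Measurable.prodMk (h1.add (hs.smul hg)) measurable_const))

/-! ### Runs of the algorithm and the union bound over iterations. -/

section Run

variable {𝓜 : CMDP S A m γ} {𝓟 : PolicyClass S A d} {p : LBParams}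
  {θ₀ : EuclideanSpace ℝ (Fin d)} {T : ℕ}

theorem measurable_state_past {Ω : Type w} (ξ : ℕ → Ω → Batch S A p) (t : ℕ) :
    Measurable[⨆ s : Fin t, MeasurableSpace.comap (ξ s) inferInstance]
      fun ω => state 𝓜 𝓟 p θ₀ (fun s => ξ s ω) t := by
  induction t with
  | zero => exact measurable_const
  | succ t ih =>
    have hle : (⨆ s : Fin t, MeasurableSpace.comap (ξ s) inferInstance : MeasurableSpace Ω)
        ≤ ⨆ s : Fin (t + 1), MeasurableSpace.comap (ξ s) inferInstance :=
      iSup_le fun s => le_iSup (fun s : Fin (t + 1) => MeasurableSpace.comap (ξ s) inferInstance)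
        s.castSucc
    have hξ : Measurable[⨆ s : Fin (t + 1), MeasurableSpace.comap (ξ s) inferInstance] (ξ t) :=
      measurable_iff_comap_le.2 (le_iSup
        (fun s : Fin (t + 1) => MeasurableSpace.comap (ξ s) inferInstance) (Fin.last t))
    exact (measurable_update 𝓜 𝓟 p).comp ((ih.mono hle le_rfl).prodMk hξ)

variable {Ω : Type w} [MeasurableSpace Ω] {μ : Measure Ω} {ξ : ℕ → Ω → Batch S A p}

theorem past_le (hξ : ∀ t, Measurable (ξ t)) (t : ℕ) :
    (⨆ s : Fin t, MeasurableSpace.comap (ξ s) inferInstance) ≤ (inferInstance : MeasurableSpace Ω) :=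
  iSup_le fun s => (hξ s).comap_le

/-- The iterate is determined by the past batches, so the defining identity of a run, applied to the
past event that the iterate lies in `s`, fixes the joint law on rectangles. -/
theorem IsRun.map_iterate_batch [IsFiniteMeasure μ] (h : IsRun 𝓜 𝓟 p θ₀ T μ ξ) {t : ℕ}
    (ht : t < T) :
    μ.map (fun ω => (iterate 𝓜 𝓟 p θ₀ (fun s => ξ s ω) t, ξ t ω))
      = μ.map (fun ω => iterate 𝓜 𝓟 p θ₀ (fun s => ξ s ω) t) ⊗ₘ batchKernel 𝓜 𝓟 p := by
  have hpast : Measurable[⨆ s : Fin t, MeasurableSpace.comap (ξ s) inferInstance]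
      fun ω => iterate 𝓜 𝓟 p θ₀ (fun s => ξ s ω) t :=
    measurable_fst.comp (measurable_state_past ξ t)
  have hΘ : Measurable fun ω => iterate 𝓜 𝓟 p θ₀ (fun s => ξ s ω) t :=
    hpast.mono (past_le h.1 t) le_rfl
  refine Measure.ext_prod fun {s B} hs hB => ?_
  rw [Measure.map_apply (hΘ.prodMk (h.1 t)) (hs.prod hB), Measure.compProd_apply_prod hs hB,
    setLIntegral_map hs ((batchKernel 𝓜 𝓟 p).measurable_coe hB) hΘ]
  exact h.2 t ht _ (hpast hs) B hB

/-- If, at every parameter, a batch falls into the bad set with probability at most `δ`, then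
with probability at least `1 - T δ` no batch of the run is bad. -/
theorem IsRun.measure_good_ge [IsProbabilityMeasure μ] (h : IsRun 𝓜 𝓟 p θ₀ T μ ξ)
    {D : Set (EuclideanSpace ℝ (Fin d) × Batch S A p)} (hD : MeasurableSet D) {δ : ℝ} (hδ : 0 ≤ δ)
    (hbad : ∀ θ, batchLaw 𝓜 𝓟 p θ {b | (θ, b) ∈ D} ≤ ENNReal.ofReal δ) {Γ : Set Ω}
    (hΓ : ∀ ω, (∀ t < T, (iterate 𝓜 𝓟 p θ₀ (fun s => ξ s ω) t, ξ t ω) ∉ D) → ω ∈ Γ) :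
    1 - T * δ ≤ μ.real Γ := by
  have hm : ∀ t, Measurable fun ω => (iterate 𝓜 𝓟 p θ₀ (fun s => ξ s ω) t, ξ t ω) := fun t =>
    ((measurable_fst.comp (measurable_state_past ξ t)).mono (past_le h.1 t) le_rfl).prodMk (h.1 t)
  set N : ℕ → Set Ω := fun t => (fun ω => (iterate 𝓜 𝓟 p θ₀ (fun s => ξ s ω) t, ξ t ω)) ⁻¹' D
    with hN
  have hNm : ∀ t, MeasurableSet (N t) := fun t => hm t hD
  have hNle : ∀ t < T, μ.real (N t) ≤ δ := fun t ht => by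
    refine ENNReal.toReal_le_of_le_ofReal hδ ?_
    have hΘ : Measurable fun ω => iterate 𝓜 𝓟 p θ₀ (fun s => ξ s ω) t := (hm t).fst
    have := Measure.isProbabilityMeasure_map (μ := μ) hΘ.aemeasurable
    rw [hN, ← Measure.map_apply (hm t) hD, h.map_iterate_batch ht, Measure.compProd_apply hD]
    refine (lintegral_mono fun θ => hbad θ).trans ?_
    simp
  have hU : μ.real (⋃ t ∈ Finset.range T, N t) ≤ T * δ := by
    refine (measureReal_biUnion_finset_le _ _).trans ?_
    refine (Finset.sum_le_sum fun t ht => hNle t (Finset.mem_range.1 ht)).trans ?_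
    simp
  have hUm : MeasurableSet (⋃ t ∈ Finset.range T, N t) :=
    Finset.measurableSet_biUnion _ fun t _ => hNm t
  have hc := probReal_compl_eq_one_sub (μ := μ) hUm
  have hsub : (⋃ t ∈ Finset.range T, N t)ᶜ ⊆ Γ := fun ω hω => hΓ ω fun t ht hmem =>
    hω (Set.mem_biUnion (Finset.mem_coe.2 (Finset.mem_range.2 ht)) hmem)
  have := measureReal_mono (μ := μ) hsub
  linarith

end Run

end LBSGD

/-! ### Bias and deviation of the estimators. -/

namespace LBSGD

variable {S : Type u} {A : Type v} [MeasurableSpace S] [MeasurableSpace A] {m : ℕ} {γ : ℝ} {d : ℕ}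
  {𝓜 : CMDP S A m γ} {𝓟 : PolicyClass S A d} {θ : EuclideanSpace ℝ (Fin d)} {Mg Mh : ℝ}

theorem abs_trajValue_le (𝓜 : CMDP S A m γ) (H : ℕ) (i : Fin (m + 1)) (y : Fin H → S × A) :
    |trajValue 𝓜 H i y| ≤ 1 / (1 - γ) := by
  have h : ∀ t ∈ (Finset.univ : Finset (Fin H)), |γ ^ (t : ℕ) * 𝓜.r i (y t)| ≤ γ ^ (t : ℕ) :=
    fun t _ => by
      rw [abs_mul, abs_of_nonneg (pow_nonneg 𝓜.γ_pos.le _)]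
      exact mul_le_of_le_one_right (pow_nonneg 𝓜.γ_pos.le _) (𝓜.abs_r_le_one i _)
  refine (Finset.abs_sum_le_sum_abs _ _).trans ((Finset.sum_le_sum h).trans ?_)
  rw [Fin.sum_univ_eq_sum_range (fun t => γ ^ t) H]
  exact sum_le_hasSum _ (fun t _ => pow_nonneg 𝓜.γ_pos.le t) 𝓜.hasSum_discount

theorem norm_trajGrad_le (h : ∀ x, ‖𝓟.score θ x‖ ≤ Mg) (H : ℕ) (i : Fin (m + 1))
    (y : Fin H → S × A) : ‖trajGrad 𝓜 𝓟 H θ i y‖ ≤ lipConst γ Mg := by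
  have hMg : ∀ _ : Fin H, 0 ≤ Mg := fun t => (norm_nonneg _).trans (h (y t))
  have h1 : ∀ t ∈ (Finset.univ : Finset (Fin H)),
      ‖∑ t' ∈ Finset.Iic t, (γ ^ (t : ℕ) * 𝓜.r i (y t)) • 𝓟.score θ (y t')‖
        ≤ γ ^ (t : ℕ) * ((t : ℕ) + 1) * Mg := fun t _ => by
    have h2 : ∀ t' ∈ Finset.Iic t, ‖(γ ^ (t : ℕ) * 𝓜.r i (y t)) • 𝓟.score θ (y t')‖
        ≤ γ ^ (t : ℕ) * Mg := fun t' _ => by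
      rw [norm_smul, norm_mul, norm_pow, Real.norm_of_nonneg 𝓜.γ_pos.le, mul_assoc]
      refine mul_le_mul_of_nonneg_left ?_ (pow_nonneg 𝓜.γ_pos.le _)
      exact (mul_le_of_le_one_left (norm_nonneg _) (𝓜.abs_r_le_one i _)).trans (h _)
    refine (norm_sum_le_of_le _ h2).trans (le_of_eq ?_)
    rw [Finset.sum_const, Fin.card_Iic, nsmul_eq_mul]
    push_cast; ring
  refine (norm_sum_le_of_le _ h1).trans ?_
  rw [Fin.sum_univ_eq_sum_range (fun t => γ ^ t * ((t : ℝ) + 1) * Mg) H]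
  have h2 := 𝓜.hasSum_discount_mul_succ.mul_right Mg
  rw [one_div_mul_eq_div] at h2
  rcases Nat.eq_zero_or_pos H with rfl | hH
  · simp only [Finset.range_zero, Finset.sum_empty]
    obtain ⟨x⟩ : Nonempty (S × A) := nonempty_of_isProbabilityMeasure (𝓜.ρ ⊗ₘ 𝓟.policy θ)
    exact div_nonneg ((norm_nonneg _).trans (h x)) (sq_nonneg _)
  · have := hMg ⟨0, hH⟩
    have := 𝓜.γ_pos
    exact sum_le_hasSum _ (fun t _ => by positivity) h2

theorem sum_Iic_score (𝓟 : PolicyClass S A d) {H : ℕ} (θ : EuclideanSpace ℝ (Fin d))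
    (τ : ℕ → S × A) (t : Fin H) :
    ∑ t' ∈ Finset.Iic t, 𝓟.score θ (τ t') = CMDP.pathScore 𝓟 θ t τ := by
  have : Finset.range ((t : ℕ) + 1) = (Finset.Iic t).map Fin.valEmbedding := by
    rw [Fin.map_valEmbedding_Iic]
    ext k; simp
  rw [CMDP.pathScore, this, Finset.sum_map]
  rfl

theorem trajGrad_trunc (𝓜 : CMDP S A m γ) (𝓟 : PolicyClass S A d) (H : ℕ)
    (θ : EuclideanSpace ℝ (Fin d)) (i : Fin (m + 1)) (τ : ℕ → S × A) :
    trajGrad 𝓜 𝓟 H θ i (fun t => τ t)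
      = ∑ t ∈ Finset.range H, γ ^ t • (𝓜.r i (τ t) • CMDP.pathScore 𝓟 θ t τ) := by
  rw [trajGrad, ← Fin.sum_univ_eq_sum_range
    (fun t => γ ^ t • (𝓜.r i (τ t) • CMDP.pathScore 𝓟 θ t τ)) H]
  refine Finset.sum_congr rfl fun t _ => ?_
  rw [← Finset.smul_sum, sum_Iic_score, smul_smul]

theorem integral_trajValue (𝓜 : CMDP S A m γ) (𝓟 : PolicyClass S A d) (H : ℕ)
    (θ : EuclideanSpace ℝ (Fin d)) (i : Fin (m + 1)) :
    ∫ y, trajValue 𝓜 H i y ∂(truncLaw 𝓜 𝓟 H θ)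
      = ∑ t ∈ Finset.range H, γ ^ t * ∫ τ, 𝓜.r i (τ t) ∂(𝓜.law 𝓟 θ) := by
  rw [truncLaw, integral_map (measurable_trunc H).aemeasurable
    (measurable_trajValue 𝓜 H i).aestronglyMeasurable]
  have h : ∀ τ : ℕ → S × A, trajValue 𝓜 H i (fun t => τ t)
      = ∑ t ∈ Finset.range H, γ ^ t * 𝓜.r i (τ t) := fun τ =>
    Fin.sum_univ_eq_sum_range (fun t => γ ^ t * 𝓜.r i (τ t)) H
  simp_rw [h]
  rw [integral_finsetSum _ fun t _ => (CMDP.integrable_of_abs_le (𝓜.measurable_reward_coord i t)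
    fun τ => 𝓜.abs_r_le_one i _).const_mul _]
  simp_rw [integral_const_mul]

theorem measurable_trajGrad_right (𝓜 : CMDP S A m γ) (𝓟 : PolicyClass S A d) (H : ℕ)
    (θ : EuclideanSpace ℝ (Fin d)) (i : Fin (m + 1)) :
    Measurable fun y => trajGrad 𝓜 𝓟 H θ i y := by
  have hc := (measurable_trajGrad 𝓜 𝓟 H i).comp (measurable_prodMk_left (x := θ))
  simp only [Function.comp_def] at hc
  exact hc

theorem integral_trajGrad (h : ∀ x, ‖𝓟.score θ x‖ ≤ Mg) (H : ℕ) (i : Fin (m + 1)) :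
    ∫ y, trajGrad 𝓜 𝓟 H θ i y ∂(truncLaw 𝓜 𝓟 H θ)
      = ∑ t ∈ Finset.range H, γ ^ t • 𝓜.stepGrad 𝓟 i t θ := by
  have hm := measurable_trajGrad_right 𝓜 𝓟 H θ i
  rw [truncLaw, integral_map (measurable_trunc H).aemeasurable hm.aestronglyMeasurable]
  simp_rw [trajGrad_trunc]
  rw [integral_finsetSum _ fun t _ => ?_]
  · simp_rw [integral_smul]
    rfl
  · have hs : Measurable fun τ : ℕ → S × A => 𝓜.r i (τ t) • CMDP.pathScore 𝓟 θ t τ :=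
      (𝓜.measurable_reward_coord i t).smul (CMDP.measurable_pathScore 𝓟 θ t)
    exact (Integrable.of_bound hs.aestronglyMeasurable _
      (ae_of_all _ (CMDP.norm_reward_smul_pathScore_le h t t))).smul (γ ^ t)

theorem abs_integral_trajValue_sub_le (𝓜 : CMDP S A m γ) (𝓟 : PolicyClass S A d) (H : ℕ)
    (θ : EuclideanSpace ℝ (Fin d)) (i : Fin (m + 1)) :
    |∫ y, trajValue 𝓜 H i y ∂(truncLaw 𝓜 𝓟 H θ) - 𝓜.V 𝓟 i θ| ≤ γ ^ H / (1 - γ) := by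
  rw [integral_trajValue, abs_sub_comm]
  have h1 := (hasSum_nat_add_iff' H).2 (𝓜.hasSum_V 𝓟 i θ)
  have h2 := 𝓜.hasSum_discount.mul_left (γ ^ H)
  rw [mul_one_div] at h2
  rw [← h1.tsum_eq]
  refine tsum_of_norm_bounded (E := ℝ) h2 fun t => ?_
  rw [norm_mul, norm_pow, Real.norm_of_nonneg 𝓜.γ_pos.le, pow_add, mul_comm (γ ^ t)]
  exact mul_le_of_le_one_right (mul_nonneg (pow_nonneg 𝓜.γ_pos.le _) (pow_nonneg 𝓜.γ_pos.le _))
    (CMDP.abs_integral_le_of_abs_le fun τ => 𝓜.abs_r_le_one i _)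

/-- The truncation error is a tail of the policy gradient series; since t + H + 1 ≤ (1 + H) (t + 1),
the tail is at most γ^H (1 + H) times the bound for the whole series. -/
theorem norm_integral_trajGrad_sub_le (h : ∀ x, ‖𝓟.score θ x‖ ≤ Mg) (H : ℕ) (i : Fin (m + 1)) :
    ‖∫ y, trajGrad 𝓜 𝓟 H θ i y ∂(truncLaw 𝓜 𝓟 H θ) - 𝓜.policyGrad 𝓟 i θ‖
      ≤ lipConst γ Mg * (γ ^ H * (1 + H)) := by
  rw [integral_trajGrad h, norm_sub_rev]
  have hMg : 0 ≤ Mg := by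
    obtain ⟨x⟩ : Nonempty (S × A) := nonempty_of_isProbabilityMeasure (𝓜.ρ ⊗ₘ 𝓟.policy θ)
    exact (norm_nonneg _).trans (h x)
  have h1 := (hasSum_nat_add_iff' H).2 (CMDP.hasSum_policyGrad (𝓜 := 𝓜) (i := i) h)
  have h2 := 𝓜.hasSum_discount_mul_succ.mul_left (Mg * (γ ^ H * (1 + H)))
  have e : Mg * (γ ^ H * (1 + H)) * (1 / (1 - γ) ^ 2) = lipConst γ Mg * (γ ^ H * (1 + H)) := by
    rw [lipConst]; ring
  rw [e] at h2
  rw [← h1.tsum_eq]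
  refine tsum_of_norm_bounded h2 fun t => ?_
  refine (CMDP.norm_discount_smul_stepGrad_le h (t + H)).trans ?_
  have := 𝓜.γ_pos
  have h3 : ((t + H : ℕ) : ℝ) + 1 ≤ (1 + H) * (t + 1) := by
    push_cast
    nlinarith [mul_nonneg (Nat.cast_nonneg (α := ℝ) t) (Nat.cast_nonneg (α := ℝ) H)]
  calc γ ^ (t + H) * (((t + H : ℕ) : ℝ) + 1) * Mg
      ≤ γ ^ (t + H) * ((1 + H) * (t + 1)) * Mg := by gcongr
    _ = _ := by rw [pow_add]; ring

/-- All estimators computed from the batch are within `e₀` (values) and `e₁` (gradients) of the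
quantities they estimate. -/
def Accurate (𝓜 : CMDP S A m γ) (𝓟 : PolicyClass S A d) (p : LBParams) (e₀ e₁ : ℝ)
    (θ : EuclideanSpace ℝ (Fin d)) (b : Batch S A p) : Prop :=
  ∀ i : Fin (m + 1), |valueEst 𝓜 p i b - 𝓜.V 𝓟 i θ| ≤ e₀ ∧
    ‖gradEst 𝓜 𝓟 p θ i b - gradient (𝓜.V 𝓟 i) θ‖ ≤ e₁

/-- The relative size of the statistical error. -/
noncomputable def statError (m : ℕ) (δ : ℝ) (n : ℕ) : ℝ :=
  (4 * m + 8) * √(Real.log (2 / δ)) / √(n : ℝ)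

/-- The constant 9/16 makes the square root of the logarithm at least 3/4, which absorbs the offset
3/2 of the Hoeffding bound into a multiple of that root. -/
theorem half_le_log_two_div {δ : ℝ} (hδ : 0 < δ) (hδ1 : δ ≤ 1) : 9 / 16 ≤ Real.log (2 / δ) := by
  have h1 : (2 : ℝ) ≤ 2 / δ := by rw [le_div_iff₀ hδ]; linarith
  have h2 := Real.log_le_log (by norm_num) h1
  linarith [Real.log_two_gt_d9]

/-- The expectation of the value estimates. -/
noncomputable def meanValue (𝓜 : CMDP S A m γ) (𝓟 : PolicyClass S A d) (H : ℕ) (i : Fin (m + 1))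
    (θ : EuclideanSpace ℝ (Fin d)) : ℝ :=
  ∫ y, trajValue 𝓜 H i y ∂(truncLaw 𝓜 𝓟 H θ)

/-- The expectation of the gradient estimates. -/
noncomputable def meanGrad (𝓜 : CMDP S A m γ) (𝓟 : PolicyClass S A d) (H : ℕ) (i : Fin (m + 1))
    (θ : EuclideanSpace ℝ (Fin d)) : EuclideanSpace ℝ (Fin d) :=
  ∫ y, trajGrad 𝓜 𝓟 H θ i y ∂(truncLaw 𝓜 𝓟 H θ)

theorem measurable_meanValue (𝓜 : CMDP S A m γ) (𝓟 : PolicyClass S A d) (H : ℕ)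
    (i : Fin (m + 1)) : Measurable (meanValue 𝓜 𝓟 H i) := by
  let κ : Kernel (EuclideanSpace ℝ (Fin d)) (Fin H → S × A) :=
    ⟨truncLaw 𝓜 𝓟 H, measurable_truncLaw 𝓜 𝓟 H⟩
  exact ((measurable_trajValue 𝓜 H i).stronglyMeasurable.integral_kernel (κ := κ)).measurable

theorem measurable_meanGrad (𝓜 : CMDP S A m γ) (𝓟 : PolicyClass S A d) (H : ℕ)
    (i : Fin (m + 1)) : Measurable (meanGrad 𝓜 𝓟 H i) := by
  let κ : Kernel (EuclideanSpace ℝ (Fin d)) (Fin H → S × A) :=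
    ⟨truncLaw 𝓜 𝓟 H, measurable_truncLaw 𝓜 𝓟 H⟩
  have hκ : IsMarkovKernel κ := ⟨fun θ => isProbabilityMeasure_truncLaw 𝓜 𝓟 H θ⟩
  exact ((measurable_trajGrad 𝓜 𝓟 H i).stronglyMeasurable.integral_kernel_prod_right'
    (κ := κ)).measurable

theorem batchLaw_value_deviation_le (𝓜 : CMDP S A m γ) (𝓟 : PolicyClass S A d) (p : LBParams)
    (hn : 0 < p.n) (θ : EuclideanSpace ℝ (Fin d)) (i : Fin (m + 1)) {s : ℝ} (hs : 0 ≤ s) :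
    batchLaw 𝓜 𝓟 p θ {b | 1 / (1 - γ) * (2 * (3 / 2 + s) / √(p.n : ℝ))
        ≤ ‖valueEst 𝓜 p i b - meanValue 𝓜 𝓟 p.H i θ‖} ≤ ENNReal.ofReal (Real.exp (-(s ^ 2 / 2))) := by
  have h := measure_pi_norm_mean_sub_ge_le (ν := truncLaw 𝓜 𝓟 p.H θ)
    (measurable_trajValue 𝓜 p.H i) (one_div_pos.2 𝓜.one_sub_pos) (abs_trajValue_le 𝓜 p.H i) hn hs
  rw [batchLaw_eq_pi]
  refine (measure_mono fun b hb => ?_).trans h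
  rw [Set.mem_ofPred_eq] at hb ⊢
  rw [valueEst_eq] at hb
  refine le_trans (le_of_eq ?_) hb
  ring

theorem batchLaw_grad_deviation_le (h : ∀ x, ‖𝓟.score θ x‖ ≤ Mg) (hMg : 0 < Mg) (p : LBParams)
    (hn : 0 < p.n) (i : Fin (m + 1)) {s : ℝ} (hs : 0 ≤ s) :
    batchLaw 𝓜 𝓟 p θ {b | lipConst γ Mg * (2 * (3 / 2 + s) / √(p.n : ℝ))
        ≤ ‖gradEst 𝓜 𝓟 p θ i b - meanGrad 𝓜 𝓟 p.H i θ‖}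
      ≤ ENNReal.ofReal (Real.exp (-(s ^ 2 / 2))) := by
  have hL : 0 < lipConst γ Mg := div_pos hMg (pow_pos 𝓜.one_sub_pos 2)
  have h := measure_pi_norm_mean_sub_ge_le (ν := truncLaw 𝓜 𝓟 p.H θ)
    (measurable_trajGrad_right 𝓜 𝓟 p.H θ i) hL (norm_trajGrad_le h p.H i) hn hs
  rw [batchLaw_eq_pi]
  refine (measure_mono fun b hb => ?_).trans h
  rw [Set.mem_ofPred_eq] at hb ⊢
  rw [gradEst_eq] at hb
  refine le_trans (le_of_eq ?_) hb
  ring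

/-- The pairs of a strictly feasible parameter and a batch for which some estimate deviates from
its mean. -/
def deviationSet (𝓜 : CMDP S A m γ) (𝓟 : PolicyClass S A d) (p : LBParams) (e₀ e₁ : ℝ) :
    Set (EuclideanSpace ℝ (Fin d) × Batch S A p) :=
  {q | q.1 ∈ 𝓜.strictlyFeasible 𝓟} ∩ ⋃ i, ({q | e₀ ≤ ‖valueEst 𝓜 p i q.2 - meanValue 𝓜 𝓟 p.H i q.1‖}
    ∪ {q | e₁ ≤ ‖gradEst 𝓜 𝓟 p q.1 i q.2 - meanGrad 𝓜 𝓟 p.H i q.1‖})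

theorem measurableSet_deviationSet (𝓜 : CMDP S A m γ) (𝓟 : PolicyClass S A d) (p : LBParams)
    (e₀ e₁ : ℝ) : MeasurableSet (deviationSet 𝓜 𝓟 p e₀ e₁) := by
  refine MeasurableSet.inter (measurable_fst CMDP.isOpen_strictlyFeasible.measurableSet)
    (MeasurableSet.iUnion fun i => MeasurableSet.union ?_ ?_)
  · have h1 := (measurable_valueEst 𝓜 p i).comp
      (measurable_snd : Measurable
        (Prod.snd : EuclideanSpace ℝ (Fin d) × Batch S A p → Batch S A p))
    have h2 := (measurable_meanValue 𝓜 𝓟 p.H i).comp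
      (measurable_fst : Measurable
        (Prod.fst : EuclideanSpace ℝ (Fin d) × Batch S A p → EuclideanSpace ℝ (Fin d)))
    simp only [Function.comp_def] at h1 h2
    exact measurableSet_le measurable_const (h1.sub h2).norm
  · have h2 := (measurable_meanGrad 𝓜 𝓟 p.H i).comp
      (measurable_fst : Measurable
        (Prod.fst : EuclideanSpace ℝ (Fin d) × Batch S A p → EuclideanSpace ℝ (Fin d)))
    simp only [Function.comp_def] at h2
    exact measurableSet_le measurable_const ((measurable_gradEst 𝓜 𝓟 p i).sub h2).norm

/-- A union over the 2 (m + 1) estimators. Outside the strictly feasible set the section is empty,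
so the score bound is never needed there. Deviations are measured from the means because these
depend measurably on the parameter. -/
theorem batchLaw_deviationSet_le (hB : 𝓜.BoundedScore 𝓟 Mg Mh) (hMg : 0 < Mg) (p : LBParams)
    (hn : 0 < p.n) (θ : EuclideanSpace ℝ (Fin d)) {s : ℝ} (hs : 0 ≤ s) :
    batchLaw 𝓜 𝓟 p θ {b | (θ, b) ∈ deviationSet 𝓜 𝓟 p (1 / (1 - γ) * (2 * (3 / 2 + s) / √(p.n : ℝ)))
        (lipConst γ Mg * (2 * (3 / 2 + s) / √(p.n : ℝ)))}
      ≤ ENNReal.ofReal ((2 * (m + 1) : ℕ) * Real.exp (-(s ^ 2 / 2))) := by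
  by_cases hθ : θ ∈ 𝓜.strictlyFeasible 𝓟
  · have hsc : ∀ x, ‖𝓟.score θ x‖ ≤ Mg := fun x => (hB θ (CMDP.strictlyFeasible_subset hθ) x).1
    refine (measure_mono (t := ⋃ i, ({b | 1 / (1 - γ) * (2 * (3 / 2 + s) / √(p.n : ℝ))
        ≤ ‖valueEst 𝓜 p i b - meanValue 𝓜 𝓟 p.H i θ‖}
      ∪ {b | lipConst γ Mg * (2 * (3 / 2 + s) / √(p.n : ℝ))
        ≤ ‖gradEst 𝓜 𝓟 p θ i b - meanGrad 𝓜 𝓟 p.H i θ‖})) fun b hb => ?_).trans ?_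
    · obtain ⟨i, hi⟩ := Set.mem_iUnion.1 hb.2
      exact Set.mem_iUnion.2 ⟨i, hi⟩
    · refine (measure_iUnion_fintype_le _ _).trans ((Finset.sum_le_sum fun i _ =>
        (measure_union_le _ _).trans (add_le_add (batchLaw_value_deviation_le 𝓜 𝓟 p hn θ i hs)
          (batchLaw_grad_deviation_le hsc hMg p hn i hs))).trans (le_of_eq ?_))
      rw [Finset.sum_const, Finset.card_univ, Fintype.card_fin, nsmul_eq_mul,
        ENNReal.ofReal_mul (Nat.cast_nonneg _), ENNReal.ofReal_natCast]
      push_cast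
      ring
  · refine le_trans (le_of_eq ?_) zero_le
    convert measure_empty (μ := batchLaw 𝓜 𝓟 p θ) using 2
    ext b
    simp [hθ, deviationSet]

/-- With probability at least `1 - T δ` all the batches used at strictly feasible iterates are
accurate. -/
theorem IsRun.measure_accurate_ge {p : LBParams} {θ₀ : EuclideanSpace ℝ (Fin d)} {T : ℕ}
    {Ω : Type w} [MeasurableSpace Ω] {μ : Measure Ω} [IsProbabilityMeasure μ]
    {ξ : ℕ → Ω → Batch S A p} (hrun : IsRun 𝓜 𝓟 p θ₀ T μ ξ) (hB : 𝓜.BoundedScore 𝓟 Mg Mh)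
    (hMg : 0 < Mg) (hn : 0 < p.n) (hδ : 0 < p.δ) (hδ1 : p.δ ≤ 1) {Γ : Set Ω}
    (hΓ : ∀ ω, (∀ t < T, iterate 𝓜 𝓟 p θ₀ (fun s => ξ s ω) t ∈ 𝓜.strictlyFeasible 𝓟 →
      Accurate 𝓜 𝓟 p (1 / (1 - γ) * (statError m p.δ p.n + γ ^ p.H))
        (lipConst γ Mg * (statError m p.δ p.n + γ ^ p.H * (1 + p.H)))
        (iterate 𝓜 𝓟 p θ₀ (fun s => ξ s ω) t) (ξ t ω)) → ω ∈ Γ) :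
    1 - T * p.δ ≤ μ.real Γ := by
  have hγ := 𝓜.one_sub_pos
  have hL : 0 < lipConst γ Mg := by rw [lipConst]; positivity
  have hn' : (0 : ℝ) < √(p.n : ℝ) := Real.sqrt_pos.2 (by exact_mod_cast hn)
  set lg := Real.log (2 / p.δ) with hlg
  have hlg0 : 9 / 16 ≤ lg := half_le_log_two_div hδ hδ1
  set K : ℕ := 2 * (m + 1) with hK
  -- Chosen so that each failure probability is (δ / 2)^K. Then K (δ / 2)^K ≤ δ^K ≤ δ, so all
  -- estimators together fail with probability at most δ.
  set s : ℝ := √(2 * K * lg) with hs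
  have hs2 : s ^ 2 / 2 = K * lg := by rw [hs, Real.sq_sqrt (by positivity)]; ring
  have hstat : 2 * (3 / 2 + s) / √(p.n : ℝ) ≤ statError m p.δ p.n := by
    rw [statError]
    refine div_le_div_of_nonneg_right ?_ hn'.le
    have h1 : 3 / 2 ≤ 2 * √lg := by
      have : (3 / 4 : ℝ) ≤ √lg := Real.le_sqrt_of_sq_le (by norm_num; linarith)
      linarith
    have h2 : s ≤ 2 * (m + 1) * √lg := by
      have : 2 * ((m : ℝ) + 1) * √lg = √((2 * (m + 1)) ^ 2 * lg) := by
        rw [Real.sqrt_mul (by positivity), Real.sqrt_sq (by positivity)]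
      rw [this, hs]
      refine Real.sqrt_le_sqrt (mul_le_mul_of_nonneg_right ?_ (by linarith))
      rw [hK]; push_cast
      nlinarith [Nat.cast_nonneg (α := ℝ) m]
    nlinarith [Real.sqrt_nonneg lg]
  have hxle : K * Real.exp (-(s ^ 2 / 2)) ≤ p.δ := by
    have h1 : Real.exp (-(s ^ 2 / 2)) = (p.δ / 2) ^ K := by
      rw [hs2, hlg, Real.exp_neg, mul_comm, Real.exp_mul, Real.exp_log (by positivity),
        Real.rpow_natCast, ← inv_pow, inv_div]
    have h2 : (K : ℝ) ≤ 2 ^ K := by exact_mod_cast Nat.lt_two_pow_self.le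
    have h3 : p.δ ^ K ≤ p.δ := pow_le_of_le_one hδ.le hδ1 (by omega)
    rw [h1, div_pow]
    calc (K : ℝ) * (p.δ ^ K / 2 ^ K) ≤ 2 ^ K * (p.δ ^ K / 2 ^ K) := by gcongr
      _ = p.δ ^ K := by field_simp
      _ ≤ p.δ := h3
  refine hrun.measure_good_ge (measurableSet_deviationSet 𝓜 𝓟 p _ _) hδ.le (fun θ =>
    (batchLaw_deviationSet_le hB hMg p hn θ (Real.sqrt_nonneg (2 * K * lg))).trans
      (ENNReal.ofReal_le_ofReal hxle)) fun ω hω => hΓ ω fun t ht hθ i => ?_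
  have hnot := hω t ht
  set Θ := iterate 𝓜 𝓟 p θ₀ (fun s => ξ s ω) t with hΘ
  have hsc : ∀ x, ‖𝓟.score Θ x‖ ≤ Mg := fun x => (hB _ (CMDP.strictlyFeasible_subset hθ) x).1
  have h1 := fun h => hnot ⟨hθ, Set.mem_iUnion.2 ⟨i, Or.inl h⟩⟩
  have h2 := fun h => hnot ⟨hθ, Set.mem_iUnion.2 ⟨i, Or.inr h⟩⟩
  rw [imp_false, Set.mem_ofPred_eq, not_le] at h1 h2
  rw [Real.norm_eq_abs] at h1
  have h3 := abs_integral_trajValue_sub_le 𝓜 𝓟 p.H Θ i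
  have h4 := norm_integral_trajGrad_sub_le (𝓜 := 𝓜) hsc p.H i
  have h5 := mul_le_mul_of_nonneg_left hstat (one_div_pos.2 hγ).le
  have h6 := mul_le_mul_of_nonneg_left hstat hL.le
  rw [← meanValue] at h3
  rw [← meanGrad] at h4
  constructor
  · have := abs_sub_le (valueEst 𝓜 p i (ξ t ω)) (meanValue 𝓜 𝓟 p.H i Θ) (𝓜.V 𝓟 i Θ)
    rw [mul_add, one_div_mul_eq_div (1 - γ) (γ ^ p.H)]
    linarith
  · have := norm_sub_le_norm_sub_add_norm_sub (gradEst 𝓜 𝓟 p Θ i (ξ t ω))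
      (meanGrad 𝓜 𝓟 p.H i Θ) (𝓜.policyGrad 𝓟 i Θ)
    rw [hB.gradient_V hθ, mul_add]
    linarith

end LBSGD

/-! ### Norm of the Moore-Penrose inverse. -/

section MoorePenrose

open scoped Matrix.Norms.L2Operator

/-- Diagonalizing by a unitary preserves the operator norm and leaves a diagonal matrix whose
entries are 0 or inverses of eigenvalues that are at least `c`. -/
theorem norm_symmPinv_le {d : ℕ} {F : Matrix (Fin d) (Fin d) ℝ} (hF : F.IsHermitian) {c : ℝ}
    (hc : 0 < c)
    (h : ∀ x : ℝ, x ≠ 0 → Module.End.HasEigenvalue (Matrix.toLin' F) x → c ≤ x) :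
    ‖symmPinv F‖ ≤ c⁻¹ := by
  rw [symmPinv, hF.cfc_eq, Matrix.IsHermitian.cfc, Unitary.conjStarAlgAut_apply, mul_assoc,
    CStarRing.norm_coe_unitary_mul, ← Unitary.coe_star, CStarRing.norm_mul_coe_unitary,
    Matrix.l2_opNorm_diagonal, pi_norm_le_iff_of_nonneg (inv_pos.2 hc).le]
  intro i
  rw [Function.comp_apply, Function.comp_apply, RCLike.norm_ofReal]
  rcases eq_or_ne (hF.eigenvalues i) 0 with h0 | h0
  · rw [h0, inv_zero, abs_zero]; exact (inv_pos.2 hc).le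
  · have h1 : c ≤ hF.eigenvalues i := by
      refine h _ h0 ?_
      rw [Module.End.hasEigenvalue_iff_mem_spectrum, Matrix.spectrum_toLin']
      exact hF.eigenvalues_mem_spectrum_real i
    rw [abs_of_pos (inv_pos.2 (hc.trans_le h1))]
    exact inv_anti₀ hc h1

theorem norm_symmPinv_mulVec_le {d : ℕ} {F : Matrix (Fin d) (Fin d) ℝ} (hF : F.IsHermitian) {c : ℝ}
    (hc : 0 < c)
    (h : ∀ x : ℝ, x ≠ 0 → Module.End.HasEigenvalue (Matrix.toLin' F) x → c ≤ x)
    (v : EuclideanSpace ℝ (Fin d)) :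
    ‖(WithLp.toLp 2 (Matrix.mulVec (symmPinv F) v.ofLp) : EuclideanSpace ℝ (Fin d))‖
      ≤ ‖v‖ / c := by
  rw [div_eq_inv_mul]
  exact (Matrix.l2_opNorm_mulVec _ v).trans
    (mul_le_mul_of_nonneg_right (norm_symmPinv_le hF hc h) (norm_nonneg _))

end MoorePenrose

/-! ### Gradient domination from the transfer error. -/

namespace CMDP

variable {S : Type u} {A : Type v} [MeasurableSpace S] [MeasurableSpace A] {m : ℕ} {γ : ℝ} {d : ℕ}
  {𝓜 : CMDP S A m γ} {𝓟 : PolicyClass S A d} {Mg Mh : ℝ}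

theorem isHermitian_fisher (𝓜 : CMDP S A m γ) (𝓟 : PolicyClass S A d)
    (θ : EuclideanSpace ℝ (Fin d)) : (𝓜.fisher 𝓟 θ).IsHermitian :=
  Matrix.IsHermitian.ext fun k l => by
    simp only [fisher, Matrix.of_apply, star_trivial]
    exact integral_congr_ae (ae_of_all _ fun x => mul_comm _ _)

/-- The gradient of the log barrier function `V_0 + η ∑ᵢ log V_i`. -/
noncomputable def barrierGrad (𝓜 : CMDP S A m γ) (𝓟 : PolicyClass S A d) (η : ℝ)
    (θ : EuclideanSpace ℝ (Fin d)) : EuclideanSpace ℝ (Fin d) :=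
  gradient (𝓜.V 𝓟 0) θ
    + η • ∑ i : Fin m, (𝓜.V 𝓟 i.succ θ)⁻¹ • gradient (𝓜.V 𝓟 i.succ) θ

/-- The pseudo-inverse is linear and common to all rewards, so weighting the natural gradients by 1
and η / V i reproduces the barrier gradient. -/
theorem naturalGradient_combination (𝓜 : CMDP S A m γ) (𝓟 : PolicyClass S A d) (η : ℝ)
    (θ : EuclideanSpace ℝ (Fin d)) :
    𝓜.naturalGradient 𝓟 0 θ + ∑ i : Fin m, (η / 𝓜.V 𝓟 i.succ θ) • 𝓜.naturalGradient 𝓟 i.succ θ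
      = WithLp.toLp 2 (Matrix.mulVec (symmPinv (𝓜.fisher 𝓟 θ)) (𝓜.barrierGrad 𝓟 η θ).ofLp) := by
  have h : ∀ v : EuclideanSpace ℝ (Fin d),
      (WithLp.toLp 2 (Matrix.mulVec (symmPinv (𝓜.fisher 𝓟 θ)) v.ofLp) : EuclideanSpace ℝ (Fin d))
        = Matrix.toEuclideanLin (symmPinv (𝓜.fisher 𝓟 θ)) v := fun v => rfl
  simp_rw [naturalGradient, h, barrierGrad, map_add, map_smul, map_sum, Finset.smul_sum, map_smul,
    smul_smul, div_eq_mul_inv]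

/-- The compatible-approximation residual is integrated against the visitation measure of `π`: the
advantage gives the value gap, the linear part gives the pairing with the mean score. -/
theorem value_sub_le_of_transferError (hsc : ∀ x, ‖𝓟.score θ x‖ ≤ Mg) (π : Kernel S A)
    [IsMarkovKernel π] {i : Fin (m + 1)} {ε : ℝ} (hε : 𝓜.transferError 𝓟 i θ π ≤ ε) :
    𝓜.value i π - 𝓜.V 𝓟 i θ ≤ √ε / (1 - γ)
      + inner ℝ (𝓜.naturalGradient 𝓟 i θ) (∫ x, 𝓟.score θ x ∂(𝓜.visitation π)) := by
  have hγ := 𝓜.one_sub_pos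
  set ν := 𝓜.visitation π with hν
  set μ := 𝓜.naturalGradient 𝓟 i θ with hμ
  have hsm := 𝓟.measurable_score θ
  have hsi : Integrable (𝓟.score θ) ν :=
    Integrable.of_bound hsm.aestronglyMeasurable Mg (ae_of_all _ hsc)
  have hb : ∀ x, |inner ℝ μ (𝓟.score θ x)| ≤ ‖μ‖ * Mg := fun x =>
    (abs_real_inner_le_norm _ _).trans (mul_le_mul_of_nonneg_left (hsc x) (norm_nonneg _))
  have him : Measurable fun x => inner ℝ μ (𝓟.score θ x) := measurable_const.inner hsm
  have hA := 𝓜.measurable_advantage i (𝓟.policy θ)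
  set f : S × A → ℝ := fun x => 𝓜.advantage i (𝓟.policy θ) x - (1 - γ) * inner ℝ μ (𝓟.score θ x)
    with hf
  have hfm : Measurable f := hA.sub (him.const_mul _)
  have hfb : ∀ x, |f x| ≤ 2 / (1 - γ) + (1 - γ) * (‖μ‖ * Mg) := fun x => by
    refine (abs_sub _ _).trans (add_le_add (𝓜.abs_advantage_le i _ x) ?_)
    rw [abs_mul, abs_of_pos hγ]
    exact mul_le_mul_of_nonneg_left (hb x) hγ.le
  have hfi : Integrable f ν := integrable_of_abs_le hfm hfb
  have hf2 : MemLp f 2 ν := MemLp.of_bound hfm.aestronglyMeasurable _ (ae_of_all _ hfb)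
  have hAi : Integrable (𝓜.advantage i (𝓟.policy θ)) ν :=
    integrable_of_abs_le hA (𝓜.abs_advantage_le i _)
  have hii : Integrable (fun x => inner ℝ μ (𝓟.score θ x)) ν := integrable_of_abs_le him hb
  have h1 : ∫ x, f x ∂ν = (1 - γ) * (𝓜.value i π - 𝓜.V 𝓟 i θ)
      - (1 - γ) * inner ℝ μ (∫ x, 𝓟.score θ x ∂ν) := by
    rw [hf, integral_sub hAi (hii.const_mul _), integral_const_mul, V, performance_difference,
      integral_inner hsi]
  -- Jensen's inequality in the form of nonnegativity of the variance.
  have h2 : (∫ x, f x ∂ν) ^ 2 ≤ ε := by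
    have hv := ProbabilityTheory.variance_nonneg f ν
    rw [ProbabilityTheory.variance_eq_sub hf2] at hv
    have h3 : ∫ x, f x ^ 2 ∂ν ≤ ε := hε
    have h4 : ν[f ^ 2] = ∫ x, f x ^ 2 ∂ν := rfl
    linarith
  have h3 : ∫ x, f x ∂ν ≤ √ε := Real.le_sqrt_of_sq_le h2
  rw [h1] at h3
  rw [← sub_le_iff_le_add, le_div_iff₀ hγ]
  linarith

/-- Gradient domination for the log barrier. -/
theorem value_sub_le_of_relaxedFisher (hB : 𝓜.BoundedScore 𝓟 Mg Mh) {πopt : Kernel S A}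
    [IsMarkovKernel πopt] (hopt : ∀ i : Fin m, 0 ≤ 𝓜.value i.succ πopt) {μF ε η : ℝ}
    (hμF : 0 < μF) (hF : 𝓜.RelaxedFisher 𝓟 μF) (hε : 𝓜.BoundedTransferError 𝓟 πopt ε)
    (hη : 0 < η) {θ : EuclideanSpace ℝ (Fin d)} (hθ : θ ∈ 𝓜.strictlyFeasible 𝓟) :
    𝓜.value 0 πopt - 𝓜.V 𝓟 0 θ ≤ m * η
      + √ε / (1 - γ) * (1 + ∑ i : Fin m, η / 𝓜.V 𝓟 i.succ θ)
      + Mg * (‖𝓜.barrierGrad 𝓟 η θ‖ / μF) := by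
  have hfe := strictlyFeasible_subset hθ
  have hsc : ∀ x, ‖𝓟.score θ x‖ ≤ Mg := fun x => (hB θ hfe x).1
  have hV : ∀ i : Fin m, 0 < 𝓜.V 𝓟 i.succ θ := hθ
  set σ := ∫ x, 𝓟.score θ x ∂(𝓜.visitation πopt) with hσ
  have hσn : ‖σ‖ ≤ Mg := by
    have := norm_integral_le_of_norm_le_const (μ := 𝓜.visitation πopt) (ae_of_all _ hsc)
    rwa [probReal_univ, mul_one] at this
  have h0 := value_sub_le_of_transferError hsc πopt (hε θ hfe 0)
  -- Multiplied by η / V i, the gap of constraint i is at least -η, since the optimal policy is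
  -- feasible. Each constraint thus costs only η, however small V i is.
  have hi : ∀ i : Fin m, -η ≤ √ε / (1 - γ) * (η / 𝓜.V 𝓟 i.succ θ)
      + inner ℝ ((η / 𝓜.V 𝓟 i.succ θ) • 𝓜.naturalGradient 𝓟 i.succ θ) σ := fun i => by
    have h1 := mul_le_mul_of_nonneg_left
      (value_sub_le_of_transferError hsc πopt (hε θ hfe i.succ)) (div_pos hη (hV i)).le
    have h2 : η / 𝓜.V 𝓟 i.succ θ * 𝓜.V 𝓟 i.succ θ = η := div_mul_cancel₀ _ (hV i).ne'
    have h3 := mul_nonneg (div_pos hη (hV i)).le (hopt i)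
    rw [real_inner_smul_left]
    linarith
  have hs := Finset.sum_le_sum fun i (_ : i ∈ (Finset.univ : Finset (Fin m))) => hi i
  rw [Finset.sum_const, Finset.card_univ, Fintype.card_fin, nsmul_eq_mul, Finset.sum_add_distrib,
    ← Finset.mul_sum, ← sum_inner] at hs
  have hc : inner ℝ (𝓜.naturalGradient 𝓟 0 θ) σ
      + inner ℝ (∑ i : Fin m, (η / 𝓜.V 𝓟 i.succ θ) • 𝓜.naturalGradient 𝓟 i.succ θ) σ
      ≤ Mg * (‖𝓜.barrierGrad 𝓟 η θ‖ / μF) := by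
    rw [← inner_add_left, naturalGradient_combination, mul_comm Mg]
    refine (real_inner_le_norm _ _).trans (mul_le_mul
      (norm_symmPinv_mulVec_le (𝓜.isHermitian_fisher 𝓟 θ) hμF (hF θ hfe) _) hσn
      (norm_nonneg _) (by positivity))
  linarith

end CMDP

/-! ### The truncated logarithm. -/

section Scalar

/-- A quadratic lower bound for the logarithm, valid down to `log (1/3)`. -/
theorem sub_sq_le_log_one_add {x : ℝ} (hx : -(2 / 3) ≤ x) : x - x ^ 2 ≤ Real.log (1 + x) := by
  rcases le_or_gt 0 x with h0 | h0
  · refine le_trans ?_ (Real.le_log_one_add_of_nonneg h0)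
    rw [le_div_iff₀ (by linarith)]
    nlinarith [mul_nonneg h0 (sq_nonneg x), sq_nonneg x]
  -- On negative arguments `f` increases up to -1/2 and decreases from there to 0, so it suffices to
  -- check both endpoints. At -2/3 the claim is log 3 ≤ 10/9.
  · set f : ℝ → ℝ := fun y => Real.log (1 + y) - y + y ^ 2 with hf
    have hd : ∀ y : ℝ, -1 < y → HasDerivAt f (y * (1 + 2 * y) / (1 + y)) y := fun y hy => by
      have hy' : (1 + y) ≠ 0 := by linarith
      have h1 := ((((hasDerivAt_id y).const_add 1).log hy').sub (hasDerivAt_id y)).add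
        (hasDerivAt_pow 2 y)
      refine h1.congr_deriv ?_
      simp only [id]
      field_simp
      push_cast; ring
    have hc : ∀ s : Set ℝ, (∀ y ∈ s, -1 < y) → ContinuousOn f s := fun s hs y hy =>
      (hd y (hs y hy)).continuousAt.continuousWithinAt
    suffices h : 0 ≤ f x by simp only [hf] at h; linarith
    rcases le_or_gt x (-(1 / 2)) with h1 | h1
    · have hmono : MonotoneOn f (Set.Icc (-(2 / 3)) (-(1 / 2))) := by
        refine monotoneOn_of_deriv_nonneg (convex_Icc _ _)
          (hc _ fun y hy => by linarith [hy.1]) (fun y hy => ?_) fun y hy => ?_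
        · rw [interior_Icc] at hy
          exact (hd y (by linarith [hy.1])).differentiableAt.differentiableWithinAt
        · rw [interior_Icc] at hy
          rw [(hd y (by linarith [hy.1])).deriv]
          exact div_nonneg (mul_nonneg_of_nonpos_of_nonpos (by linarith [hy.2])
            (by linarith [hy.2])) (by linarith [hy.1])
      refine le_trans ?_ (hmono ⟨le_rfl, by norm_num⟩ ⟨hx, h1⟩ hx)
      simp only [hf]
      have h2 : Real.log (1 + -(2 / 3)) = -Real.log 3 := by
        rw [← Real.log_inv]; norm_num
      rw [h2]
      have h3 : Real.log 3 ≤ 10 / 9 := by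
        rw [Real.log_le_iff_le_exp (by norm_num)]
        have h4 := Real.quadratic_le_exp_of_nonneg (x := 1 / 9) (by norm_num)
        have h5 := Real.exp_one_gt_d9
        have h6 : Real.exp (10 / 9) = Real.exp 1 * Real.exp (1 / 9) := by
          rw [← Real.exp_add]; norm_num
        rw [h6]
        nlinarith
      linarith
    · have hanti : AntitoneOn f (Set.Icc (-(1 / 2)) 0) := by
        refine antitoneOn_of_deriv_nonpos (convex_Icc _ _)
          (hc _ fun y hy => by linarith [hy.1]) (fun y hy => ?_) fun y hy => ?_
        · rw [interior_Icc] at hy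
          exact (hd y (by linarith [hy.1])).differentiableAt.differentiableWithinAt
        · rw [interior_Icc] at hy
          rw [(hd y (by linarith [hy.1])).deriv]
          exact div_nonpos_of_nonpos_of_nonneg (mul_nonpos_of_nonpos_of_nonneg hy.2.le
            (by linarith [hy.1])) (by linarith [hy.1])
      refine le_trans ?_ (hanti ⟨h1.le, h0.le⟩ ⟨by norm_num, le_rfl⟩ h0.le)
      simp [hf]

/-- The potential `ψ(min (v / η) 1)`, `ψ(x) = log x + 1 - x`: a truncated logarithm, smooth at the
truncation level `η`. -/
noncomputable def truncLog (η v : ℝ) : ℝ :=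
  Real.log (min (v / η) 1) + 1 - min (v / η) 1

variable {η v w : ℝ}

theorem truncLog_of_le (hη : 0 < η) (h : v ≤ η) :
    truncLog η v = Real.log (v / η) + 1 - v / η := by
  rw [truncLog, min_eq_left ((div_le_one hη).2 h)]

theorem truncLog_of_ge (hη : 0 < η) (h : η ≤ v) : truncLog η v = 0 := by
  rw [truncLog, min_eq_right ((one_le_div hη).2 h)]; simp

theorem truncLog_nonpos (hη : 0 < η) (hv : 0 < v) : truncLog η v ≤ 0 := by
  have := Real.log_le_sub_one_of_pos (lt_min (div_pos hv hη) one_pos)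
  rw [truncLog]; linarith

/-- The concave function log x + 1 - x has its maximum 0 at x = 1, so continuing it past 1 instead
of truncating only lowers it. -/
theorem log_add_one_sub_le_truncLog (hη : 0 < η) (hv : 0 < v) :
    Real.log (v / η) + 1 - v / η ≤ truncLog η v := by
  rcases le_total v η with h | h
  · rw [truncLog_of_le hη h]
  · rw [truncLog_of_ge hη h]
    have := Real.log_le_sub_one_of_pos (div_pos hv hη)
    linarith

/-- `log x + 1 - x` is increasing on `(0, 1]`. -/
theorem log_add_one_sub_mono {x y : ℝ} (hx : 0 < x) (hxy : x ≤ y) (hy : y ≤ 1) :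
    Real.log x + 1 - x ≤ Real.log y + 1 - y := by
  have hy0 := hx.trans_le hxy
  have h := Real.log_le_sub_one_of_pos (div_pos hx hy0)
  rw [Real.log_div hx.ne' hy0.ne'] at h
  have h2 : x / y - 1 ≤ x - y := by
    rw [div_sub_one hy0.ne', div_le_iff₀ hy0]
    nlinarith
  linarith

theorem truncLog_ge_of_ge {c : ℝ} (hη : 0 < η) (hc : 0 < c) (hc1 : c ≤ 1) (h : c * η ≤ v) :
    Real.log c + 1 - c ≤ truncLog η v :=
  log_add_one_sub_mono hc (le_min ((le_div_iff₀ hη).2 h) hc1) (min_le_right _ _)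

/-- A one-sided quadratic expansion across the truncation level. Below the level, the untruncated
function minorizes and its linear part -x is expanded exactly. Above it the slope is zero, and a
step that crosses the level loses at most the squared relative change. -/
theorem truncLog_step (hη : 0 < η) (hv : 0 < v) (hw : v / 3 ≤ w) :
    max (v⁻¹ - η⁻¹) 0 * (w - v) - ((w - v) / v) ^ 2 ≤ truncLog η w - truncLog η v := by
  have hw0 : 0 < w := by linarith
  rcases le_total η v with h | h
  · have h1 : v⁻¹ - η⁻¹ ≤ 0 := sub_nonpos.2 (inv_anti₀ hη h)
    rw [max_eq_right h1, truncLog_of_ge hη h, zero_mul, zero_sub, sub_zero]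
    rcases le_total η w with h2 | h2
    · rw [truncLog_of_ge hη h2]; exact neg_nonpos.2 (sq_nonneg _)
    · have h3 : (1 : ℝ) / 3 ≤ w / η := by
        rw [le_div_iff₀ hη]; linarith
      have h4 := sub_sq_le_log_one_add (x := w / η - 1) (by linarith)
      rw [add_sub_cancel] at h4
      rw [truncLog_of_le hη h2]
      have h5 : w / η ≤ 1 := (div_le_one hη).2 h2
      have h6 : (w - v) / v ≤ w / η - 1 := by
        rw [sub_div, div_self hv.ne']
        have := div_le_div_of_nonneg_left hw0.le hη h
        linarith
      have h7 : (w / η - 1) ^ 2 ≤ ((w - v) / v) ^ 2 := by nlinarith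
      linarith
  · have h1 : 0 ≤ v⁻¹ - η⁻¹ := sub_nonneg.2 (inv_anti₀ hv h)
    rw [max_eq_left h1, truncLog_of_le hη h]
    have h2 := log_add_one_sub_le_truncLog hη hw0
    have h3 := sub_sq_le_log_one_add (x := (w - v) / v) (by
      rw [sub_div, div_self hv.ne']
      have : (1 : ℝ) / 3 ≤ w / v := by rw [le_div_iff₀ hv]; linarith
      linarith)
    have h4 : 1 + (w - v) / v = w / v := by field_simp; ring
    rw [h4, Real.log_div hw0.ne' hv.ne'] at h3
    rw [Real.log_div hw0.ne' hη.ne'] at h2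
    rw [Real.log_div hv.ne' hη.ne']
    have h5 : (v⁻¹ - η⁻¹) * (w - v) = (w - v) / v - w / η + v / η := by
      field_simp
      ring
    linarith

end Scalar

/-! ### Scalar consequences of the stepsize safeguard. -/

section StepScalar

variable {M v α β e b s Δ : ℝ}

/-- The safeguard keeps the step within the curvature radius √(α / M), so the quadratic Taylor term
is controlled by the linear quantity s √(M α). -/
theorem smooth_mul_sq_le (hM : 0 ≤ M) (hα : 0 < α) (hβ : 0 ≤ β) (hs : 0 ≤ s)
    (hsle : s * (√(M * α) + 2 * β) ≤ α) : M * s ^ 2 ≤ s * √(M * α) ∧ s * √(M * α) ≤ α := by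
  have hr := Real.sqrt_nonneg (M * α)
  have hr2 : √(M * α) ^ 2 = M * α := Real.sq_sqrt (by positivity)
  have h1 : s * √(M * α) ≤ α := by nlinarith [mul_nonneg hs hβ]
  refine ⟨?_, h1⟩
  have h2 : (s * √(M * α)) ^ 2 = M * s ^ 2 * α := by rw [mul_pow, hr2]; ring
  have h3 : 0 ≤ s * √(M * α) := mul_nonneg hs hr
  refine le_of_mul_le_mul_right ?_ hα
  rw [← h2]
  nlinarith

/-- A step obeying the safeguard changes a constraint value by at most a fixed fraction. -/
theorem abs_change_le (hM : 0 ≤ M) (hv : 0 < v) (hα : |α - v| ≤ v / 20) (hβ : 0 ≤ β)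
    (he2 : e ^ 2 ≤ M * v / 200) (hb : |b| ≤ β + e) (hs : 0 ≤ s)
    (hsle : s * (√(M * α) + 2 * β) ≤ α) (hΔ : |Δ - s * b| ≤ M * (s ^ 2 / 2)) :
    |Δ| ≤ 2 / 3 * v := by
  have hα' := abs_le.1 hα
  have hα0 : 0 < α := by linarith
  obtain ⟨h1, h2⟩ := smooth_mul_sq_le hM hα0 hβ hs hsle
  have h3 : |Δ| ≤ s * |b| + M * (s ^ 2 / 2) := by
    have := abs_sub_abs_le_abs_sub Δ (s * b)
    rw [abs_mul, abs_of_nonneg hs] at this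
    linarith
  -- As M s² ≤ α ≤ 21 v / 20, the square of s e is at most 21 v² / 4000 ≤ (3 v / 40)². The other
  -- contributions, s β + s √(M α) / 2, total at most α / 2, so the change is at most 3 v / 5.
  have h4 : s * e ≤ 3 / 40 * v := by
    refine abs_le_of_sq_le_sq' ?_ (by positivity) |>.2
    rw [mul_pow]
    have h5 : M * s ^ 2 ≤ α := h1.trans h2
    have h6 : s ^ 2 * e ^ 2 ≤ s ^ 2 * (M * v / 200) := mul_le_mul_of_nonneg_left he2 (sq_nonneg s)
    nlinarith
  have h7 : s * |b| ≤ s * (β + e) := mul_le_mul_of_nonneg_left hb hs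
  nlinarith

/-- Everything is expressed through the summands of the local smoothness constant. The factor 14/25
is dictated by the slope term, 4 (21/20)² = 4.41 against 8 · 14/25 = 4.48; the curvature terms have
much room. -/
theorem second_order_le (hM : 0 ≤ M) (hv : 0 < v) (hα : |α - v| ≤ v / 20) (hβ : 0 ≤ β)
    (he2 : e ^ 2 ≤ M * v / 200) (hb : |b| ≤ β + e) (hs : 0 ≤ s)
    (hsle : s * (√(M * α) + 2 * β) ≤ α) (hΔ : |Δ - s * b| ≤ M * (s ^ 2 / 2)) :
    M * (s ^ 2 / 2) / v + (Δ / v) ^ 2 ≤ 14 / 25 * s ^ 2 * (10 * M / α + 8 * (β ^ 2 / α ^ 2)) := by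
  have hα' := abs_le.1 hα
  have hα0 : 0 < α := by linarith
  obtain ⟨h1, h2⟩ := smooth_mul_sq_le hM hα0 hβ hs hsle
  have hsM : 0 ≤ M * s ^ 2 := by positivity
  have hb2 : b ^ 2 ≤ 2 * β ^ 2 + 2 * e ^ 2 := by
    rw [← sq_abs b]
    nlinarith [abs_nonneg b, sq_nonneg (β - e)]
  have hΔ2 : Δ ^ 2 ≤ 4 * s ^ 2 * β ^ 2 + 4 * s ^ 2 * e ^ 2 + M * s ^ 2 * α / 2 := by
    have h3 : Δ ^ 2 ≤ 2 * (s * b) ^ 2 + 2 * (Δ - s * b) ^ 2 := by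
      nlinarith [sq_nonneg (Δ - 2 * (s * b))]
    have h4 : (Δ - s * b) ^ 2 ≤ (M * (s ^ 2 / 2)) ^ 2 := by
      rw [← sq_abs (Δ - s * b)]
      exact pow_le_pow_left₀ (abs_nonneg _) hΔ 2
    have h5 : (M * (s ^ 2 / 2)) ^ 2 ≤ M * s ^ 2 * α / 4 := by
      have := mul_le_mul_of_nonneg_left (h1.trans h2) hsM
      nlinarith
    have h6 : s ^ 2 * b ^ 2 ≤ s ^ 2 * (2 * β ^ 2 + 2 * e ^ 2) :=
      mul_le_mul_of_nonneg_left hb2 (sq_nonneg s)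
    nlinarith
  have hinv : v⁻¹ ≤ 21 / 20 * α⁻¹ := by
    rw [← div_eq_mul_inv, le_div_iff₀ hα0, ← div_eq_inv_mul, div_le_iff₀ hv]
    linarith
  have hv0 : 0 < v⁻¹ := inv_pos.2 hv
  have hα0' : 0 < α⁻¹ := inv_pos.2 hα0
  have hinv2 : v⁻¹ ^ 2 ≤ 441 / 400 * α⁻¹ ^ 2 := by
    have := pow_le_pow_left₀ hv0.le hinv 2
    rw [mul_pow] at this
    linarith
  have hA : 4 * s ^ 2 * β ^ 2 * v⁻¹ ^ 2 ≤ 4 * s ^ 2 * β ^ 2 * (441 / 400 * α⁻¹ ^ 2) :=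
    mul_le_mul_of_nonneg_left hinv2 (by positivity)
  have hB : 4 * s ^ 2 * e ^ 2 * v⁻¹ ^ 2 ≤ M * s ^ 2 / 50 * (21 / 20 * α⁻¹) := by
    calc 4 * s ^ 2 * e ^ 2 * v⁻¹ ^ 2 ≤ 4 * s ^ 2 * (M * v / 200) * v⁻¹ ^ 2 := by gcongr
      _ = M * s ^ 2 / 50 * v⁻¹ := by field_simp; ring
      _ ≤ _ := mul_le_mul_of_nonneg_left hinv (by positivity)
  have hC : M * s ^ 2 * α / 2 * v⁻¹ ^ 2 ≤ M * s ^ 2 / 2 * (441 / 400 * α⁻¹) := by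
    calc M * s ^ 2 * α / 2 * v⁻¹ ^ 2 ≤ M * s ^ 2 * α / 2 * (441 / 400 * α⁻¹ ^ 2) := by gcongr
      _ = _ := by field_simp
  have hD : M * (s ^ 2 / 2) * v⁻¹ ≤ M * (s ^ 2 / 2) * (21 / 20 * α⁻¹) :=
    mul_le_mul_of_nonneg_left hinv (by positivity)
  have hE : Δ ^ 2 * v⁻¹ ^ 2
      ≤ (4 * s ^ 2 * β ^ 2 + 4 * s ^ 2 * e ^ 2 + M * s ^ 2 * α / 2) * v⁻¹ ^ 2 :=
    mul_le_mul_of_nonneg_right hΔ2 (by positivity)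
  have hF : 0 ≤ M * s ^ 2 * α⁻¹ := by positivity
  have hG : 0 ≤ s ^ 2 * β ^ 2 * α⁻¹ ^ 2 := by positivity
  rw [div_pow, div_eq_mul_inv (Δ ^ 2), ← inv_pow, div_eq_mul_inv _ v, div_eq_mul_inv _ α,
    div_eq_mul_inv _ (α ^ 2), ← inv_pow]
  nlinarith

end StepScalar

/-! ### Feasibility along a segment. -/

namespace CMDP

variable {S : Type u} {A : Type v} [MeasurableSpace S] [MeasurableSpace A] {m : ℕ} {γ : ℝ} {d : ℕ}
  {𝓜 : CMDP S A m γ} {𝓟 : PolicyClass S A d}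

/-- A segment along which the constraint values cannot drop abruptly stays strictly feasible. -/
theorem segment_strictlyFeasible {θ w : EuclideanSpace ℝ (Fin d)}
    (hθ : θ ∈ 𝓜.strictlyFeasible 𝓟) {h : ℝ}
    (hstep : ∀ s ∈ Set.Icc 0 h, (∀ r ∈ Set.Icc 0 s, θ + r • w ∈ 𝓜.strictlyFeasible 𝓟) →
      ∀ i : Fin m, 𝓜.V 𝓟 i.succ θ / 3 ≤ 𝓜.V 𝓟 i.succ (θ + s • w)) :
    ∀ s ∈ Set.Icc 0 h, θ + s • w ∈ 𝓜.strictlyFeasible 𝓟 := by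
  have hc : Continuous fun s : ℝ => θ + s • w := by fun_prop
  by_contra! hne
  obtain ⟨s₁, hs₁, hs₁'⟩ := hne
  -- The infeasible times form a compact set; its least element is the first exit time. Before that
  -- time every constraint keeps a third of its initial value, and continuity carries this to the
  -- exit time, where feasibility would hold after all.
  have hK : IsCompact (Set.Icc 0 h ∩ (fun s : ℝ => θ + s • w) ⁻¹' (𝓜.strictlyFeasible 𝓟)ᶜ) :=
    isCompact_Icc.inter_right (isOpen_strictlyFeasible.isClosed_compl.preimage hc)
  obtain ⟨s₀, ⟨hs₀, hbad⟩, hmin⟩ := hK.exists_isLeast ⟨s₁, hs₁, hs₁'⟩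
  have hpos : 0 < s₀ := by
    refine lt_of_le_of_ne hs₀.1 fun h0 => hbad ?_
    simp only [← h0, zero_smul, add_zero]
    exact hθ
  have hgood : ∀ s ∈ Set.Ico 0 s₀, θ + s • w ∈ 𝓜.strictlyFeasible 𝓟 := fun s hs => by
    by_contra hns
    exact absurd (hmin ⟨⟨hs.1, hs.2.le.trans hs₀.2⟩, hns⟩) (not_le.2 hs.2)
  refine hbad fun i => ?_
  have hcl : IsClosed {s : ℝ | 𝓜.V 𝓟 i.succ θ / 3 ≤ 𝓜.V 𝓟 i.succ (θ + s • w)} :=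
    isClosed_le continuous_const ((𝓜.continuous_V 𝓟 i.succ).comp hc)
  have hsub : Set.Ico 0 s₀ ⊆ {s : ℝ | 𝓜.V 𝓟 i.succ θ / 3 ≤ 𝓜.V 𝓟 i.succ (θ + s • w)} :=
    fun s hs => hstep s ⟨hs.1, hs.2.le.trans hs₀.2⟩
      (fun r hr => hgood r ⟨hr.1, hr.2.trans_lt hs.2⟩) i
  have hmem := hcl.closure_subset_iff.2 hsub
    (by rw [closure_Ico hpos.ne]; exact ⟨hpos.le, le_rfl⟩)
  have h2 : 0 < 𝓜.V 𝓟 i.succ θ / 3 := div_pos (hθ i) three_pos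
  exact h2.trans_le hmem

end CMDP

/-! ### Barrier, potential and the effect of one step. -/

namespace CMDP

variable {S : Type u} {A : Type v} [MeasurableSpace S] [MeasurableSpace A] {m : ℕ} {γ : ℝ} {d : ℕ}

/-- The log barrier function `V_0 + η ∑ᵢ log V_i`. -/
noncomputable def barrier (𝓜 : CMDP S A m γ) (𝓟 : PolicyClass S A d) (η : ℝ)
    (θ : EuclideanSpace ℝ (Fin d)) : ℝ :=
  𝓜.V 𝓟 0 θ + η * ∑ i : Fin m, Real.log (𝓜.V 𝓟 i.succ θ)

/-- The sum of the truncated logarithms of the constraint values. -/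
noncomputable def potential (𝓜 : CMDP S A m γ) (𝓟 : PolicyClass S A d) (η : ℝ)
    (θ : EuclideanSpace ℝ (Fin d)) : ℝ :=
  ∑ i : Fin m, truncLog η (𝓜.V 𝓟 i.succ θ)

/-- The gradient of the potential. -/
noncomputable def potentialGrad (𝓜 : CMDP S A m γ) (𝓟 : PolicyClass S A d) (η : ℝ)
    (θ : EuclideanSpace ℝ (Fin d)) : EuclideanSpace ℝ (Fin d) :=
  ∑ i : Fin m, max ((𝓜.V 𝓟 i.succ θ)⁻¹ - η⁻¹) 0 • gradient (𝓜.V 𝓟 i.succ) θ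

end CMDP

namespace LBSGD

variable {S : Type u} {A : Type v} [MeasurableSpace S] [MeasurableSpace A] {m : ℕ} {γ : ℝ} {d : ℕ}
  {𝓜 : CMDP S A m γ} {𝓟 : PolicyClass S A d} {p : LBParams} {θ : EuclideanSpace ℝ (Fin d)}
  {b : Batch S A p}

/-- The accuracy of the estimates which one step of the algorithm relies on. -/
structure StepAccurate (𝓜 : CMDP S A m γ) (𝓟 : PolicyClass S A d) (p : LBParams)
    (θ : EuclideanSpace ℝ (Fin d)) (b : Batch S A p) : Prop where
  lower : ∀ i : Fin m, |lowerValue 𝓜 p i b - 𝓜.V 𝓟 i.succ θ| ≤ 𝓜.V 𝓟 i.succ θ / 20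
  slope : ∃ e : ℝ, ∀ i : Fin m, e ^ 2 ≤ smoothConst γ p.Mg p.Mh * 𝓜.V 𝓟 i.succ θ / 200 ∧
    |inner ℝ (gradient (𝓜.V 𝓟 i.succ) θ)
      (‖barrierGradEst 𝓜 𝓟 p θ b‖⁻¹ • barrierGradEst 𝓜 𝓟 p θ b)| ≤ |upperSlope 𝓜 𝓟 p θ i b| + e
  grad : ‖barrierGradEst 𝓜 𝓟 p θ b - 𝓜.barrierGrad 𝓟 p.η θ‖ ≤ p.η / 100

theorem StepAccurate.lower_pos (h : StepAccurate 𝓜 𝓟 p θ b) (hθ : θ ∈ 𝓜.strictlyFeasible 𝓟)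
    (i : Fin m) : 0 < lowerValue 𝓜 p i b := by
  have := (abs_le.1 (h.lower i)).1
  have : 0 < 𝓜.V 𝓟 i.succ θ := hθ i
  linarith

theorem smoothConst_pos (𝓜 : CMDP S A m γ) {Mg Mh : ℝ} (hMg : 0 < Mg) (hMh : 0 < Mh) :
    0 < smoothConst γ Mg Mh := by
  have := 𝓜.one_sub_pos
  rw [smoothConst]; positivity

theorem localSmooth_pos (hMg : 0 < p.Mg) (hMh : 0 < p.Mh) (hη : 0 < p.η)
    (hα : ∀ i : Fin m, 0 < lowerValue 𝓜 p i b) : 0 < localSmooth 𝓜 𝓟 p θ b := by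
  have hM := smoothConst_pos 𝓜 hMg hMh
  have h1 : 0 ≤ ∑ i : Fin m, 10 * smoothConst γ p.Mg p.Mh * p.η / lowerValue 𝓜 p i b :=
    Finset.sum_nonneg fun i _ => by have := hα i; positivity
  have h2 : 0 ≤ ∑ i : Fin m, upperSlope 𝓜 𝓟 p θ i b ^ 2 / lowerValue 𝓜 p i b ^ 2 :=
    Finset.sum_nonneg fun i _ => by have := hα i; positivity
  rw [localSmooth]; positivity

theorem stepSize_nonneg (hMg : 0 < p.Mg) (hMh : 0 < p.Mh) (hη : 0 < p.η)
    (hα : ∀ i : Fin m, 0 < lowerValue 𝓜 p i b) : 0 ≤ stepSize 𝓜 𝓟 p θ b := by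
  have hM := smoothConst_pos 𝓜 hMg hMh
  refine le_min (one_div_pos.2 (localSmooth_pos hMg hMh hη hα)).le
    (mul_nonneg (Real.iInf_nonneg fun i => ?_) (by positivity))
  have := hα i
  positivity

theorem stepSize_mul_norm_le (hMg : 0 < p.Mg) (hMh : 0 < p.Mh)
    (hα : ∀ i : Fin m, 0 < lowerValue 𝓜 p i b) (hg : 0 < ‖barrierGradEst 𝓜 𝓟 p θ b‖) (i : Fin m) :
    stepSize 𝓜 𝓟 p θ b * ‖barrierGradEst 𝓜 𝓟 p θ b‖
      * (√(smoothConst γ p.Mg p.Mh * lowerValue 𝓜 p i b) + 2 * |upperSlope 𝓜 𝓟 p θ i b|)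
      ≤ lowerValue 𝓜 p i b := by
  have hM := smoothConst_pos 𝓜 hMg hMh
  have hpos : 0 < √(smoothConst γ p.Mg p.Mh * lowerValue 𝓜 p i b)
      + 2 * |upperSlope 𝓜 𝓟 p θ i b| :=
    add_pos_of_pos_of_nonneg (Real.sqrt_pos.2 (mul_pos hM (hα i))) (by positivity)
  rw [← le_div_iff₀ hpos, ← le_div_iff₀ hg]
  refine (min_le_right _ _).trans ?_
  rw [mul_one_div]
  refine div_le_div_of_nonneg_right (ciInf_le (Set.finite_range _).bddBelow i) hg.le

theorem stepSize_mul_localSmooth_le (hMg : 0 < p.Mg) (hMh : 0 < p.Mh) (hη : 0 < p.η)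
    (hα : ∀ i : Fin m, 0 < lowerValue 𝓜 p i b) :
    stepSize 𝓜 𝓟 p θ b * localSmooth 𝓜 𝓟 p θ b ≤ 1 := by
  rw [← le_div_iff₀ (localSmooth_pos hMg hMh hη hα)]
  exact min_le_left _ _

/-- The quantitative effect of one step. -/
theorem StepAccurate.step (h : StepAccurate 𝓜 𝓟 p θ b) (hB : 𝓜.BoundedScore 𝓟 p.Mg p.Mh)
    (hMg : 0 < p.Mg) (hMh : 0 < p.Mh) (hη : 0 < p.η) (hθ : θ ∈ 𝓜.strictlyFeasible 𝓟)
    (hg : p.η / 2 < ‖barrierGradEst 𝓜 𝓟 p θ b‖) {θ' : EuclideanSpace ℝ (Fin d)}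
    (hθ' : θ' = θ + stepSize 𝓜 𝓟 p θ b • barrierGradEst 𝓜 𝓟 p θ b) :
    (∀ i : Fin m, 𝓜.V 𝓟 i.succ θ / 3 ≤ 𝓜.V 𝓟 i.succ θ') ∧
    2 / 5 * stepSize 𝓜 𝓟 p θ b * ‖barrierGradEst 𝓜 𝓟 p θ b‖ ^ 2
      ≤ 𝓜.barrier 𝓟 p.η θ' - 𝓜.barrier 𝓟 p.η θ ∧
    stepSize 𝓜 𝓟 p θ b * (inner ℝ (p.η • 𝓜.potentialGrad 𝓟 p.η θ) (barrierGradEst 𝓜 𝓟 p θ b)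
        - 14 / 25 * ‖barrierGradEst 𝓜 𝓟 p θ b‖ ^ 2)
      ≤ p.η * (𝓜.potential 𝓟 p.η θ' - 𝓜.potential 𝓟 p.η θ) := by
  have hα := h.lower_pos hθ
  have hV : ∀ i : Fin m, 0 < 𝓜.V 𝓟 i.succ θ := hθ
  obtain ⟨e, he⟩ := h.slope
  have hM := smoothConst_pos 𝓜 hMg hMh
  have hg0 : 0 < ‖barrierGradEst 𝓜 𝓟 p θ b‖ := by linarith
  have hγt := stepSize_nonneg (𝓟 := 𝓟) (θ := θ) hMg hMh hη hα
  have hlen := stepSize_mul_norm_le (𝓟 := 𝓟) (θ := θ) hMg hMh hα hg0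
  have hloc := stepSize_mul_localSmooth_le (𝓟 := 𝓟) (θ := θ) hMg hMh hη hα
  have hgrad := h.grad
  have hlow := h.lower
  set M := smoothConst γ p.Mg p.Mh with hMdef
  set q := barrierGradEst 𝓜 𝓟 p θ b with hq
  set w := ‖q‖⁻¹ • q with hw
  set τ := stepSize 𝓜 𝓟 p θ b with hτ
  set r := τ * ‖q‖ with hr
  have hr0 : 0 ≤ r := by positivity
  have hw1 : ‖w‖ = 1 := by rw [hw, norm_smul, norm_inv, norm_norm, inv_mul_cancel₀ hg0.ne']
  have hrw : r • w = τ • q := by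
    rw [hr, hw, smul_smul, mul_assoc, mul_inv_cancel₀ hg0.ne', mul_one]
  have hqw : q = ‖q‖ • w := by rw [hw, smul_smul, mul_inv_cancel₀ hg0.ne', one_smul]
  have hsub : ∀ s ∈ Set.Icc 0 r, ∀ i : Fin m,
      s * (√(M * lowerValue 𝓜 p i b) + 2 * |upperSlope 𝓜 𝓟 p θ i b|) ≤ lowerValue 𝓜 p i b :=
    fun s hs i => (mul_le_mul_of_nonneg_right hs.2 (by positivity)).trans (hlen i)
  -- The Taylor bound needs a feasible segment and feasibility needs the Taylor bound; the
  -- first-exit argument breaks the circle.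
  have hseg : ∀ s ∈ Set.Icc 0 r, θ + s • w ∈ 𝓜.strictlyFeasible 𝓟 := by
    refine CMDP.segment_strictlyFeasible hθ fun s hs hall i => ?_
    have h1 := hB.abs_V_taylor_le hw1.le hs.1 hall i.succ
    have h2 := abs_change_le hM.le (hV i) (hlow i) (abs_nonneg _) (he i).1 (he i).2 hs.1
      (hsub s hs i) h1
    linarith [(abs_le.1 h2).1]
  have htay := hB.abs_V_taylor_le hw1.le hr0 hseg
  rw [hrw, ← hθ'] at htay
  have hr' : r ∈ Set.Icc 0 r := ⟨hr0, le_rfl⟩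
  have hch : ∀ i : Fin m, |𝓜.V 𝓟 i.succ θ' - 𝓜.V 𝓟 i.succ θ| ≤ 2 / 3 * 𝓜.V 𝓟 i.succ θ := fun i =>
    abs_change_le hM.le (hV i) (hlow i) (abs_nonneg _) (he i).1 (he i).2 hr0
      (hsub r hr' i) (htay i.succ)
  have hthird : ∀ i : Fin m, 𝓜.V 𝓟 i.succ θ / 3 ≤ 𝓜.V 𝓟 i.succ θ' := fun i => by
    linarith [(abs_le.1 (hch i)).1]
  have hsec : ∀ i : Fin m, M * (r ^ 2 / 2) / 𝓜.V 𝓟 i.succ θ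
      + ((𝓜.V 𝓟 i.succ θ' - 𝓜.V 𝓟 i.succ θ) / 𝓜.V 𝓟 i.succ θ) ^ 2
      ≤ 14 / 25 * r ^ 2 * (10 * M / lowerValue 𝓜 p i b
        + 8 * (upperSlope 𝓜 𝓟 p θ i b ^ 2 / lowerValue 𝓜 p i b ^ 2)) := fun i => by
    have := second_order_le hM.le (hV i) (hlow i) (abs_nonneg _) (he i).1 (he i).2 hr0
      (hsub r hr' i) (htay i.succ)
    rwa [sq_abs] at this
  -- All second-order losses, including that of the objective, add up to at most 14/25 of r² times
  -- the local smoothness, and the stepsize is at most the inverse of the latter.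
  have hsecsum : M * (r ^ 2 / 2) + p.η * ∑ i : Fin m, (M * (r ^ 2 / 2) / 𝓜.V 𝓟 i.succ θ
      + ((𝓜.V 𝓟 i.succ θ' - 𝓜.V 𝓟 i.succ θ) / 𝓜.V 𝓟 i.succ θ) ^ 2) ≤ 14 / 25 * (τ * ‖q‖ ^ 2) := by
    have h1 := mul_le_mul_of_nonneg_left (Finset.sum_le_sum fun i
      (_ : i ∈ (Finset.univ : Finset (Fin m))) => hsec i) hη.le
    have h2 : M * (r ^ 2 / 2) + p.η * ∑ i : Fin m, 14 / 25 * r ^ 2 * (10 * M / lowerValue 𝓜 p i b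
        + 8 * (upperSlope 𝓜 𝓟 p θ i b ^ 2 / lowerValue 𝓜 p i b ^ 2))
        ≤ 14 / 25 * r ^ 2 * localSmooth 𝓜 𝓟 p θ b := by
      rw [← Finset.mul_sum, Finset.sum_add_distrib, ← Finset.mul_sum, localSmooth, ← hMdef]
      have h3 : ∑ i : Fin m, 10 * M * p.η / lowerValue 𝓜 p i b
          = p.η * ∑ i : Fin m, 10 * M / lowerValue 𝓜 p i b := by
        rw [Finset.mul_sum]
        exact Finset.sum_congr rfl fun i _ => by ring
      rw [h3]
      have h4 : 0 ≤ M * r ^ 2 := by positivity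
      nlinarith
    have h3 : r ^ 2 * localSmooth 𝓜 𝓟 p θ b ≤ τ * ‖q‖ ^ 2 := by
      have : r ^ 2 * localSmooth 𝓜 𝓟 p θ b
          = τ * ‖q‖ ^ 2 * (τ * localSmooth 𝓜 𝓟 p θ b) := by rw [hr]; ring
      rw [this]
      exact mul_le_of_le_one_right (by positivity) hloc
    linarith
  have hdir : ∀ G : EuclideanSpace ℝ (Fin d), τ * inner ℝ G q = r * inner ℝ G w := fun G => by
    conv_lhs => rw [hqw, real_inner_smul_right]
    rw [hr]; ring
  refine ⟨hthird, ?_, ?_⟩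
  · have hlog : ∀ i : Fin m, r * inner ℝ ((𝓜.V 𝓟 i.succ θ)⁻¹ • gradient (𝓜.V 𝓟 i.succ) θ) w
        - (M * (r ^ 2 / 2) / 𝓜.V 𝓟 i.succ θ
          + ((𝓜.V 𝓟 i.succ θ' - 𝓜.V 𝓟 i.succ θ) / 𝓜.V 𝓟 i.succ θ) ^ 2)
        ≤ Real.log (𝓜.V 𝓟 i.succ θ') - Real.log (𝓜.V 𝓟 i.succ θ) := fun i => by
      have hv := hV i
      have hv' : 0 < 𝓜.V 𝓟 i.succ θ' := by linarith [hthird i]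
      have h1 := sub_sq_le_log_one_add
        (x := (𝓜.V 𝓟 i.succ θ' - 𝓜.V 𝓟 i.succ θ) / 𝓜.V 𝓟 i.succ θ) (by
          rw [le_div_iff₀ hv]; linarith [hthird i])
      have h2 : 1 + (𝓜.V 𝓟 i.succ θ' - 𝓜.V 𝓟 i.succ θ) / 𝓜.V 𝓟 i.succ θ
          = 𝓜.V 𝓟 i.succ θ' / 𝓜.V 𝓟 i.succ θ := by field_simp; ring
      rw [h2, Real.log_div hv'.ne' hv.ne'] at h1
      have h3 : r * inner ℝ (gradient (𝓜.V 𝓟 i.succ) θ) w / 𝓜.V 𝓟 i.succ θ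
          ≤ (𝓜.V 𝓟 i.succ θ' - 𝓜.V 𝓟 i.succ θ) / 𝓜.V 𝓟 i.succ θ
            + M * (r ^ 2 / 2) / 𝓜.V 𝓟 i.succ θ := by
        rw [← add_div]
        exact div_le_div_of_nonneg_right (by linarith [(abs_le.1 (htay i.succ)).1]) hv.le
      have h4 : r * inner ℝ ((𝓜.V 𝓟 i.succ θ)⁻¹ • gradient (𝓜.V 𝓟 i.succ) θ) w
          = r * inner ℝ (gradient (𝓜.V 𝓟 i.succ) θ) w / 𝓜.V 𝓟 i.succ θ := by
        rw [real_inner_smul_left, div_eq_inv_mul]; ring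
      rw [h4]
      linarith
    have h1 := mul_le_mul_of_nonneg_left (Finset.sum_le_sum fun i
      (_ : i ∈ (Finset.univ : Finset (Fin m))) => hlog i) hη.le
    rw [Finset.sum_sub_distrib, Finset.sum_sub_distrib, ← Finset.mul_sum, ← sum_inner] at h1
    have h2 : r * inner ℝ (𝓜.barrierGrad 𝓟 p.η θ) w = r * inner ℝ (gradient (𝓜.V 𝓟 0) θ) w
        + p.η * (r * inner ℝ (∑ i : Fin m, (𝓜.V 𝓟 i.succ θ)⁻¹ • gradient (𝓜.V 𝓟 i.succ) θ) w) := by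
      rw [CMDP.barrierGrad, inner_add_left, real_inner_smul_left]; ring
    have h3 := (abs_le.1 (htay 0)).1
    rw [← hdir] at h2
    -- The gradient error is at most η / 100, and η is below 2 ‖q‖ because the algorithm did not
    -- stop. Then 49/50 - 14/25 = 21/50 leaves the claimed 2/5.
    have h4 : 49 / 50 * ‖q‖ ^ 2 ≤ inner ℝ (𝓜.barrierGrad 𝓟 p.η θ) q := by
      have h5 := real_inner_le_norm (q - 𝓜.barrierGrad 𝓟 p.η θ) q
      rw [inner_sub_left, real_inner_self_eq_norm_sq] at h5
      nlinarith
    have h6 := mul_le_mul_of_nonneg_left h4 hγt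
    have h7 : 0 ≤ τ * ‖q‖ ^ 2 := by positivity
    rw [CMDP.barrier, CMDP.barrier]
    linarith
  · have hphi : ∀ i : Fin m, r * inner ℝ (max ((𝓜.V 𝓟 i.succ θ)⁻¹ - p.η⁻¹) 0
          • gradient (𝓜.V 𝓟 i.succ) θ) w
        - (M * (r ^ 2 / 2) / 𝓜.V 𝓟 i.succ θ
          + ((𝓜.V 𝓟 i.succ θ' - 𝓜.V 𝓟 i.succ θ) / 𝓜.V 𝓟 i.succ θ) ^ 2)
        ≤ truncLog p.η (𝓜.V 𝓟 i.succ θ') - truncLog p.η (𝓜.V 𝓟 i.succ θ) := fun i => by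
      have hv := hV i
      have h1 := truncLog_step hη hv (hthird i)
      set z := max ((𝓜.V 𝓟 i.succ θ)⁻¹ - p.η⁻¹) 0 with hz
      have hz0 : 0 ≤ z := le_max_right _ _
      have hz1 : z ≤ (𝓜.V 𝓟 i.succ θ)⁻¹ :=
        max_le (sub_le_self _ (inv_pos.2 hη).le) (inv_pos.2 hv).le
      have h2 : z * (r * inner ℝ (gradient (𝓜.V 𝓟 i.succ) θ) w - M * (r ^ 2 / 2))
          ≤ z * (𝓜.V 𝓟 i.succ θ' - 𝓜.V 𝓟 i.succ θ) :=
        mul_le_mul_of_nonneg_left (by linarith [(abs_le.1 (htay i.succ)).1]) hz0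
      have h3 : z * (M * (r ^ 2 / 2)) ≤ M * (r ^ 2 / 2) / 𝓜.V 𝓟 i.succ θ := by
        rw [div_eq_inv_mul (M * (r ^ 2 / 2))]
        exact mul_le_mul_of_nonneg_right hz1 (by positivity)
      rw [real_inner_smul_left]
      linarith
    have h1 := mul_le_mul_of_nonneg_left (Finset.sum_le_sum fun i
      (_ : i ∈ (Finset.univ : Finset (Fin m))) => hphi i) hη.le
    rw [Finset.sum_sub_distrib, Finset.sum_sub_distrib, ← Finset.mul_sum, ← sum_inner] at h1
    have h2 : 0 ≤ M * (r ^ 2 / 2) := by positivity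
    rw [real_inner_smul_left, CMDP.potentialGrad, CMDP.potential, CMDP.potential, mul_sub,
      mul_left_comm, hdir]
    linarith

/-- If some constraint value is below `c η`, the potential does not decrease. -/
theorem StepAccurate.potential_le (h : StepAccurate 𝓜 𝓟 p θ b) (hB : 𝓜.BoundedScore 𝓟 p.Mg p.Mh)
    (hMg : 0 < p.Mg) (hMh : 0 < p.Mh) (hη : 0 < p.η) (hθ : θ ∈ 𝓜.strictlyFeasible 𝓟)
    (hg : p.η / 2 < ‖barrierGradEst 𝓜 𝓟 p θ b‖) {νemf ℓ c : ℝ} (hℓ : 0 < ℓ)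
    (hℓL : ℓ ≤ lipConst γ p.Mg) (hc : 0 < c) (hc' : ℓ / c = 5 * (m + 2) * lipConst γ p.Mg)
    (hην : p.η ≤ νemf) (hE : 𝓜.ExtendedMFCQ 𝓟 νemf ℓ)
    {j : Fin m} (hj : 𝓜.V 𝓟 j.succ θ ≤ c * p.η) {θ' : EuclideanSpace ℝ (Fin d)}
    (hθ' : θ' = θ + stepSize 𝓜 𝓟 p θ b • barrierGradEst 𝓜 𝓟 p θ b) :
    𝓜.potential 𝓟 p.η θ ≤ 𝓜.potential 𝓟 p.η θ' := by
  have hV : ∀ i : Fin m, 0 < 𝓜.V 𝓟 i.succ θ := hθ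
  have hstep := (h.step hB hMg hMh hη hθ hg hθ').2.2
  have hγt := stepSize_nonneg (𝓟 := 𝓟) (θ := θ) hMg hMh hη (h.lower_pos hθ)
  have hgrad := h.grad
  have hG := hB.norm_gradient_V_le hθ
  have hL : 0 < lipConst γ p.Mg := hℓ.trans_le hℓL
  set L := lipConst γ p.Mg with hLdef
  set q := barrierGradEst 𝓜 𝓟 p θ b with hq
  set g := 𝓜.barrierGrad 𝓟 p.η θ with hgdef
  set P := 𝓜.potentialGrad 𝓟 p.η θ with hP
  -- The weights of constraint i in the two gradients differ by η times the minimum of 1 / V i and 1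
  -- / η, which is at most 1.
  have hrem : ‖g - p.η • P‖ ≤ (m + 1) * L := by
    have h1 : g - p.η • P = gradient (𝓜.V 𝓟 0) θ + ∑ i : Fin m, (p.η * ((𝓜.V 𝓟 i.succ θ)⁻¹
        - max ((𝓜.V 𝓟 i.succ θ)⁻¹ - p.η⁻¹) 0)) • gradient (𝓜.V 𝓟 i.succ) θ := by
      rw [hgdef, hP, CMDP.barrierGrad, CMDP.potentialGrad, add_sub_assoc, ← smul_sub,
        ← Finset.sum_sub_distrib, Finset.smul_sum]
      simp_rw [← sub_smul, smul_smul]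
    have h2 : ∀ i ∈ (Finset.univ : Finset (Fin m)), ‖(p.η * ((𝓜.V 𝓟 i.succ θ)⁻¹
        - max ((𝓜.V 𝓟 i.succ θ)⁻¹ - p.η⁻¹) 0)) • gradient (𝓜.V 𝓟 i.succ) θ‖ ≤ L := fun i _ => by
      have h3 : 0 < (𝓜.V 𝓟 i.succ θ)⁻¹ := inv_pos.2 (hV i)
      have h4 : max ((𝓜.V 𝓟 i.succ θ)⁻¹ - p.η⁻¹) 0 ≤ (𝓜.V 𝓟 i.succ θ)⁻¹ :=
        max_le (sub_le_self _ (inv_pos.2 hη).le) h3.le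
      have h5 := le_max_left ((𝓜.V 𝓟 i.succ θ)⁻¹ - p.η⁻¹) 0
      have h6 : p.η * ((𝓜.V 𝓟 i.succ θ)⁻¹ - max ((𝓜.V 𝓟 i.succ θ)⁻¹ - p.η⁻¹) 0) ≤ 1 := by
        rw [← mul_inv_cancel₀ hη.ne']
        exact mul_le_mul_of_nonneg_left (by linarith) hη.le
      rw [norm_smul, Real.norm_of_nonneg (mul_nonneg hη.le (sub_nonneg.2 h4))]
      exact (mul_le_of_le_one_left (norm_nonneg _) h6).trans (hG i.succ)
    rw [h1]
    refine (norm_add_le _ _).trans ((add_le_add (hG 0) (norm_sum_le_of_le _ h2)).trans ?_)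
    rw [Finset.sum_const, Finset.card_univ, Fintype.card_fin, nsmul_eq_mul]
    linarith
  -- Pairing with the MFCQ direction: every active term is nonnegative, and the term of `j` alone
  -- contributes ℓ / c - ℓ after multiplication by η. Constraints above η have weight zero, so
  -- nothing need be known about their gradients.
  have hPn : 5 * (m + 2) * L - ℓ ≤ ‖p.η • P‖ := by
    obtain ⟨s, hs, hsi⟩ := hE θ (CMDP.strictlyFeasible_subset hθ)
    have h1 : ∀ i : Fin m, ℓ * max ((𝓜.V 𝓟 i.succ θ)⁻¹ - p.η⁻¹) 0
        ≤ inner ℝ s (max ((𝓜.V 𝓟 i.succ θ)⁻¹ - p.η⁻¹) 0 • gradient (𝓜.V 𝓟 i.succ) θ) :=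
      fun i => by
        rw [real_inner_smul_right, mul_comm ℓ]
        rcases le_or_gt (𝓜.V 𝓟 i.succ θ) p.η with hi | hi
        · exact mul_le_mul_of_nonneg_left (hsi i (hV i) (hi.trans hην)).le (le_max_right _ _)
        · rw [max_eq_right (sub_nonpos.2 (inv_anti₀ hη hi.le)), zero_mul, zero_mul]
    have h2 := Finset.sum_le_sum fun i (_ : i ∈ (Finset.univ : Finset (Fin m))) => h1 i
    rw [← inner_sum] at h2
    have h3 := Finset.single_le_sum (f := fun i : Fin m =>
      ℓ * max ((𝓜.V 𝓟 i.succ θ)⁻¹ - p.η⁻¹) 0)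
      (fun i _ => mul_nonneg hℓ.le (le_max_right _ _)) (Finset.mem_univ j)
    have h4 : ℓ * ((c * p.η)⁻¹ - p.η⁻¹) ≤ ℓ * max ((𝓜.V 𝓟 j.succ θ)⁻¹ - p.η⁻¹) 0 :=
      mul_le_mul_of_nonneg_left ((sub_le_sub_right (inv_anti₀ (hV j) hj) _).trans
        (le_max_left _ _)) hℓ.le
    have h5 : inner ℝ s P ≤ ‖P‖ := by
      have := real_inner_le_norm s P
      rwa [hs, one_mul] at this
    rw [norm_smul, Real.norm_of_nonneg hη.le, ← hc']
    have h6 : ℓ / c - ℓ = p.η * (ℓ * ((c * p.η)⁻¹ - p.η⁻¹)) := by field_simp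
    rw [h6]
    exact mul_le_mul_of_nonneg_left ((h4.trans h3).trans (h2.trans h5)) hη.le
  have hqP : ‖q - p.η • P‖ ≤ p.η / 100 + (m + 1) * L :=
    (norm_sub_le_norm_sub_add_norm_sub q g _).trans (add_le_add hgrad hrem)
  -- The domination of the potential gradient passes to ‖q‖; the factor 51/50 absorbs η / 100
  -- through η < 2 ‖q‖. Consequently `q` differs from η P by at most 11/25 of its own norm, and 1 -
  -- 11/25 is exactly the second-order factor 14/25.
  have hqn : 4 * (m + 1) * L ≤ 51 / 50 * ‖q‖ := by
    have h1 : ‖p.η • P‖ ≤ ‖q‖ + ‖q - p.η • P‖ := by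
      have := norm_sub_le q (q - p.η • P)
      rwa [sub_sub_cancel] at this
    have h2 : 0 ≤ (m : ℝ) * L := by positivity
    linarith
  have hin : 14 / 25 * ‖q‖ ^ 2 ≤ inner ℝ (p.η • P) q := by
    have h5 := real_inner_le_norm (q - p.η • P) q
    rw [inner_sub_left, real_inner_self_eq_norm_sq] at h5
    have h6 : ‖q - p.η • P‖ ≤ 11 / 25 * ‖q‖ := by linarith
    have h7 := mul_le_mul_of_nonneg_right h6 (norm_nonneg q)
    linarith
  have h8 := (mul_nonneg hγt (sub_nonneg.2 hin)).trans hstep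
  have h9 := nonneg_of_mul_nonneg_right h8 hη
  linarith

end LBSGD

/-! ### The invariant region and the accuracy required in it. -/

namespace LBSGD

variable {S : Type u} {A : Type v} [MeasurableSpace S] [MeasurableSpace A] {m : ℕ} {γ : ℝ} {d : ℕ}
  {𝓜 : CMDP S A m γ} {𝓟 : PolicyClass S A d} {p : LBParams} {θ : EuclideanSpace ℝ (Fin d)}
  {b : Batch S A p} {ℓ : ℝ}

/-- Below `repelRatio * η` a constraint dominates the barrier gradient. -/
noncomputable def repelRatio (m : ℕ) (γ Mg ℓ : ℝ) : ℝ :=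
  ℓ / (5 * (m + 2) * lipConst γ Mg)

/-- The iterates keep all constraint values above `safetyRatio * η`. -/
noncomputable def safetyRatio (m : ℕ) (γ Mg ℓ : ℝ) : ℝ :=
  (repelRatio m γ Mg ℓ / 6) ^ m

theorem lipConst_pos (𝓜 : CMDP S A m γ) {Mg : ℝ} (hMg : 0 < Mg) : 0 < lipConst γ Mg :=
  div_pos hMg (pow_pos 𝓜.one_sub_pos 2)

theorem repelRatio_pos {Mg : ℝ} (hL : 0 < lipConst γ Mg) (hℓ : 0 < ℓ) :
    0 < repelRatio m γ Mg ℓ := by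
  rw [repelRatio]; positivity

theorem repelRatio_le_one {Mg : ℝ} (hL : 0 < lipConst γ Mg) (hℓL : ℓ ≤ lipConst γ Mg) :
    repelRatio m γ Mg ℓ ≤ 1 := by
  rw [repelRatio, div_le_one (by positivity)]
  nlinarith [mul_nonneg (Nat.cast_nonneg (α := ℝ) m) hL.le]

theorem safetyRatio_pos {Mg : ℝ} (hL : 0 < lipConst γ Mg) (hℓ : 0 < ℓ) :
    0 < safetyRatio m γ Mg ℓ :=
  pow_pos (div_pos (repelRatio_pos hL hℓ) (by norm_num)) m

theorem safetyRatio_le_one {Mg : ℝ} (hL : 0 < lipConst γ Mg) (hℓ : 0 < ℓ)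
    (hℓL : ℓ ≤ lipConst γ Mg) : safetyRatio m γ Mg ℓ ≤ 1 := by
  have h1 := repelRatio_pos (m := m) hL hℓ
  have h2 := repelRatio_le_one (m := m) hL hℓL
  exact pow_le_one₀ (by positivity) (by linarith)

/-- The sublevel set of the potential which the iterates never leave. -/
def wellInside (𝓜 : CMDP S A m γ) (𝓟 : PolicyClass S A d) (p : LBParams) (ℓ : ℝ) :
    Set (EuclideanSpace ℝ (Fin d)) :=
  {θ | θ ∈ 𝓜.strictlyFeasible 𝓟 ∧
    m * (Real.log (repelRatio m γ p.Mg ℓ / 3) + 1 - repelRatio m γ p.Mg ℓ / 3)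
      ≤ 𝓜.potential 𝓟 p.η θ}

/-- All summands of the potential are nonpositive, so each one is at least the total, which is at
least m times the level for ratio c / 3. Halving c / 3 absorbs the remaining additive terms. -/
theorem safetyRatio_mul_le (hm : 1 ≤ m) (hMg : 0 < p.Mg) (hη : 0 < p.η) (hℓ : 0 < ℓ)
    (hℓL : ℓ ≤ lipConst γ p.Mg) (hθ : θ ∈ wellInside 𝓜 𝓟 p ℓ) (i : Fin m) :
    safetyRatio m γ p.Mg ℓ * p.η ≤ 𝓜.V 𝓟 i.succ θ := by
  have hL := lipConst_pos 𝓜 hMg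
  have hV : ∀ i : Fin m, 0 < 𝓜.V 𝓟 i.succ θ := hθ.1
  rcases le_total p.η (𝓜.V 𝓟 i.succ θ) with h | h
  · exact (mul_le_of_le_one_left hη.le (safetyRatio_le_one hL hℓ hℓL)).trans h
  · have hc0 := repelRatio_pos (m := m) hL hℓ
    have hc1 := repelRatio_le_one (m := m) hL hℓL
    have h1 : 𝓜.potential 𝓟 p.η θ ≤ truncLog p.η (𝓜.V 𝓟 i.succ θ) := by
      rw [CMDP.potential, ← Finset.add_sum_erase _ _ (Finset.mem_univ i)]
      exact add_le_of_nonpos_right (Finset.sum_nonpos fun j _ => truncLog_nonpos hη (hV j))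
    have h2 := hθ.2.trans h1
    rw [truncLog_of_le hη h] at h2
    rw [← le_div_iff₀ hη]
    have h3 : 0 < 𝓜.V 𝓟 i.succ θ / p.η := div_pos (hV i) hη
    rw [safetyRatio, ← Real.log_le_log_iff (by positivity) h3, Real.log_pow]
    set c := repelRatio m γ p.Mg ℓ
    have h4 : Real.log (c / 6) = Real.log (c / 3) - Real.log 2 := by
      rw [← Real.log_div (by positivity) (by norm_num)]
      congr 1; ring
    rw [h4]
    have h5 := Real.log_two_gt_d9
    have hm' : (1 : ℝ) ≤ m := by exact_mod_cast hm
    nlinarith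

/-- One accurate step keeps the iterate well inside the feasible set. -/
theorem StepAccurate.mem_wellInside (h : StepAccurate 𝓜 𝓟 p θ b) (hB : 𝓜.BoundedScore 𝓟 p.Mg p.Mh)
    (hMg : 0 < p.Mg) (hMh : 0 < p.Mh) (hη : 0 < p.η) (hθ : θ ∈ wellInside 𝓜 𝓟 p ℓ)
    (hg : p.η / 2 < ‖barrierGradEst 𝓜 𝓟 p θ b‖) {νemf : ℝ} (hℓ : 0 < ℓ)
    (hℓL : ℓ ≤ lipConst γ p.Mg) (hην : p.η ≤ νemf) (hE : 𝓜.ExtendedMFCQ 𝓟 νemf ℓ)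
    {θ' : EuclideanSpace ℝ (Fin d)}
    (hθ' : θ' = θ + stepSize 𝓜 𝓟 p θ b • barrierGradEst 𝓜 𝓟 p θ b) :
    θ' ∈ wellInside 𝓜 𝓟 p ℓ := by
  have hL := lipConst_pos 𝓜 hMg
  have hV : ∀ i : Fin m, 0 < 𝓜.V 𝓟 i.succ θ := hθ.1
  have hthird := (h.step hB hMg hMh hη hθ.1 hg hθ').1
  have hc0 := repelRatio_pos (m := m) hL hℓ
  have hc1 := repelRatio_le_one (m := m) hL hℓL
  refine ⟨fun i => lt_of_lt_of_le (div_pos (hV i) three_pos) (hthird i), ?_⟩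
  by_cases hex : ∃ j : Fin m, 𝓜.V 𝓟 j.succ θ ≤ repelRatio m γ p.Mg ℓ * p.η
  · obtain ⟨j, hj⟩ := hex
    refine hθ.2.trans (h.potential_le hB hMg hMh hη hθ.1 hg hℓ hℓL hc0 ?_ hην hE hj hθ')
    rw [repelRatio, div_div_cancel₀ hℓ.ne']
  -- No constraint is below the repelling level, so after the step all are still above a third of
  -- it; the level in `wellInside` is chosen for precisely this case.
  · push Not at hex
    have : ∀ i ∈ (Finset.univ : Finset (Fin m)),
        Real.log (repelRatio m γ p.Mg ℓ / 3) + 1 - repelRatio m γ p.Mg ℓ / 3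
          ≤ truncLog p.η (𝓜.V 𝓟 i.succ θ') := fun i _ =>
      truncLog_ge_of_ge hη (by positivity) (by linarith) (by linarith [hthird i, hex i])
    refine le_trans (le_of_eq ?_) (Finset.sum_le_sum this)
    rw [Finset.sum_const, Finset.card_univ, Fintype.card_fin, nsmul_eq_mul]

/-- The tolerance for the relative statistical error. -/
noncomputable def tolerance (m : ℕ) (Mg : ℝ) : ℝ :=
  min (1 / 40) (1 / (100 * (1 + 4 * m) * Mg))

theorem tolerance_pos (m : ℕ) {Mg : ℝ} (hMg : 0 < Mg) : 0 < tolerance m Mg :=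
  lt_min (by norm_num) (by positivity)

/-- Here `x` is a lower bound for all constraint values. Perturbing 1 / V i costs a factor 1 / x²,
which is why the tolerated relative error is of order x², and the batch size of order η⁻⁴. -/
theorem Accurate.stepAccurate {σ x : ℝ}
    (h : Accurate 𝓜 𝓟 p (1 / (1 - γ) * σ) (lipConst γ p.Mg * σ) θ b)
    (hB : 𝓜.BoundedScore 𝓟 p.Mg p.Mh) (hMg : 0 < p.Mg) (hMh : 0 < p.Mh)
    (hθ : θ ∈ 𝓜.strictlyFeasible 𝓟) (hσ0 : 0 ≤ σ)
    (hr0 : |valueRadius γ p| ≤ 1 / (1 - γ) * σ) (hr1 : 0 ≤ gradRadius γ p) (hx : 0 < x)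
    (hxη : x ≤ p.η) (hx1 : x * (1 - γ) ≤ 1) (hxV : ∀ i : Fin m, x ≤ 𝓜.V 𝓟 i.succ θ)
    (hσ : σ ≤ tolerance m p.Mg * x ^ 2 * (1 - γ) ^ 3) : StepAccurate 𝓜 𝓟 p θ b := by
  have hγ := 𝓜.one_sub_pos
  have hγ1 : 1 - γ ≤ 1 := by linarith [𝓜.γ_pos]
  have hη : 0 < p.η := hx.trans_le hxη
  have hL := lipConst_pos 𝓜 hMg
  have hM := smoothConst_pos 𝓜 hMg hMh
  have hκ := tolerance_pos m hMg
  have hκ1 : tolerance m p.Mg ≤ 1 / 40 := min_le_left _ _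
  have hκ2 : tolerance m p.Mg * p.Mg * (1 + 4 * m) ≤ 1 / 100 := by
    have := min_le_right (1 / 40 : ℝ) (1 / (100 * (1 + 4 * m) * p.Mg))
    rw [← tolerance, le_div_iff₀ (by positivity)] at this
    linarith
  have hx0 : 0 ≤ x * (1 - γ) := by positivity
  set κ := tolerance m p.Mg with hκdef
  set L := lipConst γ p.Mg with hLdef
  have hLγ : L * (1 - γ) ^ 2 = p.Mg := by rw [hLdef, lipConst]; field_simp
  have hv0 : 1 / (1 - γ) * σ ≤ x / 40 := by
    rw [one_div_mul_eq_div, div_le_iff₀ hγ]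
    calc σ ≤ κ * x ^ 2 * (1 - γ) ^ 3 := hσ
      _ = κ * ((x * (1 - γ)) * (1 - γ)) * (x * (1 - γ)) := by ring
      _ ≤ 1 / 40 * (1 * 1) * (x * (1 - γ)) := by gcongr
      _ = x / 40 * (1 - γ) := by ring
  have hLσ : L * σ ≤ κ * p.Mg * (x ^ 2 * (1 - γ)) := by
    calc L * σ ≤ L * (κ * x ^ 2 * (1 - γ) ^ 3) := mul_le_mul_of_nonneg_left hσ hL.le
      _ = κ * (L * (1 - γ) ^ 2) * (x ^ 2 * (1 - γ)) := by ring
      _ = _ := by rw [hLγ]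
  have hLσ0 : 0 ≤ L * σ := by positivity
  refine ⟨fun i => ?_, ⟨L * σ, fun i => ⟨?_, ?_⟩⟩, ?_⟩
  · have h1 := (h i.succ).1
    have h2 := abs_sub (valueEst 𝓜 p i.succ b - 𝓜.V 𝓟 i.succ θ) (valueRadius γ p)
    rw [sub_right_comm] at h2
    rw [lowerValue]
    linarith [hxV i]
  · have h1 : L ^ 2 * (1 - γ) ^ 2 ≤ smoothConst γ p.Mg p.Mh := by
      rw [hLdef, lipConst, smoothConst, div_pow, div_mul_eq_mul_div, div_le_div_iff₀
        (by positivity) (by positivity)]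
      have : p.Mg ^ 2 * (1 - γ) ^ 2 * (1 - γ) ^ 2 = p.Mg ^ 2 * ((1 - γ) ^ 2) ^ 2 := by ring
      rw [this]
      exact mul_le_mul_of_nonneg_right (by linarith) (by positivity)
    have h2 : σ ^ 2 ≤ (1 / 40) ^ 2 * x * (1 - γ) ^ 2 := by
      have h3 := pow_le_pow_left₀ hσ0 hσ 2
      refine h3.trans ?_
      calc (κ * x ^ 2 * (1 - γ) ^ 3) ^ 2
          = κ ^ 2 * (x * (1 - γ)) ^ 3 * (1 - γ) * (x * (1 - γ) ^ 2) := by ring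
        _ ≤ (1 / 40) ^ 2 * 1 ^ 3 * 1 * (x * (1 - γ) ^ 2) := by gcongr
        _ = _ := by ring
    calc (L * σ) ^ 2 = L ^ 2 * σ ^ 2 := by ring
      _ ≤ L ^ 2 * ((1 / 40) ^ 2 * x * (1 - γ) ^ 2) := by gcongr
      _ = L ^ 2 * (1 - γ) ^ 2 * (x / 1600) := by ring
      _ ≤ smoothConst γ p.Mg p.Mh * (𝓜.V 𝓟 i.succ θ / 200) := by
        refine mul_le_mul h1 ?_ (by positivity) hM.le
        linarith [hxV i]
      _ = _ := by ring
  · set w := ‖barrierGradEst 𝓜 𝓟 p θ b‖⁻¹ • barrierGradEst 𝓜 𝓟 p θ b with hw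
    have hw1 : ‖w‖ ≤ 1 := by
      rw [hw, norm_smul, norm_inv, norm_norm]
      exact inv_mul_le_one
    have h1 := abs_real_inner_le_norm (gradEst 𝓜 𝓟 p θ i.succ b - gradient (𝓜.V 𝓟 i.succ) θ) w
    have h2 := mul_le_mul (h i.succ).2 hw1 (norm_nonneg _) hLσ0
    rw [inner_sub_left] at h1
    have h3 := abs_sub_abs_le_abs_sub (inner ℝ (gradient (𝓜.V 𝓟 i.succ) θ) w)
      (inner ℝ (gradEst 𝓜 𝓟 p θ i.succ b) w)
    rw [abs_sub_comm] at h3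
    have h4 := le_abs_self (upperSlope 𝓜 𝓟 p θ i b)
    rw [upperSlope, ← hw] at h4
    rw [upperSlope, ← hw]
    linarith
  · have hi : ∀ i ∈ (Finset.univ : Finset (Fin m)),
        ‖(valueEst 𝓜 p i.succ b)⁻¹ • gradEst 𝓜 𝓟 p θ i.succ b
          - (𝓜.V 𝓟 i.succ θ)⁻¹ • gradient (𝓜.V 𝓟 i.succ) θ‖ ≤ 4 * (κ * p.Mg) := fun i _ => by
      have hv := hxV i
      have hvp : 0 < 𝓜.V 𝓟 i.succ θ := hx.trans_le hv
      have hh := (h i.succ).1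
      have hE : x / 2 ≤ valueEst 𝓜 p i.succ b := by linarith [(abs_le.1 hh).1]
      have hEp : 0 < valueEst 𝓜 p i.succ b := by linarith
      have hEinv : (valueEst 𝓜 p i.succ b)⁻¹ ≤ 2 / x := by
        have := inv_anti₀ (by positivity) hE
        rwa [inv_div] at this
      have hVinv : (𝓜.V 𝓟 i.succ θ)⁻¹ ≤ 1 / x := by
        rw [one_div]; exact inv_anti₀ hx hv
      have hG := hB.norm_gradient_V_le hθ i.succ
      set V := 𝓜.V 𝓟 i.succ θ
      set E := valueEst 𝓜 p i.succ b
      set G := gradient (𝓜.V 𝓟 i.succ) θ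
      set Q := gradEst 𝓜 𝓟 p θ i.succ b
      -- The gradient error is divided by a value of size x, the value error by one of size x²; each
      -- contributes 2 κ Mg.
      have e1 : E⁻¹ • Q - V⁻¹ • G = E⁻¹ • (Q - G) + (E⁻¹ - V⁻¹) • G := by
        rw [smul_sub, sub_smul]; abel
      have e2 : ‖E⁻¹ • (Q - G)‖ ≤ 2 / x * (L * σ) := by
        rw [norm_smul, norm_inv, Real.norm_of_nonneg hEp.le]
        exact mul_le_mul hEinv (h i.succ).2 (norm_nonneg _) (by positivity)
      have e3 : |E⁻¹ - V⁻¹| ≤ 2 / x * (1 / x) * (1 / (1 - γ) * σ) := by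
        have : E⁻¹ - V⁻¹ = E⁻¹ * V⁻¹ * (V - E) := by field_simp
        rw [this, abs_mul, abs_mul, abs_of_pos (inv_pos.2 hEp), abs_of_pos (inv_pos.2 hvp),
          abs_sub_comm]
        gcongr
      have e4 : ‖(E⁻¹ - V⁻¹) • G‖ ≤ 2 / x * (1 / x) * (1 / (1 - γ) * σ) * L := by
        rw [norm_smul, Real.norm_eq_abs]
        exact mul_le_mul e3 hG (norm_nonneg _) (by positivity)
      have e5 : 2 / x * (L * σ) ≤ 2 * (κ * p.Mg) := by
        calc 2 / x * (L * σ) ≤ 2 / x * (κ * p.Mg * (x ^ 2 * (1 - γ))) := by gcongr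
          _ = 2 * (κ * p.Mg) * (x * (1 - γ)) := by field_simp
          _ ≤ 2 * (κ * p.Mg) * 1 := by gcongr
          _ = _ := mul_one _
      have e6 : 2 / x * (1 / x) * (1 / (1 - γ) * σ) * L ≤ 2 * (κ * p.Mg) := by
        calc 2 / x * (1 / x) * (1 / (1 - γ) * σ) * L
            = 2 / x * (1 / x) * (1 / (1 - γ)) * (L * σ) := by ring
          _ ≤ 2 / x * (1 / x) * (1 / (1 - γ)) * (κ * p.Mg * (x ^ 2 * (1 - γ))) := by gcongr
          _ = _ := by field_simp
      rw [e1]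
      linarith [norm_add_le (E⁻¹ • (Q - G)) ((E⁻¹ - V⁻¹) • G)]
    have e0 : barrierGradEst 𝓜 𝓟 p θ b - 𝓜.barrierGrad 𝓟 p.η θ
        = (gradEst 𝓜 𝓟 p θ 0 b - gradient (𝓜.V 𝓟 0) θ)
          + p.η • ∑ i : Fin m, ((valueEst 𝓜 p i.succ b)⁻¹ • gradEst 𝓜 𝓟 p θ i.succ b
            - (𝓜.V 𝓟 i.succ θ)⁻¹ • gradient (𝓜.V 𝓟 i.succ) θ) := by
      rw [barrierGradEst, CMDP.barrierGrad, Finset.sum_sub_distrib, smul_sub]; abel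
    have hs := norm_sum_le_of_le _ hi
    rw [Finset.sum_const, Finset.card_univ, Fintype.card_fin, nsmul_eq_mul] at hs
    rw [e0]
    refine (norm_add_le _ _).trans ?_
    rw [norm_smul, Real.norm_of_nonneg hη.le]
    have h1 : L * σ ≤ κ * p.Mg * p.η := by
      refine hLσ.trans ?_
      have : x ^ 2 * (1 - γ) ≤ p.η := by
        calc x ^ 2 * (1 - γ) = x * (x * (1 - γ)) := by ring
          _ ≤ x * 1 := by gcongr
          _ ≤ p.η := by rw [mul_one]; exact hxη
      gcongr
    have h2 := mul_le_mul_of_nonneg_left hs hη.le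
    have h3 := mul_le_mul_of_nonneg_right hκ2 hη.le
    linarith [(h 0).2]

end LBSGD

/-! ### Batch size and horizon. -/

namespace LBSGD

variable {S : Type u} {A : Type v} [MeasurableSpace S] [MeasurableSpace A] {m : ℕ} {γ : ℝ} {d : ℕ}
  {𝓜 : CMDP S A m γ} {𝓟 : PolicyClass S A d} {p : LBParams} {θ : EuclideanSpace ℝ (Fin d)}
  {b : Batch S A p} {ℓ : ℝ}

/-- The relative size of the statistical error and the truncation error. -/
noncomputable def totalError (m : ℕ) (γ : ℝ) (p : LBParams) : ℝ :=
  statError m p.δ p.n + γ ^ p.H * (1 + p.H)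

theorem statError_nonneg (m : ℕ) (δ : ℝ) (n : ℕ) : 0 ≤ statError m δ n := by
  rw [statError]; positivity

theorem totalError_nonneg (m : ℕ) (hγ : 0 < γ) (p : LBParams) : 0 ≤ totalError m γ p :=
  add_nonneg (statError_nonneg _ _ _) (by positivity)

theorem Accurate.mono {e₀ e₁ e₀' e₁' : ℝ} (h : Accurate 𝓜 𝓟 p e₀ e₁ θ b) (h0 : e₀ ≤ e₀')
    (h1 : e₁ ≤ e₁') : Accurate 𝓜 𝓟 p e₀' e₁' θ b :=
  fun i => ⟨(h i).1.trans h0, (h i).2.trans h1⟩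

theorem sqrt_log_div_le_statError (m : ℕ) (δ : ℝ) (n : ℕ) :
    8 * (√(Real.log (2 / δ)) / √(n : ℝ)) ≤ statError m δ n := by
  rw [statError, mul_div_assoc]
  have : 0 ≤ √(Real.log (2 / δ)) / √(n : ℝ) := by positivity
  nlinarith [mul_nonneg (Nat.cast_nonneg (α := ℝ) m) this]

theorem abs_valueRadius_le (hγ : 0 < γ) (hγ1 : γ < 1) (m : ℕ) (p : LBParams) :
    |valueRadius γ p| ≤ 1 / (1 - γ) * totalError m γ p := by
  have h1 : 0 < 1 - γ := by linarith
  have h0 : 0 ≤ valueRadius γ p := by rw [valueRadius]; positivity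
  have h2 := sqrt_log_div_le_statError m p.δ p.n
  have h3 : √2 ≤ 8 := Real.sqrt_le_iff.2 ⟨by norm_num, by norm_num⟩
  have h4 : 0 ≤ √(Real.log (2 / p.δ)) / √(p.n : ℝ) := by positivity
  have h5 : γ ^ p.H ≤ γ ^ p.H * (1 + p.H) :=
    le_mul_of_one_le_right (by positivity) (by linarith [Nat.cast_nonneg (α := ℝ) p.H])
  have e : valueRadius γ p
      = 1 / (1 - γ) * (√2 * (√(Real.log (2 / p.δ)) / √(p.n : ℝ)) + γ ^ p.H) := by
    rw [valueRadius, div_mul_eq_mul_div, ← div_div]; ring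
  rw [abs_of_nonneg h0, e, totalError]
  refine mul_le_mul_of_nonneg_left ?_ (by positivity)
  nlinarith

theorem gradRadius_nonneg (hγ : 0 < γ) (hγ1 : γ < 1) (hMg : 0 < p.Mg) : 0 ≤ gradRadius γ p := by
  have h1 : 0 < 1 - γ := by linarith
  rw [gradRadius]; positivity

theorem gradRadius_le (hγ : 0 < γ) (hγ1 : γ < 1) (hMg : 0 < p.Mg) (hδ : 0 < p.δ) (m : ℕ) :
    gradRadius γ p ≤ lipConst γ p.Mg * totalError m γ p := by
  have h1 : 0 < 1 - γ := by linarith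
  have h2 := sqrt_log_div_le_statError m p.δ p.n
  have h3 : √2 ≤ 4 := Real.sqrt_le_iff.2 ⟨by norm_num, by norm_num⟩
  have h4 : 0 ≤ √(Real.log (2 / p.δ)) / √(p.n : ℝ) := by positivity
  have h5 : √(Real.log (Real.exp (1 / 4) / p.δ)) ≤ √(Real.log (2 / p.δ)) := by
    refine Real.sqrt_le_sqrt ?_
    rw [Real.log_div (Real.exp_pos _).ne' hδ.ne', Real.log_div two_ne_zero hδ.ne', Real.log_exp]
    linarith [Real.log_two_gt_d9]
  have h6 : 1 / (1 - γ) ^ (3 / 2 : ℝ) ≤ 1 / (1 - γ) ^ 2 := by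
    refine one_div_le_one_div_of_le (by positivity) ?_
    rw [← Real.rpow_natCast]
    exact Real.rpow_le_rpow_of_exponent_ge h1 (by linarith) (by norm_num)
  have h7 : √(1 / (1 - γ) + p.H) ≤ (1 + p.H) * (1 / (1 - γ)) := by
    have hH := Nat.cast_nonneg (α := ℝ) p.H
    have h8 : 1 ≤ 1 / (1 - γ) := by rw [le_div_iff₀ h1]; linarith
    refine Real.sqrt_le_iff.2 ⟨by positivity, ?_⟩
    have h9 : 1 / (1 - γ) + p.H ≤ (1 + p.H) * (1 / (1 - γ)) := by nlinarith
    have h10 : 1 ≤ (1 + p.H) * (1 / (1 - γ)) := by nlinarith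
    nlinarith
  have e1 : 2 * √2 * p.Mg / (√(p.n : ℝ) * (1 - γ) ^ (3 / 2 : ℝ))
      * √(Real.log (Real.exp (1 / 4) / p.δ)) ≤ lipConst γ p.Mg * statError m p.δ p.n := by
    calc 2 * √2 * p.Mg / (√(p.n : ℝ) * (1 - γ) ^ (3 / 2 : ℝ))
          * √(Real.log (Real.exp (1 / 4) / p.δ))
        = p.Mg * (1 / (1 - γ) ^ (3 / 2 : ℝ))
          * (2 * √2 * (√(Real.log (Real.exp (1 / 4) / p.δ)) / √(p.n : ℝ))) := by
          rw [← div_div]; ring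
      _ ≤ p.Mg * (1 / (1 - γ) ^ 2) * (2 * 4 * (√(Real.log (2 / p.δ)) / √(p.n : ℝ))) := by gcongr
      _ ≤ p.Mg * (1 / (1 - γ) ^ 2) * statError m p.δ p.n := by
          refine mul_le_mul_of_nonneg_left ?_ (by positivity)
          linarith
      _ = _ := by rw [lipConst]; ring
  have e2 : p.Mg * γ ^ p.H / (1 - γ) * √(1 / (1 - γ) + p.H)
      ≤ lipConst γ p.Mg * (γ ^ p.H * (1 + p.H)) := by
    calc p.Mg * γ ^ p.H / (1 - γ) * √(1 / (1 - γ) + p.H)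
        ≤ p.Mg * γ ^ p.H / (1 - γ) * ((1 + p.H) * (1 / (1 - γ))) := by gcongr
      _ = _ := by rw [lipConst]; field_simp
  rw [gradRadius, totalError, mul_add]
  exact add_le_add e1 e2

theorem safetyRatio_eq {Mg : ℝ} (hγ1 : γ < 1) (hMg : 0 < Mg) (m : ℕ) (ℓ : ℝ) :
    safetyRatio m γ Mg ℓ = ℓ ^ m * (1 - γ) ^ (2 * m) / (30 * (m + 2) * Mg) ^ m := by
  have h1 : 0 < 1 - γ := by linarith
  rw [safetyRatio, repelRatio, lipConst, pow_mul, ← mul_pow, ← div_pow]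
  congr 1
  field_simp
  ring

/-- With q = √γ, one factor q^H absorbs 1 + H, as (1 + H) q^H is at most the geometric series; the
other factor q^H supplies the power of z. -/
theorem geometric_decay {γ : ℝ} (hγ : 0 < γ) (hγ1 : γ < 1) {a : ℝ} (ha : 0 < a) (k : ℕ) :
    ∃ K > 0, ∀ z : ℝ, 0 < z → ∀ H : ℕ, K * max 1 (Real.log (1 / z)) ≤ H →
      γ ^ H * (1 + H) ≤ a * z ^ k := by
  set q := √γ with hq
  have hq0 : 0 < q := Real.sqrt_pos.2 hγ
  have hq1 : q < 1 := by rw [hq, Real.sqrt_lt' one_pos]; linarith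
  have hqq : γ = q * q := (Real.mul_self_sqrt hγ.le).symm
  have hlq : 0 < -Real.log q := neg_pos.2 (Real.log_neg hq0 hq1)
  have hw : 0 < a * (1 - q) := mul_pos ha (by linarith)
  refine ⟨(k + 1 + |Real.log (a * (1 - q))|) / (-Real.log q), by positivity, fun z hz H hH => ?_⟩
  set y := max 1 (Real.log (1 / z)) with hy
  have hy1 : 1 ≤ y := le_max_left _ _
  have hyz : -Real.log z ≤ y := by
    rw [← Real.log_inv, ← one_div]; exact le_max_right _ _
  have h1 : q ^ H * (1 + H) ≤ 1 / (1 - q) := by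
    have hg := hasSum_geometric_of_lt_one hq0.le hq1
    have h2 := sum_le_hasSum (Finset.range (H + 1)) (fun i _ => pow_nonneg hq0.le i) hg
    have h3 : ∀ i ∈ Finset.range (H + 1), q ^ H ≤ q ^ i := fun i hi =>
      pow_le_pow_of_le_one hq0.le hq1.le (Nat.lt_succ_iff.1 (Finset.mem_range.1 hi))
    have h4 := Finset.sum_le_sum h3
    rw [Finset.sum_const, Finset.card_range, nsmul_eq_mul] at h4
    push_cast at h4
    rw [one_div]
    linarith
  have h2 : q ^ H ≤ a * (1 - q) * z ^ k := by
    rw [← Real.log_le_log_iff (by positivity) (by positivity), Real.log_pow,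
      Real.log_mul hw.ne' (by positivity), Real.log_pow]
    rw [div_mul_eq_mul_div, div_le_iff₀ hlq] at hH
    have h3 : -|Real.log (a * (1 - q))| ≤ Real.log (a * (1 - q)) := neg_abs_le _
    have h4 := abs_nonneg (Real.log (a * (1 - q)))
    have h5 := mul_le_mul_of_nonneg_left hyz (Nat.cast_nonneg (α := ℝ) k)
    nlinarith
  have h3 : 0 < q ^ H := pow_pos hq0 H
  have hq1' : 0 < 1 - q := by linarith
  calc γ ^ H * (1 + H) = q ^ H * (q ^ H * (1 + H)) := by rw [hqq, mul_pow]; ring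
    _ ≤ (a * (1 - q) * z ^ k) * (1 / (1 - q)) := by gcongr
    _ = a * z ^ k := by field_simp

/-- The required batch size makes the statistical error small. -/
theorem statError_le {Mg η δ : ℝ} {n : ℕ} (hγ1 : γ < 1) (hMg : 0 < Mg) (hη : 0 < η) (hℓ : 0 < ℓ)
    (m : ℕ) (hδ : 0 < δ) (hδ1 : δ ≤ 1)
    (hn : ((4 * m + 8) * (2 * ((30 * (m + 2) * Mg) ^ m) ^ 2) / tolerance m Mg) ^ 2
      * (Real.log (2 / δ) / (η ^ 4 * ℓ ^ (4 * m) * (1 - γ) ^ (6 + 8 * m))) ≤ n) :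
    0 < n ∧ statError m δ n
      ≤ tolerance m Mg * (safetyRatio m γ Mg ℓ * η) ^ 2 * (1 - γ) ^ 3 / 2 := by
  have h1 : 0 < 1 - γ := by linarith
  have hlg : 0 < Real.log (2 / δ) := by linarith [half_le_log_two_div hδ hδ1]
  have hκ := tolerance_pos m hMg
  set D := (30 * (m + 2) * Mg) ^ m with hD
  have hD0 : 0 < D := by positivity
  set W := η ^ 2 * ℓ ^ (2 * m) * (1 - γ) ^ (3 + 4 * m) with hW
  have hW0 : 0 < W := by positivity
  have hW2 : η ^ 4 * ℓ ^ (4 * m) * (1 - γ) ^ (6 + 8 * m) = W ^ 2 := by rw [hW]; ring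
  rw [hW2] at hn
  have hn0 : (0 : ℝ) < n := lt_of_lt_of_le (by positivity) hn
  refine ⟨by exact_mod_cast hn0, ?_⟩
  have hns : 0 < √(n : ℝ) := Real.sqrt_pos.2 hn0
  have e : tolerance m Mg * (safetyRatio m γ Mg ℓ * η) ^ 2 * (1 - γ) ^ 3 / 2
      = tolerance m Mg / (2 * D ^ 2) * W := by
    rw [safetyRatio_eq hγ1 hMg, ← hD, hW]
    field_simp
    ring
  rw [e, statError, div_le_iff₀ hns]
  have h2 : (4 * m + 8) * (2 * D ^ 2) / tolerance m Mg * (√(Real.log (2 / δ)) / W) ≤ √(n : ℝ) := by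
    refine Real.le_sqrt_of_sq_le ?_
    rw [mul_pow, div_pow (√_), Real.sq_sqrt hlg.le]
    exact hn
  calc (4 * m + 8) * √(Real.log (2 / δ))
      = tolerance m Mg / (2 * D ^ 2) * W
        * ((4 * m + 8) * (2 * D ^ 2) / tolerance m Mg * (√(Real.log (2 / δ)) / W)) := by
        field_simp
    _ ≤ _ := by gcongr

/-- The required horizon makes the truncation error small. -/
theorem exists_horizon {Mg : ℝ} (hγ : 0 < γ) (hγ1 : γ < 1) (hMg : 0 < Mg) {m : ℕ} (hm : 1 ≤ m) :
    ∃ K > 0, ∀ ℓ η : ℝ, 0 < ℓ → 0 < η → η * (1 - γ) ≤ 1 → ∀ H : ℕ,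
      K * max 1 (Real.log (1 / (ℓ * η))) ≤ H →
      γ ^ H * (1 + H) ≤ tolerance m Mg * (safetyRatio m γ Mg ℓ * η) ^ 2 * (1 - γ) ^ 3 / 2 := by
  have h1 : 0 < 1 - γ := by linarith
  have hκ := tolerance_pos m hMg
  obtain ⟨k, rfl⟩ := Nat.exists_eq_add_of_le' hm
  set D := (30 * ((k + 1 : ℕ) + 2) * Mg) ^ (k + 1) with hD
  have hD0 : 0 < D := by positivity
  obtain ⟨K, hK, h⟩ := geometric_decay hγ hγ1 (a := tolerance (k + 1) Mg / (2 * D ^ 2)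
    * (1 - γ) ^ (2 * k + 3 + 4 * (k + 1))) (by positivity) (2 * (k + 1))
  refine ⟨K, hK, fun ℓ η hℓ hη hη1 H hH => (h (ℓ * η) (by positivity) H hH).trans ?_⟩
  rw [safetyRatio_eq hγ1 hMg, ← hD]
  -- The horizon depends on ℓ and η only through their product, which produces 2 m powers of η where
  -- 2 are needed. The surplus is paid by η (1 - γ) ≤ 1 and the extra powers of 1 - γ put into the
  -- constant.
  have h2 : (η * (1 - γ)) ^ (2 * k) ≤ 1 := pow_le_one₀ (by positivity) hη1
  calc tolerance (k + 1) Mg / (2 * D ^ 2) * (1 - γ) ^ (2 * k + 3 + 4 * (k + 1))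
        * (ℓ * η) ^ (2 * (k + 1))
      = tolerance (k + 1) Mg / (2 * D ^ 2) * (1 - γ) ^ (3 + 4 * (k + 1)) * ℓ ^ (2 * (k + 1))
        * η ^ 2 * (η * (1 - γ)) ^ (2 * k) := by
        rw [mul_pow η]
        generalize 1 - γ = g
        ring
    _ ≤ tolerance (k + 1) Mg / (2 * D ^ 2) * (1 - γ) ^ (3 + 4 * (k + 1)) * ℓ ^ (2 * (k + 1))
        * η ^ 2 * 1 := by gcongr
    _ = _ := by field_simp; ring

end LBSGD

/-! ### Behaviour of a whole run, and the length of a step. -/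

namespace LBSGD

variable {S : Type u} {A : Type v} [MeasurableSpace S] [MeasurableSpace A] {m : ℕ} {γ : ℝ} {d : ℕ}
  {𝓜 : CMDP S A m γ} {𝓟 : PolicyClass S A d} {p : LBParams} {θ θ₀ : EuclideanSpace ℝ (Fin d)}
  {b : Batch S A p} {ℓ : ℝ}

/-- Along a run with accurate batches the iterates stay well inside the feasible set; the output
is nearly stationary if the run terminated, and otherwise every function which contracts in each
step has contracted geometrically. -/
theorem state_of_stepAccurate (hB : 𝓜.BoundedScore 𝓟 p.Mg p.Mh) (hMg : 0 < p.Mg)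
    (hMh : 0 < p.Mh) (hη : 0 < p.η) {νemf : ℝ} (hℓ : 0 < ℓ) (hℓL : ℓ ≤ lipConst γ p.Mg)
    (hην : p.η ≤ νemf) (hE : 𝓜.ExtendedMFCQ 𝓟 νemf ℓ) (hθ₀ : θ₀ ∈ wellInside 𝓜 𝓟 p ℓ)
    {b : ℕ → Batch S A p} {T : ℕ}
    (hacc : ∀ t < T, iterate 𝓜 𝓟 p θ₀ b t ∈ wellInside 𝓜 𝓟 p ℓ →
      StepAccurate 𝓜 𝓟 p (iterate 𝓜 𝓟 p θ₀ b t) (b t))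
    {W : EuclideanSpace ℝ (Fin d) → ℝ} {r : ℝ} (hr : 0 ≤ r)
    (hW : ∀ t < T, iterate 𝓜 𝓟 p θ₀ b t ∈ wellInside 𝓜 𝓟 p ℓ →
      p.η / 2 < ‖barrierGradEst 𝓜 𝓟 p (iterate 𝓜 𝓟 p θ₀ b t) (b t)‖ →
      max (W (iterate 𝓜 𝓟 p θ₀ b t + stepSize 𝓜 𝓟 p (iterate 𝓜 𝓟 p θ₀ b t) (b t)
        • barrierGradEst 𝓜 𝓟 p (iterate 𝓜 𝓟 p θ₀ b t) (b t))) 0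
      ≤ r * max (W (iterate 𝓜 𝓟 p θ₀ b t)) 0) :
    ∀ t ≤ T, iterate 𝓜 𝓟 p θ₀ b t ∈ wellInside 𝓜 𝓟 p ℓ ∧
      (((state 𝓜 𝓟 p θ₀ b t).2 = true ∧ ‖𝓜.barrierGrad 𝓟 p.η (iterate 𝓜 𝓟 p θ₀ b t)‖ ≤ p.η) ∨
        ((state 𝓜 𝓟 p θ₀ b t).2 = false ∧
          max (W (iterate 𝓜 𝓟 p θ₀ b t)) 0 ≤ r ^ t * max (W θ₀) 0)) := by
  intro t
  induction t with
  | zero => exact fun _ => ⟨hθ₀, Or.inr ⟨rfl, by rw [pow_zero, one_mul]; rfl⟩⟩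
  | succ t ih =>
    intro ht
    obtain ⟨hin, hcase⟩ := ih (by omega)
    have hs : state 𝓜 𝓟 p θ₀ b (t + 1) = update 𝓜 𝓟 p (state 𝓜 𝓟 p θ₀ b t) (b t) := rfl
    rcases hcase with ⟨hf, hn⟩ | ⟨hf, hn⟩
    · have h1 : state 𝓜 𝓟 p θ₀ b (t + 1) = state 𝓜 𝓟 p θ₀ b t := by rw [hs, update, if_pos hf]
      rw [iterate, h1]
      exact ⟨hin, Or.inl ⟨hf, hn⟩⟩
    · have ha := hacc t (by omega) hin
      have hWt := hW t (by omega) hin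
      by_cases hg : ‖barrierGradEst 𝓜 𝓟 p (state 𝓜 𝓟 p θ₀ b t).1 (b t)‖ ≤ p.η / 2
      · have h1 : state 𝓜 𝓟 p θ₀ b (t + 1) = ((state 𝓜 𝓟 p θ₀ b t).1, true) := by
          rw [hs, update, if_neg (by rw [hf]; exact Bool.false_ne_true), if_pos hg]
        rw [iterate, h1]
        refine ⟨hin, Or.inl ⟨rfl, ?_⟩⟩
        -- Stopping gives an estimated gradient of at most η / 2; the error η / 100 still leaves the
        -- true one below η.
        have h2 := norm_sub_norm_le (𝓜.barrierGrad 𝓟 p.η (iterate 𝓜 𝓟 p θ₀ b t))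
          (barrierGradEst 𝓜 𝓟 p (iterate 𝓜 𝓟 p θ₀ b t) (b t))
        rw [norm_sub_rev] at h2
        have h3 := ha.grad
        rw [iterate] at h2 h3
        linarith
      · have h1 : state 𝓜 𝓟 p θ₀ b (t + 1) = ((state 𝓜 𝓟 p θ₀ b t).1
            + stepSize 𝓜 𝓟 p (state 𝓜 𝓟 p θ₀ b t).1 (b t)
              • barrierGradEst 𝓜 𝓟 p (state 𝓜 𝓟 p θ₀ b t).1 (b t), false) := by
          rw [hs, update, if_neg (by rw [hf]; exact Bool.false_ne_true), if_neg hg]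
        have h2 := not_le.1 hg
        rw [iterate, h1]
        refine ⟨ha.mem_wellInside hB hMg hMh hη hin h2 hℓ hℓL hην hE rfl, Or.inr ⟨rfl, ?_⟩⟩
        refine (hWt h2).trans ?_
        rw [pow_succ', mul_assoc]
        exact mul_le_mul_of_nonneg_left hn hr

theorem cConst_pos {Mg : ℝ} (hγ1 : γ < 1) (hMg : 0 < Mg) (hℓ : 0 < ℓ) :
    0 < cConst m γ Mg ℓ := by
  have : 0 < 1 - γ := by linarith
  rw [cConst]; positivity

/-- The constant of the stated rate and the safety ratio of this proof are m-th powers of comparable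
quantities. The factor between them depends on m only and is absorbed into `dampRatio`. -/
theorem cConst_le {Mg : ℝ} (hγ1 : γ < 1) (hMg : 0 < Mg) (hℓ : 0 < ℓ) (m : ℕ) :
    cConst m γ Mg ℓ ≤ (30 * (m + 2)) ^ m * safetyRatio m γ Mg ℓ := by
  have h1 : 0 < 1 - γ := by linarith
  rw [cConst, safetyRatio, ← mul_pow]
  refine pow_le_pow_left₀ (by positivity) ?_ m
  have e : 30 * ((m : ℝ) + 2) * (repelRatio m γ Mg ℓ / 6) = ℓ * (1 - γ) ^ 2 / Mg := by
    rw [repelRatio, lipConst]; field_simp; ring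
  rw [e]
  refine div_le_div_of_nonneg_left (by positivity) hMg ?_
  nlinarith [mul_nonneg (Nat.cast_nonneg (α := ℝ) m) hMg.le]

/-- Only the lower bounds m / c for 1 + m / c and 4 for the maximum are used. -/
theorem rateConst_le {Mg Mh : ℝ} (hγ1 : γ < 1) (hMg : 0 < Mg) (hMh : 0 < Mh) (hℓ : 0 < ℓ)
    (hm : 1 ≤ m) :
    0 < rateConst m γ Mg Mh ℓ ∧
      rateConst m γ Mg Mh ℓ ≤ cConst m γ Mg ℓ ^ 2 / (8 * m * lipConst γ Mg ^ 2) := by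
  have h1 : 0 < 1 - γ := by linarith
  have hc := cConst_pos (m := m) hγ1 hMg hℓ
  have hL : 0 < lipConst γ Mg := by rw [lipConst]; positivity
  have hM : 0 < smoothConst γ Mg Mh := by rw [smoothConst]; positivity
  have hm' : (0 : ℝ) < m := by exact_mod_cast hm
  rw [rateConst]
  set c := cConst m γ Mg ℓ
  set L := lipConst γ Mg
  set X := max (4 + 5 * smoothConst γ Mg Mh * c / L ^ 2)
    (1 + √(smoothConst γ Mg Mh * c / (4 * L ^ 2))) with hX
  have hX4 : 4 ≤ X := by
    have : 0 ≤ 5 * smoothConst γ Mg Mh * c / L ^ 2 := by positivity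
    exact le_trans (by linarith) (le_max_left _ _)
  refine ⟨by positivity, ?_⟩
  have e : c ^ 2 / (8 * m * L ^ 2) = c / (2 * L ^ 2 * (m / c) * 4) := by field_simp; ring
  rw [e]
  refine div_le_div_of_nonneg_left hc.le (by positivity) ?_
  gcongr
  linarith

/-- The constant relating the rate of the algorithm to the gradient norms in which it is
guaranteed. -/
noncomputable def dampRatio (m : ℕ) (Mg : ℝ) : ℝ :=
  42 * Mg * ((30 * (m + 2)) ^ m) ^ 2

/-- The barrier parameters for which the asymptotically dominant terms of the stepsize
dominate. -/
def IsSmall (m : ℕ) (γ Mg Mh ℓ η : ℝ) : Prop :=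
  η * (smoothConst γ Mg Mh + 20 * m * smoothConst γ Mg Mh / safetyRatio m γ Mg ℓ)
      ≤ m * lipConst γ Mg ^ 2 / safetyRatio m γ Mg ℓ ^ 2 ∧
    η * (51 / 20 * rateConst m γ Mg Mh ℓ * Mg)
      ≤ safetyRatio m γ Mg ℓ / 2
        / (√(smoothConst γ Mg Mh * (2 / (1 - γ))) + 4 * lipConst γ Mg)

theorem exists_isSmall {Mg Mh : ℝ} (hγ1 : γ < 1) (hMg : 0 < Mg) (hMh : 0 < Mh) (hℓ : 0 < ℓ)
    (hm : 1 ≤ m) : ∃ η₀ > 0, ∀ η ≤ η₀, IsSmall m γ Mg Mh ℓ η := by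
  have h1 : 0 < 1 - γ := by linarith
  have hL : 0 < lipConst γ Mg := by rw [lipConst]; positivity
  have hM : 0 < smoothConst γ Mg Mh := by rw [smoothConst]; positivity
  have hm' : (0 : ℝ) < m := by exact_mod_cast hm
  have hc := safetyRatio_pos (m := m) hL hℓ
  have hC := (rateConst_le hγ1 hMg hMh hℓ hm).1
  refine ⟨min (m * lipConst γ Mg ^ 2 / safetyRatio m γ Mg ℓ ^ 2
      / (smoothConst γ Mg Mh + 20 * m * smoothConst γ Mg Mh / safetyRatio m γ Mg ℓ))
    (safetyRatio m γ Mg ℓ / 2 / (√(smoothConst γ Mg Mh * (2 / (1 - γ))) + 4 * lipConst γ Mg)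
      / (51 / 20 * rateConst m γ Mg Mh ℓ * Mg)), lt_min (by positivity) (by positivity),
    fun η hη => ⟨?_, ?_⟩⟩
  · rw [← le_div_iff₀ (by positivity)]
    exact hη.trans (min_le_left _ _)
  · rw [← le_div_iff₀ (by positivity)]
    exact hη.trans (min_le_right _ _)

/-- A lower bound for the length of a step. -/
theorem StepAccurate.stepLength_ge (h : StepAccurate 𝓜 𝓟 p θ b) (hm : 1 ≤ m) (hMg : 0 < p.Mg)
    (hMh : 0 < p.Mh) (hη : 0 < p.η) (hθ : θ ∈ 𝓜.strictlyFeasible 𝓟) (hℓ : 0 < ℓ)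
    (hV : ∀ i : Fin m, safetyRatio m γ p.Mg ℓ * p.η ≤ 𝓜.V 𝓟 i.succ θ)
    (hβ : ∀ i : Fin m, |upperSlope 𝓜 𝓟 p θ i b| ≤ 2 * lipConst γ p.Mg)
    (hsmall : IsSmall m γ p.Mg p.Mh ℓ p.η)
    (hg : dampRatio m p.Mg * p.η ≤ ‖barrierGradEst 𝓜 𝓟 p θ b‖) :
    51 / 20 * rateConst m γ p.Mg p.Mh ℓ * p.Mg * p.η ^ 2
      ≤ stepSize 𝓜 𝓟 p θ b * ‖barrierGradEst 𝓜 𝓟 p θ b‖ := by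
  have hγ := 𝓜.one_sub_pos
  have hL := lipConst_pos 𝓜 hMg
  have hM := smoothConst_pos 𝓜 hMg hMh
  have hα := h.lower_pos hθ
  have hm' : (0 : ℝ) < m := by exact_mod_cast hm
  have hc := safetyRatio_pos (m := m) hL hℓ
  have hloc := localSmooth_pos (𝓟 := 𝓟) (θ := θ) hMg hMh hη hα
  have hg0 : 0 < ‖barrierGradEst 𝓜 𝓟 p θ b‖ :=
    lt_of_lt_of_le (by rw [dampRatio]; positivity) hg
  have hC := rateConst_le 𝓜.γ_lt_one hMg hMh hℓ hm
  have hc0 := cConst_pos (m := m) 𝓜.γ_lt_one hMg hℓ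
  have hcc := cConst_le 𝓜.γ_lt_one hMg hℓ m
  obtain ⟨hs1, hs2⟩ := hsmall
  have hαlow : ∀ i : Fin m, safetyRatio m γ p.Mg ℓ * p.η / 2 ≤ lowerValue 𝓜 p i b := fun i => by
    have h1 := (abs_le.1 (h.lower i)).1
    have h2 := hV i
    have h3 := mul_pos hc hη
    linarith
  have hαhigh : ∀ i : Fin m, lowerValue 𝓜 p i b ≤ 2 / (1 - γ) := fun i => by
    have h1 := (abs_le.1 (h.lower i)).2
    have h2 := (abs_le.1 (𝓜.abs_value_le i.succ (𝓟.policy θ))).2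
    rw [← CMDP.V] at h2
    have h3 : (0 : ℝ) < 1 / (1 - γ) := by positivity
    have h4 : 2 / (1 - γ) = 2 * (1 / (1 - γ)) := by ring
    linarith
  rw [stepSize, min_mul_of_nonneg _ _ hg0.le]
  set c := safetyRatio m γ p.Mg ℓ
  set M := smoothConst γ p.Mg p.Mh with hMdef
  set L := lipConst γ p.Mg
  set C := rateConst m γ p.Mg p.Mh ℓ
  set η := p.η with hηdef
  refine le_min ?_ ?_
  -- The slope terms give 128 m L² / c², and smallness of η fits all the rest into one more unit.
  · have h1 : localSmooth 𝓜 𝓟 p θ b * η ≤ 129 * m * L ^ 2 / c ^ 2 := by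
      have t1 : ∀ i ∈ (Finset.univ : Finset (Fin m)),
          10 * M * η / lowerValue 𝓜 p i b ≤ 20 * M / c := fun i _ => by
        calc 10 * M * η / lowerValue 𝓜 p i b ≤ 10 * M * η / (c * η / 2) :=
              div_le_div_of_nonneg_left (by positivity) (by positivity) (hαlow i)
          _ = 20 * M / c := by field_simp; norm_num
      have t2 : ∀ i ∈ (Finset.univ : Finset (Fin m)),
          upperSlope 𝓜 𝓟 p θ i b ^ 2 / lowerValue 𝓜 p i b ^ 2
            ≤ (2 * L) ^ 2 / (c * η / 2) ^ 2 := fun i _ => by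
        rw [← sq_abs (upperSlope 𝓜 𝓟 p θ i b)]
        exact div_le_div₀ (by positivity) (pow_le_pow_left₀ (abs_nonneg _) (hβ i) 2)
          (by positivity) (pow_le_pow_left₀ (by positivity) (hαlow i) 2)
      have t1s := Finset.sum_le_sum t1
      have t2s := Finset.sum_le_sum t2
      rw [Finset.sum_const, Finset.card_univ, Fintype.card_fin, nsmul_eq_mul] at t1s t2s
      have t3 : localSmooth 𝓜 𝓟 p θ b
          ≤ M + m * (20 * M / c) + 8 * η * (m * ((2 * L) ^ 2 / (c * η / 2) ^ 2)) := by
        rw [localSmooth, ← hMdef, ← hηdef]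
        gcongr
      refine (mul_le_mul_of_nonneg_right t3 hη.le).trans ?_
      have t4 : (M + m * (20 * M / c) + 8 * η * (m * ((2 * L) ^ 2 / (c * η / 2) ^ 2))) * η
          = η * (M + 20 * m * M / c) + 128 * (m * L ^ 2 / c ^ 2) := by
        field_simp; ring
      rw [t4]
      have t5 : 129 * m * L ^ 2 / c ^ 2 = m * L ^ 2 / c ^ 2 + 128 * (m * L ^ 2 / c ^ 2) := by ring
      rw [t5]
      linarith
    rw [one_div_mul_eq_div, le_div_iff₀ hloc]
    have h2 : C ≤ ((30 * (m + 2)) ^ m * c) ^ 2 / (8 * m * L ^ 2) := by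
      refine hC.2.trans ?_
      gcongr
    -- L and the safety ratio cancel, leaving the numerical factor 51 · 129 / 160 < 42; this fixes
    -- `dampRatio`.
    calc 51 / 20 * C * p.Mg * η ^ 2 * localSmooth 𝓜 𝓟 p θ b
        = 51 / 20 * C * p.Mg * η * (localSmooth 𝓜 𝓟 p θ b * η) := by ring
      _ ≤ 51 / 20 * (((30 * (m + 2)) ^ m * c) ^ 2 / (8 * m * L ^ 2)) * p.Mg * η
          * (129 * m * L ^ 2 / c ^ 2) := by
          gcongr
      _ = 51 * 129 / 160 * p.Mg * ((30 * (m + 2)) ^ m) ^ 2 * η := by field_simp; norm_num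
      _ ≤ dampRatio m p.Mg * η := by
          rw [dampRatio]
          have : 0 ≤ p.Mg * ((30 * ((m : ℝ) + 2)) ^ m) ^ 2 * η := by positivity
          nlinarith
      _ ≤ _ := hg
  · rw [mul_one_div, div_mul_cancel₀ _ hg0.ne']
    have : Nonempty (Fin m) := ⟨⟨0, hm⟩⟩
    refine le_ciInf fun i => ?_
    have hi := hα i
    calc 51 / 20 * C * p.Mg * η ^ 2 = η * (51 / 20 * C * p.Mg) * η := by ring
      _ ≤ c / 2 / (√(M * (2 / (1 - γ))) + 4 * L) * η := by gcongr
      _ = c * η / 2 / (√(M * (2 / (1 - γ))) + 2 * (2 * L)) := by ring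
      _ ≤ _ := by
        refine div_le_div₀ hi.le (hαlow i) ?_ ?_
        · exact add_pos_of_pos_of_nonneg (Real.sqrt_pos.2 (by positivity)) (by positivity)
        · gcongr
          · exact hαhigh i
          · exact hβ i

end LBSGD

/-! ### Contraction of the barrier gap and the probabilistic bound. -/

namespace LBSGD

variable {S : Type u} {A : Type v} [MeasurableSpace S] [MeasurableSpace A] {m : ℕ} {γ : ℝ} {d : ℕ}
  {𝓜 : CMDP S A m γ} {𝓟 : PolicyClass S A d} {p : LBParams} {θ θ₀ : EuclideanSpace ℝ (Fin d)}
  {b : Batch S A p} {ℓ : ℝ} {πopt : Kernel S A} [IsMarkovKernel πopt] {μF ε νemf : ℝ}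

/-- All truncated logarithms vanish, while the level defining the region is nonpositive. Slater's
condition uses this for the starting point. -/
theorem mem_wellInside_of_le (hMg : 0 < p.Mg) (hη : 0 < p.η) (hℓ : 0 < ℓ)
    (h : ∀ i : Fin m, p.η ≤ 𝓜.V 𝓟 i.succ θ) : θ ∈ wellInside 𝓜 𝓟 p ℓ := by
  refine ⟨fun i => hη.trans_le (h i), ?_⟩
  have h1 : 𝓜.potential 𝓟 p.η θ = 0 :=
    Finset.sum_eq_zero fun i _ => truncLog_of_ge hη (h i)
  have h2 := Real.log_le_sub_one_of_pos
    (div_pos (repelRatio_pos (m := m) (lipConst_pos 𝓜 hMg) hℓ) three_pos)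
  rw [h1]
  exact mul_nonpos_of_nonneg_of_nonpos (Nat.cast_nonneg m) (by linarith)

/-- Accurate batches make accurate steps. -/
theorem Accurate.stepAccurate_of_wellInside (hm : 1 ≤ m)
    (h : Accurate 𝓜 𝓟 p (1 / (1 - γ) * totalError m γ p)
      (lipConst γ p.Mg * totalError m γ p) θ b)
    (hB : 𝓜.BoundedScore 𝓟 p.Mg p.Mh) (hMg : 0 < p.Mg) (hMh : 0 < p.Mh) (hη : 0 < p.η)
    (hδ : 0 < p.δ) (hℓ : 0 < ℓ) (hℓL : ℓ ≤ lipConst γ p.Mg)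
    (hη1 : p.η * (1 - γ) ≤ 1) (hθ : θ ∈ wellInside 𝓜 𝓟 p ℓ)
    (hσ : totalError m γ p
      ≤ tolerance m p.Mg * (safetyRatio m γ p.Mg ℓ * p.η) ^ 2 * (1 - γ) ^ 3) :
    StepAccurate 𝓜 𝓟 p θ b ∧
      ∀ i : Fin m, |upperSlope 𝓜 𝓟 p θ i b| ≤ 2 * lipConst γ p.Mg := by
  have hγ := 𝓜.one_sub_pos
  have hγ1 : 1 - γ ≤ 1 := by linarith [𝓜.γ_pos]
  have hL := lipConst_pos 𝓜 hMg
  have hc := safetyRatio_pos (m := m) hL hℓ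
  have hc1 := safetyRatio_le_one (m := m) hL hℓ hℓL
  have hσ0 := totalError_nonneg m 𝓜.γ_pos p
  have hr0 := gradRadius_nonneg (p := p) 𝓜.γ_pos 𝓜.γ_lt_one hMg
  have hx1 : safetyRatio m γ p.Mg ℓ * p.η * (1 - γ) ≤ 1 := by
    rw [mul_assoc]
    exact mul_le_one₀ hc1 (by positivity) hη1
  refine ⟨h.stepAccurate hB hMg hMh hθ.1 hσ0
    (abs_valueRadius_le 𝓜.γ_pos 𝓜.γ_lt_one m p) hr0 (by positivity)
    (mul_le_of_le_one_left hη.le hc1) hx1 (safetyRatio_mul_le hm hMg hη hℓ hℓL hθ) hσ,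
    fun i => ?_⟩
  have hσ1 : totalError m γ p ≤ 1 / 40 := by
    refine hσ.trans ?_
    have hκ : tolerance m p.Mg ≤ 1 / 40 := min_le_left _ _
    have hκ0 := tolerance_pos m hMg
    calc tolerance m p.Mg * (safetyRatio m γ p.Mg ℓ * p.η) ^ 2 * (1 - γ) ^ 3
        = tolerance m p.Mg * (safetyRatio m γ p.Mg ℓ * p.η * (1 - γ)) ^ 2 * (1 - γ) := by ring
      _ ≤ 1 / 40 * 1 ^ 2 * 1 := by gcongr
      _ = 1 / 40 := by norm_num
  have hLσ := mul_le_mul_of_nonneg_left hσ1 hL.le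
  have hr1 := gradRadius_le (p := p) 𝓜.γ_pos 𝓜.γ_lt_one hMg hδ m
  have hG := hB.norm_gradient_V_le hθ.1 i.succ
  have hQ := norm_le_norm_sub_add (gradEst 𝓜 𝓟 p θ i.succ b) (gradient (𝓜.V 𝓟 i.succ) θ)
  have hh := (h i.succ).2
  rw [upperSlope]
  set w := ‖barrierGradEst 𝓜 𝓟 p θ b‖⁻¹ • barrierGradEst 𝓜 𝓟 p θ b with hw
  have hw1 : ‖w‖ ≤ 1 := by
    rw [hw, norm_smul, norm_inv, norm_norm]
    exact inv_mul_le_one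
  have h1 := (abs_real_inner_le_norm (gradEst 𝓜 𝓟 p θ i.succ b) w).trans
    (mul_le_of_le_one_right (norm_nonneg _) hw1)
  rw [abs_of_nonneg (add_nonneg (abs_nonneg _) hr0)]
  linarith

/-- A bound for the logarithms of the constraint values, up to the factor `max 1 (log (1 / η))`. -/
noncomputable def logBound (m : ℕ) (γ Mg ℓ : ℝ) : ℝ :=
  m * (-Real.log (1 - γ) - Real.log (safetyRatio m γ Mg ℓ) + 1)

theorem logBound_nonneg {Mg : ℝ} (hγ : 0 < γ) (hγ1 : γ < 1) (hMg : 0 < Mg) (hℓ : 0 < ℓ)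
    (hℓL : ℓ ≤ lipConst γ Mg) : 0 ≤ logBound m γ Mg ℓ := by
  have h1 : 0 < 1 - γ := by linarith
  have hL : 0 < lipConst γ Mg := by rw [lipConst]; positivity
  have h2 := Real.log_nonpos h1.le (by linarith)
  have h3 := Real.log_nonpos (safetyRatio_pos (m := m) hL hℓ).le (safetyRatio_le_one hL hℓ hℓL)
  exact mul_nonneg (Nat.cast_nonneg m) (by linarith)

theorem abs_sum_log_le (hm : 1 ≤ m) (hMg : 0 < p.Mg) (hη : 0 < p.η) (hℓ : 0 < ℓ)
    (hℓL : ℓ ≤ lipConst γ p.Mg) (hθ : θ ∈ wellInside 𝓜 𝓟 p ℓ) :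
    |∑ i : Fin m, Real.log (𝓜.V 𝓟 i.succ θ)|
      ≤ logBound m γ p.Mg ℓ * max 1 (Real.log (1 / p.η)) := by
  have hγ := 𝓜.one_sub_pos
  have hL := lipConst_pos 𝓜 hMg
  have hc := safetyRatio_pos (m := m) hL hℓ
  have h2 := Real.log_nonpos hγ.le (by linarith [𝓜.γ_pos])
  have h3 := Real.log_nonpos hc.le (safetyRatio_le_one (m := m) hL hℓ hℓL)
  set y := max 1 (Real.log (1 / p.η)) with hy
  have hy1 : 1 ≤ y := le_max_left _ _
  have hy2 : -Real.log p.η ≤ y := by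
    rw [← Real.log_inv, ← one_div]; exact le_max_right _ _
  have hi : ∀ i ∈ (Finset.univ : Finset (Fin m)), |Real.log (𝓜.V 𝓟 i.succ θ)|
      ≤ (-Real.log (1 - γ) - Real.log (safetyRatio m γ p.Mg ℓ) + 1) * y := fun i _ => by
    have hV : 0 < 𝓜.V 𝓟 i.succ θ := hθ.1 i
    have h4 := Real.log_le_log (by positivity) (safetyRatio_mul_le hm hMg hη hℓ hℓL hθ i)
    rw [Real.log_mul hc.ne' hη.ne'] at h4
    have h5 := (abs_le.1 (𝓜.abs_value_le i.succ (𝓟.policy θ))).2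
    rw [← CMDP.V] at h5
    have h6 := Real.log_le_log hV h5
    rw [one_div, Real.log_inv] at h6
    rw [abs_le]
    constructor <;> nlinarith
  refine (Finset.abs_sum_le_sum_abs _ _).trans ((Finset.sum_le_sum hi).trans (le_of_eq ?_))
  rw [Finset.sum_const, Finset.card_univ, Fintype.card_fin, nsmul_eq_mul, logBound, mul_assoc]

/-- Gradient domination well inside the feasible set. -/
theorem value_sub_le_of_wellInside (hm : 1 ≤ m) (hB : 𝓜.BoundedScore 𝓟 p.Mg p.Mh)
    (hMg : 0 < p.Mg) (hη : 0 < p.η) (hℓ : 0 < ℓ) (hℓL : ℓ ≤ lipConst γ p.Mg)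
    (hopt : ∀ i : Fin m, 0 ≤ 𝓜.value i.succ πopt) (hμF : 0 < μF) (hF : 𝓜.RelaxedFisher 𝓟 μF)
    (hε : 𝓜.BoundedTransferError 𝓟 πopt ε) (hθ : θ ∈ wellInside 𝓜 𝓟 p ℓ) :
    𝓜.value 0 πopt - 𝓜.V 𝓟 0 θ
      ≤ m * p.η + √ε / (1 - γ) * (1 + m / safetyRatio m γ p.Mg ℓ)
        + p.Mg * (‖𝓜.barrierGrad 𝓟 p.η θ‖ / μF) := by
  have hγ := 𝓜.one_sub_pos
  have hL := lipConst_pos 𝓜 hMg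
  have hc := safetyRatio_pos (m := m) hL hℓ
  refine (CMDP.value_sub_le_of_relaxedFisher hB hopt hμF hF hε hη hθ.1).trans ?_
  have hi : ∀ i ∈ (Finset.univ : Finset (Fin m)), p.η / 𝓜.V 𝓟 i.succ θ
      ≤ 1 / safetyRatio m γ p.Mg ℓ := fun i _ => by
    rw [div_le_div_iff₀ (hθ.1 i) hc, one_mul, mul_comm]
    exact safetyRatio_mul_le hm hMg hη hℓ hℓL hθ i
  have hs := Finset.sum_le_sum hi
  rw [Finset.sum_const, Finset.card_univ, Fintype.card_fin, nsmul_eq_mul, mul_one_div] at hs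
  gcongr

/-- One step contracts the part of the barrier gap exceeding `z`. -/
theorem StepAccurate.contract (h : StepAccurate 𝓜 𝓟 p θ b) (hm : 1 ≤ m)
    (hB : 𝓜.BoundedScore 𝓟 p.Mg p.Mh) (hMg : 0 < p.Mg) (hMh : 0 < p.Mh) (hη : 0 < p.η)
    (hℓ : 0 < ℓ) (hℓL : ℓ ≤ lipConst γ p.Mg) (hμF : 0 < μF) (hθ : θ ∈ wellInside 𝓜 𝓟 p ℓ)
    (hβ : ∀ i : Fin m, |upperSlope 𝓜 𝓟 p θ i b| ≤ 2 * lipConst γ p.Mg)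
    (hsmall : IsSmall m γ p.Mg p.Mh ℓ p.η) (hg : p.η / 2 < ‖barrierGradEst 𝓜 𝓟 p θ b‖)
    {v y Λ : ℝ} (hgap : v - 𝓜.V 𝓟 0 θ ≤ y + p.Mg * (‖𝓜.barrierGrad 𝓟 p.η θ‖ / μF))
    (hΛ : |∑ i : Fin m, Real.log (𝓜.V 𝓟 i.succ θ)| ≤ Λ) {θ' : EuclideanSpace ℝ (Fin d)}
    (hθ' : θ' = θ + stepSize 𝓜 𝓟 p θ b • barrierGradEst 𝓜 𝓟 p θ b) {z : ℝ}
    (hz : z = y + p.Mg * (2 * dampRatio m p.Mg * p.η / μF) + p.η * Λ) :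
    max (v - 𝓜.barrier 𝓟 p.η θ' - z) 0
      ≤ Real.exp (-(rateConst m γ p.Mg p.Mh ℓ * μF * p.η ^ 2))
        * max (v - 𝓜.barrier 𝓟 p.η θ - z) 0 := by
  have hstep := (h.step hB hMg hMh hη hθ.1 hg hθ').2.1
  have hγt := stepSize_nonneg (𝓟 := 𝓟) (θ := θ) hMg hMh hη (h.lower_pos hθ.1)
  have hgrad := h.grad
  have hC := (rateConst_le 𝓜.γ_lt_one hMg hMh hℓ hm).1
  have hlen := h.stepLength_ge hm hMg hMh hη hθ.1 hℓ (safetyRatio_mul_le hm hMg hη hℓ hℓL hθ)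
    hβ hsmall
  set C := rateConst m γ p.Mg p.Mh ℓ
  set q := barrierGradEst 𝓜 𝓟 p θ b
  set τ := stepSize 𝓜 𝓟 p θ b
  set g := 𝓜.barrierGrad 𝓟 p.η θ
  set Wθ := v - 𝓜.barrier 𝓟 p.η θ - z with hWθ
  have hdec : v - 𝓜.barrier 𝓟 p.η θ' - z ≤ Wθ - 2 / 5 * τ * ‖q‖ ^ 2 := by linarith
  have hq0 : 0 < ‖q‖ := by linarith
  rcases le_or_gt Wθ 0 with h0 | h0
  · rw [max_eq_right h0, mul_zero]
    refine max_le ?_ le_rfl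
    have : 0 ≤ 2 / 5 * τ * ‖q‖ ^ 2 := by positivity
    linarith
  · rw [max_eq_left h0.le]
    refine max_le ?_ (by positivity)
    have hgq : ‖g‖ ≤ 51 / 50 * ‖q‖ := by
      have := norm_sub_norm_le g q
      rw [norm_sub_rev] at this
      linarith
    have hW1 : Wθ ≤ p.Mg * (‖g‖ / μF) - p.Mg * (2 * dampRatio m p.Mg * p.η / μF) := by
      have h1 : -Λ ≤ ∑ i : Fin m, Real.log (𝓜.V 𝓟 i.succ θ) := (abs_le.1 hΛ).1
      have h2 := mul_le_mul_of_nonneg_left h1 hη.le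
      rw [hWθ, CMDP.barrier, hz]
      linarith
    -- A gap above the floor `z` forces a large gradient, because `z` contains the gap that a
    -- gradient of norm 2 `dampRatio` η would explain. This is the regime in which the step length
    -- bound holds.
    have hgl : 2 * dampRatio m p.Mg * p.η < ‖g‖ := by
      rw [← mul_sub, ← sub_div] at hW1
      have h3 := pos_of_mul_pos_right (h0.trans_le hW1) hMg.le
      have h4 : 0 < ‖g‖ - 2 * dampRatio m p.Mg * p.η := by
        rcases div_pos_iff.1 h3 with h5 | h5
        · exact h5.1
        · linarith [h5.2]
      linarith
    have hlen' := hlen (by linarith)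
    have hW2 : Wθ * μF ≤ p.Mg * (51 / 50 * ‖q‖) := by
      have hdr : 0 ≤ p.Mg * (2 * dampRatio m p.Mg * p.η / μF) := by
        rw [dampRatio]; positivity
      have h5 : Wθ ≤ p.Mg * (‖g‖ / μF) := by linarith
      have h6 := mul_le_mul_of_nonneg_right h5 hμF.le
      have h7 : p.Mg * (‖g‖ / μF) * μF = p.Mg * ‖g‖ := by field_simp
      rw [h7] at h6
      exact h6.trans (mul_le_mul_of_nonneg_left hgq hMg.le)
    -- Gap at most Mg times gradient norm over μF, and step length at least a multiple of η²: the
    -- product is linear in the gap. The constant 51/20 is 51/50 divided by 2/5.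
    have hkey : C * μF * p.η ^ 2 * Wθ ≤ 2 / 5 * τ * ‖q‖ ^ 2 := by
      calc C * μF * p.η ^ 2 * Wθ = C * p.η ^ 2 * (Wθ * μF) := by ring
        _ ≤ C * p.η ^ 2 * (p.Mg * (51 / 50 * ‖q‖)) := by gcongr
        _ = 2 / 5 * (51 / 20 * C * p.Mg * p.η ^ 2) * ‖q‖ := by ring
        _ ≤ 2 / 5 * (τ * ‖q‖) * ‖q‖ := by gcongr
        _ = _ := by ring
    have hexp := Real.one_sub_le_exp_neg (C * μF * p.η ^ 2)
    have h8 := mul_le_mul_of_nonneg_right hexp h0.le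
    linarith

/-- The optimality gap of the output of a run with accurate batches. -/
theorem value_sub_iterate_le (hm : 1 ≤ m) (hB : 𝓜.BoundedScore 𝓟 p.Mg p.Mh) (hMg : 0 < p.Mg)
    (hMh : 0 < p.Mh) (hη : 0 < p.η) (hℓ : 0 < ℓ) (hℓL : ℓ ≤ lipConst γ p.Mg)
    (hην : p.η ≤ νemf) (hE : 𝓜.ExtendedMFCQ 𝓟 νemf ℓ)
    (hopt : 𝓜.IsOptimalPolicy πopt) (hμF : 0 < μF) (hF : 𝓜.RelaxedFisher 𝓟 μF)
    (hε : 𝓜.BoundedTransferError 𝓟 πopt ε) (hsmall : IsSmall m γ p.Mg p.Mh ℓ p.η)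
    (hθ₀ : θ₀ ∈ wellInside 𝓜 𝓟 p ℓ) {b : ℕ → Batch S A p} {T : ℕ}
    (hacc : ∀ t < T, iterate 𝓜 𝓟 p θ₀ b t ∈ wellInside 𝓜 𝓟 p ℓ →
      StepAccurate 𝓜 𝓟 p (iterate 𝓜 𝓟 p θ₀ b t) (b t) ∧ ∀ i : Fin m,
        |upperSlope 𝓜 𝓟 p (iterate 𝓜 𝓟 p θ₀ b t) i (b t)| ≤ 2 * lipConst γ p.Mg) :
    𝓜.value 0 πopt - 𝓜.V 𝓟 0 (iterate 𝓜 𝓟 p θ₀ b T)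
      ≤ √ε / (1 - γ) * (1 + m / safetyRatio m γ p.Mg ℓ)
        + (p.Mg + 2 * p.Mg * dampRatio m p.Mg) * (p.η / μF)
        + (m + 2 * logBound m γ p.Mg ℓ) * (p.η * max 1 (Real.log (1 / p.η)))
        + Real.exp (-(rateConst m γ p.Mg p.Mh ℓ) * μF * T * p.η ^ 2)
          * (𝓜.value 0 πopt - 𝓜.V 𝓟 0 θ₀) := by
  have hγ := 𝓜.one_sub_pos
  have hL := lipConst_pos 𝓜 hMg
  have hc := safetyRatio_pos (m := m) hL hℓ
  have hgap := fun {θ : EuclideanSpace ℝ (Fin d)} (hθ : θ ∈ wellInside 𝓜 𝓟 p ℓ) =>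
    value_sub_le_of_wellInside (πopt := πopt) hm hB hMg hη hℓ hℓL hopt.1 hμF hF hε hθ
  have hlog := fun {θ : EuclideanSpace ℝ (Fin d)} (hθ : θ ∈ wellInside 𝓜 𝓟 p ℓ) =>
    abs_sum_log_le (𝓟 := 𝓟) hm hMg hη hℓ hℓL hθ
  have hLB := logBound_nonneg (m := m) 𝓜.γ_pos 𝓜.γ_lt_one hMg hℓ hℓL
  have hgap0 : 0 ≤ 𝓜.value 0 πopt - 𝓜.V 𝓟 0 θ₀ :=
    sub_nonneg.2 (hopt.2 (𝓟.policy θ₀) fun i => (hθ₀.1 i).le)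
  set N := max 1 (Real.log (1 / p.η)) with hN
  have hN1 : 1 ≤ N := le_max_left _ _
  set Λ := logBound m γ p.Mg ℓ * N with hΛ
  have hΛ0 : 0 ≤ Λ := by positivity
  set y := m * p.η + √ε / (1 - γ) * (1 + m / safetyRatio m γ p.Mg ℓ) with hy
  set z := y + p.Mg * (2 * dampRatio m p.Mg * p.η / μF) + p.η * Λ with hz
  set r := Real.exp (-(rateConst m γ p.Mg p.Mh ℓ * μF * p.η ^ 2)) with hr
  have hdr : 0 ≤ p.Mg * (2 * dampRatio m p.Mg * p.η / μF) := by rw [dampRatio]; positivity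
  have hmain := state_of_stepAccurate (W := fun θ => 𝓜.value 0 πopt - 𝓜.barrier 𝓟 p.η θ - z)
    (r := r) hB hMg hMh hη hℓ hℓL hην hE hθ₀ (fun t ht hin => (hacc t ht hin).1)
    (Real.exp_pos _).le (fun t ht hin hg => (hacc t ht hin).1.contract hm hB hMg hMh hη hℓ hℓL
      hμF hin (hacc t ht hin).2 hsmall hg (hgap hin) (hlog hin) rfl rfl) T le_rfl
  have hrT : Real.exp (-(rateConst m γ p.Mg p.Mh ℓ) * μF * T * p.η ^ 2) = r ^ T := by
    rw [hr, ← Real.exp_nat_mul]; congr 1; ring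
  rw [hrT]
  set θT := iterate 𝓜 𝓟 p θ₀ b T
  have hrp : 0 ≤ r ^ T * (𝓜.value 0 πopt - 𝓜.V 𝓟 0 θ₀) :=
    mul_nonneg (pow_nonneg (Real.exp_pos _).le _) hgap0
  have e1 : p.Mg * (2 * dampRatio m p.Mg * p.η / μF)
      = 2 * p.Mg * dampRatio m p.Mg * (p.η / μF) := by ring
  have e2 : p.η * Λ = logBound m γ p.Mg ℓ * (p.η * N) := by rw [hΛ]; ring
  have e3 : 0 ≤ p.Mg * (p.η / μF) := by positivity
  have e4 : 0 ≤ p.η * Λ := by positivity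
  have e5 : m * p.η ≤ m * (p.η * N) :=
    mul_le_mul_of_nonneg_left (le_mul_of_one_le_right hη.le hN1) (Nat.cast_nonneg m)
  obtain ⟨hin, ⟨-, hn⟩ | ⟨-, hn⟩⟩ := hmain
  · have h1 := hgap hin
    have h2 : p.Mg * (‖𝓜.barrierGrad 𝓟 p.η θT‖ / μF) ≤ p.Mg * (p.η / μF) := by gcongr
    linarith
  · have h1 := (le_max_left _ _).trans hn
    -- The floor contains η Λ, which covers the logarithms of the initial barrier, so the
    -- contraction starts from the plain value gap.
    have h2 : max (𝓜.value 0 πopt - 𝓜.barrier 𝓟 p.η θ₀ - z) 0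
        ≤ 𝓜.value 0 πopt - 𝓜.V 𝓟 0 θ₀ := by
      refine max_le ?_ hgap0
      have h3 := mul_le_mul_of_nonneg_left (neg_le_of_abs_le (hlog hθ₀)) hη.le
      have hy0 : 0 ≤ y := by positivity
      rw [CMDP.barrier]
      linarith
    have h3 := mul_le_mul_of_nonneg_left h2 (pow_nonneg (Real.exp_pos
      (-(rateConst m γ p.Mg p.Mh ℓ * μF * p.η ^ 2))).le T)
    have h4 := mul_le_mul_of_nonneg_left (le_of_abs_le (hlog hin)) hη.le
    rw [CMDP.barrier] at h1
    linarith

/-- With probability at least `1 - m T δ` all steps taken well inside the feasible set are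
accurate. -/
theorem IsRun.measure_stepAccurate_ge {T : ℕ} {Ω : Type w} [MeasurableSpace Ω] {μ : Measure Ω}
    [IsProbabilityMeasure μ] {ξ : ℕ → Ω → Batch S A p} (hrun : IsRun 𝓜 𝓟 p θ₀ T μ ξ) (hm : 1 ≤ m)
    (hB : 𝓜.BoundedScore 𝓟 p.Mg p.Mh) (hMg : 0 < p.Mg) (hMh : 0 < p.Mh) (hη : 0 < p.η)
    (hn : 0 < p.n) (hδ : 0 < p.δ) (hδ1 : p.δ ≤ 1) (hℓ : 0 < ℓ) (hℓL : ℓ ≤ lipConst γ p.Mg)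
    (hη1 : p.η * (1 - γ) ≤ 1)
    (hσ : totalError m γ p
      ≤ tolerance m p.Mg * (safetyRatio m γ p.Mg ℓ * p.η) ^ 2 * (1 - γ) ^ 3) {Γ : Set Ω}
    (hΓ : ∀ ω, (∀ t < T, iterate 𝓜 𝓟 p θ₀ (fun s => ξ s ω) t ∈ wellInside 𝓜 𝓟 p ℓ →
      StepAccurate 𝓜 𝓟 p (iterate 𝓜 𝓟 p θ₀ (fun s => ξ s ω) t) (ξ t ω) ∧ ∀ i : Fin m,
        |upperSlope 𝓜 𝓟 p (iterate 𝓜 𝓟 p θ₀ (fun s => ξ s ω) t) i (ξ t ω)|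
          ≤ 2 * lipConst γ p.Mg) → ω ∈ Γ) :
    1 - m * T * p.δ ≤ μ.real Γ := by
  have hγ := 𝓜.one_sub_pos
  have hγ0 := 𝓜.γ_pos
  have h1 := hrun.measure_accurate_ge hB hMg hn hδ hδ1 (Γ := Γ) fun ω hω => hΓ ω
    fun t ht hw => by
      refine Accurate.stepAccurate_of_wellInside hm ((hω t ht hw.1).mono ?_ le_rfl) hB
        hMg hMh hη hδ hℓ hℓL hη1 hw hσ
      refine mul_le_mul_of_nonneg_left ?_ (by positivity)
      rw [totalError]
      have : γ ^ p.H ≤ γ ^ p.H * (1 + p.H) :=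
        le_mul_of_one_le_right (by positivity) (by linarith [Nat.cast_nonneg (α := ℝ) p.H])
      linarith
  -- The union bound already gives failure probability T δ; the factor m only weakens it.
  have hm' : (1 : ℝ) ≤ m := by exact_mod_cast hm
  have h2 : (0 : ℝ) ≤ T * p.δ := by positivity
  refine le_trans ?_ h1
  nlinarith

theorem value_sub_V_le (𝓜 : CMDP S A m γ) (𝓟 : PolicyClass S A d) (i : Fin (m + 1))
    (π : Kernel S A) [IsMarkovKernel π] (θ : EuclideanSpace ℝ (Fin d)) :
    𝓜.value i π - 𝓜.V 𝓟 i θ ≤ 2 / (1 - γ) := by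
  have hv := (abs_le.1 (𝓜.abs_value_le i π)).2
  have hv' := (abs_le.1 (𝓜.abs_value_le i (𝓟.policy θ))).1
  rw [← CMDP.V] at hv'
  have h2 : 2 / (1 - γ) = 1 / (1 - γ) + 1 / (1 - γ) := by ring
  linarith

/-- The safety ratio is at most one, so 1 + m / c is at most (1 + m) / c; writing c out gives the
powers of ℓ and 1 - γ. -/
theorem bias_term_le {Mg : ℝ} (hγ1 : γ < 1) (hMg : 0 < Mg) (hℓ : 0 < ℓ)
    (hℓL : ℓ ≤ lipConst γ Mg) {e : ℝ} (he : 0 ≤ e) :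
    e / (1 - γ) * (1 + m / safetyRatio m γ Mg ℓ)
      ≤ (1 + m) * (30 * (m + 2) * Mg) ^ m * (e / (ℓ ^ m * (1 - γ) ^ (2 * m + 1))) := by
  have h1 : 0 < 1 - γ := by linarith
  have hL : 0 < lipConst γ Mg := hℓ.trans_le hℓL
  have hc := safetyRatio_pos (m := m) hL hℓ
  have hc1 := safetyRatio_le_one (m := m) hL hℓ hℓL
  have h2 : 1 + m / safetyRatio m γ Mg ℓ ≤ (1 + m) / safetyRatio m γ Mg ℓ := by
    rw [add_div]
    have : 1 ≤ 1 / safetyRatio m γ Mg ℓ := by rwa [le_div_iff₀ hc, one_mul]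
    linarith
  refine (mul_le_mul_of_nonneg_left h2 (by positivity)).trans (le_of_eq ?_)
  rw [safetyRatio_eq hγ1 hMg, pow_succ]
  field_simp

end LBSGD

/-! ### Choice of the constants and conclusion. -/

theorem theorem4 (m : ℕ) (hm : 1 ≤ m) (Mg Mh : ℝ) (hMg : 0 < Mg) (hMh : 0 < Mh) :
    ∃ K₁ > (0 : ℝ), ∃ K₂ > (0 : ℝ), ∃ K₄ > (0 : ℝ), ∃ Kn > (0 : ℝ),
    ∀ γ : ℝ, 0 < γ → γ < 1 → ∃ KH > (0 : ℝ),
    ∀ ℓ : ℝ, 0 < ℓ → ℓ ≤ LBSGD.lipConst γ Mg → ∃ K₃ > (0 : ℝ),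
    ∀ (S : Type u) (A : Type v) [MeasurableSpace S] [MeasurableSpace A] (d : ℕ)
      (𝓜 : CMDP S A m γ) (𝓟 : PolicyClass S A d)
      (πopt : Kernel S A) [IsMarkovKernel πopt] (θ₀ : EuclideanSpace ℝ (Fin d))
      (νs νemf μF εbias η δ : ℝ) (T n H : ℕ),
      𝓜.IsOptimalPolicy πopt →
      𝓜.BoundedScore 𝓟 Mg Mh →
      𝓜.Slater 𝓟 θ₀ νs →
      0 < νemf → νemf ≤ νs → 𝓜.ExtendedMFCQ 𝓟 νemf ℓ →
      0 < μF → 𝓜.RelaxedFisher 𝓟 μF →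
      0 ≤ εbias → 𝓜.BoundedTransferError 𝓟 πopt εbias →
      0 < δ → δ ≤ 1 → 0 < η → η ≤ νemf →
      Kn * (Real.log (2 / δ) / (η ^ 4 * ℓ ^ (4 * m) * (1 - γ) ^ (6 + 8 * m))) ≤ n →
      KH * max 1 (Real.log (1 / (ℓ * η))) ≤ H →
      ∀ (Ω : Type w) [MeasurableSpace Ω] (μ : Measure Ω) [IsProbabilityMeasure μ]
        (ξ : ℕ → Ω → LBSGD.Batch S A ⟨Mg, Mh, η, δ, n, H⟩),
        LBSGD.IsRun 𝓜 𝓟 ⟨Mg, Mh, η, δ, n, H⟩ θ₀ T μ ξ →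
        1 - m * T * δ ≤
          μ.real {ω | ∀ t ≤ T, ∀ i : Fin m,
            0 ≤ 𝓜.V 𝓟 i.succ
              (LBSGD.iterate 𝓜 𝓟 ⟨Mg, Mh, η, δ, n, H⟩ θ₀ (fun s => ξ s ω) t)} ∧
        1 - m * T * δ ≤
          μ.real {ω |
            𝓜.value 0 πopt
              - 𝓜.V 𝓟 0 (LBSGD.iterate 𝓜 𝓟 ⟨Mg, Mh, η, δ, n, H⟩ θ₀ (fun s => ξ s ω) T)
            ≤ K₁ * (√εbias / (ℓ ^ m * (1 - γ) ^ (2 * m + 1)))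
              + K₂ * (η / μF)
              + K₃ * (η * max 1 (Real.log (1 / η)))
              + K₄ * Real.exp (-(LBSGD.rateConst m γ Mg Mh ℓ) * μF * T * η ^ 2)
                  * (𝓜.value 0 πopt - 𝓜.V 𝓟 0 θ₀)} := by
  set D : ℝ := (30 * (m + 2) * Mg) ^ m with hD
  have hD0 : 0 < D := by positivity
  have hκ := LBSGD.tolerance_pos m hMg
  have hdr : 0 < LBSGD.dampRatio m Mg := by rw [LBSGD.dampRatio]; positivity
  refine ⟨(1 + m) * D, by positivity, Mg + 2 * Mg * LBSGD.dampRatio m Mg, by positivity, 1,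
    one_pos, ((4 * m + 8) * (2 * D ^ 2) / LBSGD.tolerance m Mg) ^ 2, by positivity,
    fun γ hγ hγ1 => ?_⟩
  have h1γ : 0 < 1 - γ := by linarith
  obtain ⟨KH, hKH, hhor⟩ := LBSGD.exists_horizon hγ hγ1 hMg hm
  refine ⟨KH, hKH, fun ℓ hℓ hℓL => ?_⟩
  have hL : 0 < LBSGD.lipConst γ Mg := hℓ.trans_le hℓL
  obtain ⟨η₀, hη₀, hsmall⟩ := LBSGD.exists_isSmall hγ1 hMg hMh hℓ hm
  have hLB := LBSGD.logBound_nonneg (m := m) hγ hγ1 hMg hℓ hℓL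
  -- The last summand handles η > η₀, where the rate analysis is unavailable: there the trivial
  -- bound 2 / (1 - γ) on the gap is at most a constant times η.
  refine ⟨m + 2 * LBSGD.logBound m γ Mg ℓ + 2 / (1 - γ) / η₀, by positivity, ?_⟩
  intro S A _ _ d 𝓜 𝓟 πopt _ θ₀ νs νemf μF εbias η δ T n H hopt hB hSl hνemf hνs hE hμF hF hε0 hε
    hδ hδ1 hη hην hn hH Ω _ μ _ ξ hrun
  -- Slater's condition and m ≥ 1 give η ≤ V i at the starting point, and values never exceed 1 / (1
  -- - γ).
  have hη1 : η * (1 - γ) ≤ 1 := by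
    have h1 := hSl.2 ⟨0, hm⟩
    have h2 := (abs_le.1 (𝓜.abs_value_le (Fin.succ ⟨0, hm⟩) (𝓟.policy θ₀))).2
    rw [← CMDP.V] at h2
    rw [← le_div_iff₀ h1γ]
    linarith
  have hin : θ₀ ∈ LBSGD.wellInside 𝓜 𝓟 ⟨Mg, Mh, η, δ, n, H⟩ ℓ :=
    LBSGD.mem_wellInside_of_le hMg hη hℓ fun i => (hην.trans hνs).trans (hSl.2 i)
  obtain ⟨hn0, hstat⟩ := LBSGD.statError_le hγ1 hMg hη hℓ m hδ hδ1 hn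
  have hσ : LBSGD.totalError m γ ⟨Mg, Mh, η, δ, n, H⟩ ≤ LBSGD.tolerance m Mg
      * (LBSGD.safetyRatio m γ Mg ℓ * η) ^ 2 * (1 - γ) ^ 3 := by
    have := hhor ℓ η hℓ hη hη1 H hH
    rw [LBSGD.totalError]
    linarith
  have hprob := fun Γ : Set Ω => hrun.measure_stepAccurate_ge (Γ := Γ) hm hB hMg hMh hη hn0 hδ hδ1
    hℓ hℓL hη1 hσ
  refine ⟨hprob _ fun ω hω t ht i => ?_, hprob _ fun ω hω => ?_⟩
  -- Feasibility needs no contracting function, so the zero function with rate one is supplied.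
  · exact ((LBSGD.state_of_stepAccurate (W := fun _ => 0) (r := 1) hB hMg hMh hη hℓ hℓL hην hE hin
      (fun t ht hw => (hω t ht hw).1) zero_le_one (fun t ht _ _ => by simp) t ht).1.1 i).le
  · rw [Set.mem_ofPred_eq]
    have hgap0 : 0 ≤ 𝓜.value 0 πopt - 𝓜.V 𝓟 0 θ₀ :=
      sub_nonneg.2 (hopt.2 (𝓟.policy θ₀) fun i => (hin.1 i).le)
    have hN1 : 1 ≤ max 1 (Real.log (1 / η)) := le_max_left _ _
    rcases le_or_gt η η₀ with hs | hs
    · refine (LBSGD.value_sub_iterate_le hm hB hMg hMh hη hℓ hℓL hην hE hopt hμF hF hε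
        (hsmall η hs) hin hω).trans ?_
      rw [one_mul]
      refine add_le_add_left (add_le_add (add_le_add_left
        (LBSGD.bias_term_le hγ1 hMg hℓ hℓL (Real.sqrt_nonneg _)) _) ?_) _
      refine mul_le_mul_of_nonneg_right (le_add_of_nonneg_right ?_) ?_ <;> positivity
    · refine (LBSGD.value_sub_V_le 𝓜 𝓟 0 πopt _).trans ?_
      have h1 : 2 / (1 - γ) ≤ (m + 2 * LBSGD.logBound m γ Mg ℓ + 2 / (1 - γ) / η₀)
          * (η * max 1 (Real.log (1 / η))) := by
        have h2 : η₀ ≤ η * max 1 (Real.log (1 / η)) :=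
          hs.le.trans (le_mul_of_one_le_right hη.le hN1)
        have h3 : 2 / (1 - γ) = 2 / (1 - γ) / η₀ * η₀ := (div_mul_cancel₀ _ hη₀.ne').symm
        refine h3.le.trans (mul_le_mul ?_ h2 hη₀.le (by positivity))
        exact le_add_of_nonneg_left (by positivity)
      refine h1.trans ?_
      rw [add_assoc]
      refine le_trans ?_ (add_le_add_left (le_add_of_nonneg_left ?_) _)
      · exact le_add_of_nonneg_right (by positivity)
      · positivity
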